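/- A typical base station with $M\ge 1$ antennas sits at the origin; its cell is the disk $D$ of radius $R>0$. It serves $K\ge1$ users $x_1,\dots,x_K$, each uniformly distributed in $D$; user $x_k$ uses the $k$-th of $K$ orthogonal pilots. For each $k$ the users outside $D$ that reuse the $k$-th pilot form a homogeneous Poisson point process $\Phi_k$ on $\mathbb{R}^2\setminus D$ of intensity $\lambda$, where $\lambda\pi R^2=1$; all the $x_k$ and $\Phi_k$ are independent. Let $\Phi=\bigcup_k\Phi_k$. The user at $x$ has the large-scale fading coefficient $\beta_x=p_x\eta_x$ with path loss $p_x=A_0$ for $|x|<d_0$ and $p_x=A_0(|x|/d_0)^{-\gamma}$ for $|x|\ge d_0$ (where $A_0>0$, $0<d_0\le R$, $\gamma>2$). The shadowing coefficients $\eta_x$ are i.i.d., independent of the locations, and log-normal with standard deviation $\sigma\geq 0$ in dB, i.e. $10\log_{10}\eta_x\sim N(0,\sigma^2)$. The channel vector is $\mathbf g_x=\sqrt{\beta_x}\,\mathbf h_x$, where the small-scale fading vectors $\mathbf h_x\sim\mathcal{CN}(0,\mathbf I_M)$ are i.i.d. and independent of locations and shadowing. Noise is neglected. Put $$\alpha_k=\beta_{x_k}+\sum_{x\in\Phi_k}\beta_x,\qquad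 \widehat{\mathbf g}_{x_k}=\frac{\beta_{x_k}}{\alpha_k}\Big(\mathbf g_{x_k}+\sum_{x\in\Phi_k}\mathbf g_x\Big),\qquad \mathbf w_k=\sqrt{\frac{\alpha_k}{M}}\,\frac{\widehat{\mathbf g}_{x_k}}{\|\widehat{\mathbf g}_{x_k}\|}$$ (linear MMSE channel estimate, with the sum over $\Phi_k$ taken in mean square, and maximum ratio combining, MRC). With $\mathbb E_{\mathbf h}$ the expectation over the small-scale fading only, the inter-cell interference and the pilot-contamination interference of MRC for the user $x_k$ are $$I_{\mathrm{inter}}^{\mathrm{MRC}}=\mathbb E_{\mathbf h}\Big\{\sum_{y\in\Phi\setminus\Phi_k}|\mathbf w_k^{\mathrm H}\mathbf g_y|^2\Big\}+\frac{\alpha_k}{M}\sum_{y\in\Phi_k}\beta_y,\qquad I_{\mathrm{cont}}^{\mathrm{MRC}}=\mathbb E_{\mathbf h}\Big\{\sum_{y\in\Phi_k}|\mathbf w_k^{\mathrm H}\mathbf g_y|^2\Big\}-\frac{\alpha_k}{M}\sum_{y\in\Phi_k}\beta_y .$$ Let $l=d_0/R$, $\xi=10/\ln 10$ and $\mu=e^{\sigma^2/\xi^2}$.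 Then, over the locations and the shadowing, both interferences have finite second moments, and $$\operatorname{var}[I_{\mathrm{inter}}^{\mathrm{MRC}}]=\frac{l^{4\gamma}A_0^4\mu^2}{M^2}\Bigg[\frac{\mu^6}{2\gamma-1}+\frac{4(\gamma l^{2-\gamma}+2K)\mu^3}{(3\gamma-2)(\gamma-2)}+\frac{(K\gamma l^{2-2\gamma}+1)\mu^2}{(\gamma-1)^2}+\frac{4K(2\gamma l^{2-\gamma}+K\gamma l^{2-2\gamma}-1)\mu}{(\gamma-1)(\gamma-2)^2}-\frac{4K^2(\gamma l^{2-\gamma}-2)^2}{(\gamma-2)^4}\Bigg],$$ $$\operatorname{var}[I_{\mathrm{cont}}^{\mathrm{MRC}}]=\frac{(M-1)^2\,l^{4\gamma}A_0^4\mu^8}{M^2(2\gamma-1)} .$$ -/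

import Mathlib

open MeasureTheory ProbabilityTheory
open scoped ENNReal NNReal

noncomputable section

namespace MassiveMIMO

/-! ### Small-scale fading

Throughout, `K` is the number of users in the typical cell (equivalently, of pilots) and `M` the
number of antennas. A user is indexed by a pair `(k, j)`: `(k, none)` is the user `x_k` of the
typical cell to which the pilot `k` is assigned, and `(k, some n)` is the `n`-th point of the
process `Φ_k` of the users outside the typical cell that reuse the pilot `k`. -/

/-- The law `CN(0, 1)`: real and imaginary part are independent `N(0, 1/2)`. -/
def complexGaussian : Measure ℂ :=
  ((gaussianReal 0 (1 / 2)).prod (gaussianReal 0 (1 / 2))).map fun z => (⟨z.1, z.2⟩ : ℂ)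

/-- All small-scale fading coefficients: user `(k, j)`, antenna `m`. -/
abbrev Fading (K M : ℕ) : Type := Fin K × Option ℕ × Fin M → ℂ

/-- The small-scale fading coefficients are i.i.d. `CN(0, 1)`. -/
def fadingLaw (K M : ℕ) : Measure (Fading K M) := Measure.infinitePi fun _ => complexGaussian

lemma measurable_complexMk : Measurable fun z : ℝ × ℝ => (⟨z.1, z.2⟩ : ℂ) :=
  Complex.measurableEquivRealProd.symm.measurable

instance : IsProbabilityMeasure complexGaussian :=
  Measure.isProbabilityMeasure_map measurable_complexMk.aemeasurable

instance (K M : ℕ) : IsProbabilityMeasure (fadingLaw K M) := by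
  unfold fadingLaw; infer_instance

/-- The small-scale fading vector `h_x ∈ ℂ^M` of the user `(k, j)`. -/
def fadingVec {K M : ℕ} (k : Fin K) (j : Option ℕ) (h : Fading K M) : EuclideanSpace ℂ (Fin M) :=
  WithLp.toLp 2 fun m => h (k, j, m)

/-- The channel vector `g_x = √β_x h_x` of the user `(k, j)`, given the large-scale fading
coefficients `β`. -/
def channel {K M : ℕ} (β : Fin K → Option ℕ → ℝ) (k : Fin K) (j : Option ℕ) (h : Fading K M) :
    EuclideanSpace ℂ (Fin M) :=
  ((√(β k j) : ℝ) : ℂ) • fadingVec k j h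

lemma memLp_complexGaussian : MemLp (fun z : ℂ => z) 2 complexGaussian := by
  have hm : AEStronglyMeasurable (fun z : ℂ => z) complexGaussian :=
    measurable_id.aestronglyMeasurable
  unfold complexGaussian at hm ⊢
  rw [memLp_map_measure_iff hm measurable_complexMk.aemeasurable]
  have h1 : MemLp (fun z : ℝ × ℝ => z.1) 2
      ((gaussianReal 0 (1 / 2)).prod (gaussianReal 0 (1 / 2))) :=
    (memLp_id_gaussianReal' 2 (by simp)).comp_fst _
  have h2 : MemLp (fun z : ℝ × ℝ => z.2) 2
      ((gaussianReal 0 (1 / 2)).prod (gaussianReal 0 (1 / 2))) :=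
    (memLp_id_gaussianReal' 2 (by simp)).comp_snd _
  refine MemLp.of_le (h1.norm.add h2.norm) measurable_complexMk.aestronglyMeasurable
    (Filter.Eventually.of_forall fun z => ?_)
  refine (Complex.norm_le_abs_re_add_abs_im _).trans ?_
  exact le_abs_self (|z.1| + |z.2|)

lemma memLp_channel {K M : ℕ} (β : Fin K → Option ℕ → ℝ) (k : Fin K) (j : Option ℕ) :
    MemLp (channel (M := M) β k j) 2 (fadingLaw K M) := by
  have h : MemLp (fadingVec (M := M) k j) 2 (fadingLaw K M) := by
    refine MemLp.of_eval_piLp fun m => ?_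
    exact memLp_complexGaussian.comp_measurePreserving
      (measurePreserving_eval_infinitePi (fun _ => complexGaussian) (k, j, m))
  exact h.const_smul ((√(β k j) : ℝ) : ℂ)

/-- `α_k = β_{x_k} + ∑_{x ∈ Φ_k} β_x` (noise neglected). -/
def alpha {K : ℕ} (β : Fin K → Option ℕ → ℝ) (k : Fin K) : ℝ :=
  β k none + ∑' n, β k (some n)

/-- The noise-free despread pilot signal `g_{x_k} + ∑_{x ∈ Φ_k} g_x`; the series over the
infinitely many pilot-reusing users is summed in the mean-square sense. -/
def pilotSignal {K : ℕ} (M : ℕ) (β : Fin K → Option ℕ → ℝ) (k : Fin K) :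
    Lp (EuclideanSpace ℂ (Fin M)) 2 (fadingLaw K M) :=
  (memLp_channel β k none).toLp (channel β k none) +
    ∑' n, (memLp_channel β k (some n)).toLp (channel β k (some n))

/-- The linear MMSE channel estimate of the typical user,
`ĝ_{x_k} = C_{x_k} (g_{x_k} + ∑_{x ∈ Φ_k} g_x)` with `C_{x_k} = β_{x_k} / α_k`. -/
def estimate {K M : ℕ} (β : Fin K → Option ℕ → ℝ) (k : Fin K) (h : Fading K M) :
    EuclideanSpace ℂ (Fin M) :=
  ((β k none / alpha β k : ℝ) : ℂ) • (pilotSignal M β k) h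

/-- The MRC vector `w_k = √(α_k / M) ĝ_{x_k} / ‖ĝ_{x_k}‖`. -/
def mrc {K M : ℕ} (β : Fin K → Option ℕ → ℝ) (k : Fin K) (h : Fading K M) :
    EuclideanSpace ℂ (Fin M) :=
  ((√(alpha β k / M) / ‖estimate β k h‖ : ℝ) : ℂ) • estimate β k h

/-- The power `|w_k^H g_y|²` received through the MRC vector `w_k` from the user `y = (k', j)`. -/
def mrcPower {K M : ℕ} (β : Fin K → Option ℕ → ℝ) (k k' : Fin K) (j : Option ℕ)
    (h : Fading K M) : ℝ :=
  ‖inner ℂ (mrc β k h) (channel β k' j h)‖ ^ 2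

/-- The part `(α_k / M) ∑_{y ∈ Φ_k} β_y` of the interference from the pilot-reusing users which,
by convention, is counted as inter-cell interference. -/
def reuseNonCoherent {K : ℕ} (M : ℕ) (β : Fin K → Option ℕ → ℝ) (k : Fin K) : ℝ :=
  alpha β k / M * ∑' n, β k (some n)

/-- MRC inter-cell interference, averaged over small-scale fading given the large-scale fading:
`E {∑_{y ∈ Φ \ Φ_k} |w_k^H g_y|²} + (α_k / M) ∑_{y ∈ Φ_k} β_y`. -/
def interInterference {K : ℕ} (M : ℕ) (β : Fin K → Option ℕ → ℝ) (k : Fin K) : ℝ :=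
  (∫ h, ∑' y : {k' : Fin K // k' ≠ k} × ℕ, mrcPower β k y.1 (some y.2) h ∂(fadingLaw K M)) +
    reuseNonCoherent M β k

/-- Interference from the pilot-reusing users, averaged over small-scale fading:
`I_re = E {∑_{y ∈ Φ_k} |w_k^H g_y|²}`. -/
def reuseInterference {K : ℕ} (M : ℕ) (β : Fin K → Option ℕ → ℝ) (k : Fin K) : ℝ :=
  ∫ h, ∑' n, mrcPower β k k (some n) h ∂(fadingLaw K M)

/-- MRC interference due to pilot contamination: what remains of `I_re` after
`(α_k / M) ∑_{y ∈ Φ_k} β_y` has been moved to the inter-cell interference. -/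
def contInterference {K : ℕ} (M : ℕ) (β : Fin K → Option ℕ → ℝ) (k : Fin K) : ℝ :=
  reuseInterference M β k - reuseNonCoherent M β k

/-! ### Spatial distribution, path loss and shadowing -/

/-- The plane. -/
abbrev Plane : Type := EuclideanSpace ℝ (Fin 2)

/-- Path loss coefficient `p_x`, with reference distance `d₀` and exponent `γ`. -/
def pathLoss (A₀ d₀ γ : ℝ) (x : Plane) : ℝ :=
  if ‖x‖ < d₀ then A₀ else A₀ * (‖x‖ / d₀) ^ (-γ)

/-- Log-normal shadowing with standard deviation `σ` dB: the law of `10 ^ (u / 10)` for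
`u ~ N(0, σ²)`. -/
def shadowingLaw (σ : ℝ) : Measure ℝ :=
  (gaussianReal 0 (σ ^ 2).toNNReal).map fun u => (10 : ℝ) ^ (u / 10)

/-- The number of points of the sequence `x` in `A`. -/
def pointCount (x : ℕ → Plane) (A : Set Plane) : ℝ≥0∞ :=
  ∑' n, A.indicator 1 (x n)

/-- The points `X 0, X 1, …` form a Poisson point process with intensity measure `Λ`: the numbers
of points in disjoint sets are independent, and the number of points in `A` has the Poisson law
of mean `Λ A` whenever this is finite. -/
structure IsPoissonProcess {Ω : Type*} [MeasurableSpace Ω] (P : Measure Ω) (X : ℕ → Ω → Plane)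
    (Λ : Measure Plane) : Prop where
  measurable : ∀ n, Measurable (X n)
  hasLaw : ∀ A : Set Plane, MeasurableSet A → Λ A ≠ ∞ →
    HasLaw (fun ω => pointCount (fun n => X n ω) A)
      ((poissonMeasure (Λ A).toNNReal).map ((↑) : ℕ → ℝ≥0∞)) P
  indep : ∀ (m : ℕ) (A : Fin m → Set Plane), (∀ i, MeasurableSet (A i)) → (∀ i, Λ (A i) ≠ ∞) →
    Pairwise (Function.onFun Disjoint A) →
    iIndepFun (fun (i : Fin m) ω => pointCount (fun n => X n ω) (A i)) P

/-- The typical cell is the disk of radius `R` about the origin; `loc k none` is the location of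
`x_k`, `loc k (some n)` that of the `n`-th point of `Φ_k`, and `η k j` the shadowing coefficient
of the user `(k, j)`. -/
structure CellularModel {Ω : Type*} [MeasurableSpace Ω] (P : Measure Ω) (K : ℕ) (R lam σ : ℝ)
    (loc : Fin K → Option ℕ → Ω → Plane) (η : Fin K → Option ℕ → Ω → ℝ) : Prop where
  /-- the users of the typical cell are uniformly distributed in it -/
  uniform : ∀ k, pdf.IsUniform (loc k none) (Metric.closedBall 0 R) P volume
  measurable_cell : ∀ k, Measurable (loc k none)
  /-- each `Φ_k` is a homogeneous Poisson process of intensity `lam` outside the typical cell -/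
  poisson : ∀ k, IsPoissonProcess P (fun n => loc k (some n))
    (ENNReal.ofReal lam • volume.restrict (Metric.closedBall 0 R)ᶜ)
  /-- `x_k` and `Φ_k` are independent -/
  indep_cell : ∀ k, IndepFun (loc k none) (fun ω n => loc k (some n) ω) P
  /-- the pairs `(x_k, Φ_k)` are mutually independent -/
  indep_pilot : iIndepFun (fun (k : Fin K) ω j => loc k j ω) P
  measurable_shadowing : ∀ k j, Measurable (η k j)
  /-- the shadowing coefficients are i.i.d. log-normal -/
  shadowing : ∀ k j, HasLaw (η k j) (shadowingLaw σ) P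
  indep_shadowing : iIndepFun (fun (i : Fin K × Option ℕ) ω => η i.1 i.2 ω) P
  /-- the shadowing is independent of the locations -/
  indep_loc_shadowing : IndepFun (fun ω k j => loc k j ω) (fun ω k j => η k j ω) P

/-- The large-scale fading coefficients `β_x = p_x η_x`. -/
def largeScale {Ω : Type*} {K : ℕ} (A₀ d₀ γ : ℝ) (loc : Fin K → Option ℕ → Ω → Plane)
    (η : Fin K → Option ℕ → Ω → ℝ) (ω : Ω) : Fin K → Option ℕ → ℝ :=
  fun k j => pathLoss A₀ d₀ γ (loc k j ω) * η k j ω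

end MassiveMIMO

end

open MeasureTheory ProbabilityTheory
open scoped ENNReal NNReal

noncomputable section

namespace MassiveMIMO

/-! Fix the large-scale coefficients first. The pilot signal `s` of the user `x_k` is a complex
Gaussian vector with covariance `α_k I`, and MRC uses only its direction: `|w_k^H g_y|² = (α_k / M)
β_y |⟨s, h_y⟩|² / ‖s‖²` (`mrcPower_eq`). The pair `(s, h_y)` is jointly Gaussian, so it has the law
of `(√α_k h, a h + b h')` with independent `h`, `h'` and `a² + b² = 1`
(`map_pilotSignal_fadingVec`). The quotient then has mean `a² M + b²`, where `a² = β_y / α_k` if `y`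
uses the pilot `k` and `a = 0` otherwise. Summing over `y` gives `I_inter = (X + S)(S + T) / M` and
`I_cont = (1 - 1/M) ∑_{y ∈ Φ_k} β_y²`, where `X = β_{x_k}`, `S` is the sum of `β` over `Φ_k`, and
`T` is the sum over the other `Φ_{k'}` (`interInterference_eq`, `contInterference_eq`).

Now average over locations and shadowing. `X`, `S`, `T` are independent, and `T` is a sum of `K - 1`
independent copies of `S`. `S` is shot noise of a marked Poisson process, so its Laplace transform
is `exp(-∫ (1 - e^{-t p η}))` (`IsMarkedPoissonProcess.integral_exp_neg_tsum`). Differentiating and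
letting `t → 0` (`moments_of_laplace`) shows that its cumulants are `c_r = ∫ p^r dΛ · E η^r = A₀^r
l^{rγ} · 2 / (rγ - 2) · μ^{r²/2}`, by polar coordinates with `λπR² = 1` and the Gaussian moment
generating function.

The sum of `β²` over `Φ_k` is shot noise as well, and its variance is `∫ p⁴ dΛ · E η⁴ = c_4`; this
is the second formula. For the first, the square of `(X + S)(S + T)` is expanded into monomials,
whose means factor (`variance_add_mul_add`). Two moments of `X` and `T` and four of `S` suffice, and
what remains is a rational identity. -/

/-! ### Characteristic functions of the fading vectors -/

lemma integral_exp_complexGaussian (c : ℂ) :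
    ∫ z, Complex.exp (((starRingEnd ℂ c * z).re : ℝ) * Complex.I) ∂complexGaussian =
      Complex.exp (-(‖c‖ ^ 2 / 4 : ℝ)) := by
  have hc : Continuous fun z : ℂ =>
      Complex.exp (((starRingEnd ℂ c * z).re : ℝ) * Complex.I) := by fun_prop
  unfold complexGaussian
  rw [integral_map measurable_complexMk.aemeasurable hc.aestronglyMeasurable]
  have h1 : ∀ z : ℝ × ℝ, Complex.exp
      (((starRingEnd ℂ c * (⟨z.1, z.2⟩ : ℂ)).re : ℝ) * Complex.I) =
      Complex.exp (c.re * z.1 * Complex.I) * Complex.exp (c.im * z.2 * Complex.I) := by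
    intro z
    rw [← Complex.exp_add]
    congr 1
    simp [Complex.mul_re]
    ring
  simp_rw [h1]
  rw [integral_prod_mul (fun x : ℝ => Complex.exp (c.re * x * Complex.I))
    (fun x : ℝ => Complex.exp (c.im * x * Complex.I))]
  rw [← charFun_apply_real, ← charFun_apply_real, charFun_gaussianReal, charFun_gaussianReal,
    ← Complex.exp_add]
  congr 1
  rw [Complex.sq_norm, Complex.normSq_apply]
  push_cast
  simp
  ring

variable {K M : ℕ}

lemma measurePreserving_fading_eval (i : Fin K × Option ℕ × Fin M) :
    MeasurePreserving (fun h : Fading K M => h i) (fadingLaw K M) complexGaussian :=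
  measurePreserving_eval_infinitePi (fun _ => complexGaussian) i

lemma iIndepFun_fading :
    iIndepFun (fun (i : Fin K × Option ℕ × Fin M) (h : Fading K M) => h i) (fadingLaw K M) :=
  iIndepFun_infinitePi (P := fun _ : Fin K × Option ℕ × Fin M => complexGaussian)
    (X := fun _ z => z) (fun _ => measurable_id)

lemma integral_exp_fading {κ : Type*} [Fintype κ] {e : κ → Fin K × Option ℕ × Fin M}
    (he : Function.Injective e) (c : κ → ℂ) :
    ∫ h : Fading K M, Complex.exp
        ((∑ i, (starRingEnd ℂ (c i) * h (e i)).re : ℝ) * Complex.I) ∂(fadingLaw K M) =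
      Complex.exp (-((∑ i, ‖c i‖ ^ 2) / 4 : ℝ)) := by
  have hi : iIndepFun (fun (i : κ) (h : Fading K M) =>
      Complex.exp (((starRingEnd ℂ (c i) * h (e i)).re : ℝ) * Complex.I)) (fadingLaw K M) := by
    refine (iIndepFun_fading.precomp he).comp (fun i z =>
      Complex.exp (((starRingEnd ℂ (c i) * z).re : ℝ) * Complex.I)) fun i => ?_
    exact (by fun_prop : Continuous fun z : ℂ =>
      Complex.exp (((starRingEnd ℂ (c i) * z).re : ℝ) * Complex.I)).measurable
  have hm : ∀ i, AEStronglyMeasurable (fun (h : Fading K M) =>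
      Complex.exp (((starRingEnd ℂ (c i) * h (e i)).re : ℝ) * Complex.I)) (fadingLaw K M) := by
    intro i
    have h1 : Measurable fun z : ℂ =>
        Complex.exp (((starRingEnd ℂ (c i) * z).re : ℝ) * Complex.I) :=
      (by fun_prop : Continuous fun z : ℂ =>
        Complex.exp (((starRingEnd ℂ (c i) * z).re : ℝ) * Complex.I)).measurable
    exact (h1.comp (measurable_pi_apply (e i))).aestronglyMeasurable
  have h := hi.integral_fun_prod_eq_prod_integral hm
  have h2 : ∀ i, ∫ h : Fading K M, Complex.exp
      (((starRingEnd ℂ (c i) * h (e i)).re : ℝ) * Complex.I) ∂(fadingLaw K M) =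
      Complex.exp (-(‖c i‖ ^ 2 / 4 : ℝ)) := by
    intro i
    rw [← integral_exp_complexGaussian, ← (measurePreserving_fading_eval (e i)).map_eq,
      integral_map (measurable_pi_apply _).aemeasurable]
    exact (by fun_prop : Continuous fun z : ℂ =>
      Complex.exp (((starRingEnd ℂ (c i) * z).re : ℝ) * Complex.I)).aestronglyMeasurable
  simp_rw [h2, ← Complex.exp_sum] at h
  refine (integral_congr_ae (Filter.Eventually.of_forall fun h => ?_)).trans (h.trans ?_)
  · rw [Complex.ofReal_sum, Finset.sum_mul]
  · congr 1
    push_cast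
    rw [Finset.sum_neg_distrib, Finset.sum_div]

/-- A finite real linear combination of small-scale fading vectors. -/
def fadingSum (F : Finset (Fin K × Option ℕ)) (u : Fin K × Option ℕ → ℝ) (h : Fading K M) :
    EuclideanSpace ℂ (Fin M) :=
  ∑ j ∈ F, ((u j : ℝ) : ℂ) • fadingVec j.1 j.2 h

lemma measurable_fadingVec (k : Fin K) (j : Option ℕ) :
    Measurable (fadingVec k j : Fading K M → EuclideanSpace ℂ (Fin M)) := by
  unfold fadingVec
  refine (MeasurableEquiv.toLp 2 (Fin M → ℂ)).measurable.comp ?_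
  exact measurable_pi_lambda _ fun m => measurable_pi_apply _

lemma measurable_fadingSum (F : Finset (Fin K × Option ℕ)) (u : Fin K × Option ℕ → ℝ) :
    Measurable (fadingSum F u : Fading K M → EuclideanSpace ℂ (Fin M)) := by
  unfold fadingSum
  exact Finset.measurable_sum _ fun j _ => (measurable_fadingVec j.1 j.2).const_smul ((u j : ℝ) : ℂ)

/-- The law of two such combinations depends on `u` and `v` only through the sums of `u²`, `uv` and
`v²`. This is what allows the pilot signal, with its infinitely many terms, to be replaced by a
multiple of a single fading vector. -/
lemma integral_exp_fadingSum (F : Finset (Fin K × Option ℕ)) (u v : Fin K × Option ℕ → ℝ)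
    (t t' : EuclideanSpace ℂ (Fin M)) :
    ∫ h : Fading K M, Complex.exp (((inner ℂ t (fadingSum F u h)).re +
        (inner ℂ t' (fadingSum F v h)).re : ℝ) * Complex.I) ∂(fadingLaw K M) =
      Complex.exp (-(((∑ j ∈ F, u j ^ 2) * ‖t‖ ^ 2 + 2 * (∑ j ∈ F, u j * v j) * (inner ℂ t t').re +
        (∑ j ∈ F, v j ^ 2) * ‖t'‖ ^ 2) / 4 : ℝ)) := by
  let e : F × Fin M → Fin K × Option ℕ × Fin M := fun i => (i.1.1.1, i.1.1.2, i.2)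
  have he : Function.Injective e := by
    rintro ⟨⟨⟨a, b⟩, h1⟩, c⟩ ⟨⟨⟨a', b'⟩, h2⟩, c'⟩ h
    simp only [e, Prod.mk.injEq] at h
    obtain ⟨rfl, rfl, rfl⟩ := h
    rfl
  -- The total coefficient, up to conjugation, of the scalar `h (e i)` in the two inner products
  -- together.
  let c : F × Fin M → ℂ := fun i => (u i.1 : ℂ) * t i.2 + (v i.1 : ℂ) * t' i.2
  have hin : ∀ (w : Fin K × Option ℕ → ℝ) (x : EuclideanSpace ℂ (Fin M)) (h : Fading K M),
      inner ℂ x (fadingSum F w h) =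
        ∑ i : F × Fin M, starRingEnd ℂ ((w i.1 : ℂ) * x i.2) * h (e i) := by
    intro w x h
    unfold fadingSum
    rw [inner_sum, ← Finset.sum_coe_sort F, Fintype.sum_prod_type]
    refine Finset.sum_congr rfl fun j _ => ?_
    rw [inner_smul_right, PiLp.inner_apply, Finset.mul_sum]
    refine Finset.sum_congr rfl fun m _ => ?_
    simp [fadingVec, e]
    ring
  have h1 := integral_exp_fading he c
  refine Eq.trans (integral_congr_ae (Filter.Eventually.of_forall fun h => ?_)) (h1.trans ?_)
  · simp only
    rw [hin, hin, ← Complex.add_re, ← Finset.sum_add_distrib, Complex.re_sum]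
    have h2 : ∀ i : F × Fin M, starRingEnd ℂ ((u i.1 : ℂ) * t i.2) * h (e i) +
        starRingEnd ℂ ((v i.1 : ℂ) * t' i.2) * h (e i) = starRingEnd ℂ (c i) * h (e i) := by
      intro i
      simp only [c, map_add]
      rw [add_mul]
    simp_rw [h2]
  · congr 4
    rw [Fintype.sum_prod_type, EuclideanSpace.norm_sq_eq, EuclideanSpace.norm_sq_eq,
      PiLp.inner_apply, Complex.re_sum, ← Finset.sum_coe_sort F, ← Finset.sum_coe_sort F,
      ← Finset.sum_coe_sort F, mul_assoc 2, Finset.sum_mul_sum, Finset.sum_mul_sum,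
      Finset.sum_mul_sum, Finset.mul_sum, ← Finset.sum_add_distrib, ← Finset.sum_add_distrib]
    refine Finset.sum_congr rfl fun j _ => ?_
    rw [Finset.mul_sum, ← Finset.sum_add_distrib, ← Finset.sum_add_distrib]
    refine Finset.sum_congr rfl fun m _ => ?_
    simp only [c, Complex.sq_norm, Complex.normSq_apply]
    simp
    ring

/-! ### Second moments of the fading and mean-square convergence of the pilot signal -/

variable {K M : ℕ}

lemma integral_complexGaussian : ∫ z, z ∂complexGaussian = 0 := by
  have h1 : Integrable (fun z : ℝ × ℝ => z.1)
      ((gaussianReal 0 (1 / 2)).prod (gaussianReal 0 (1 / 2))) :=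
    ((memLp_id_gaussianReal' 1 (by simp)).comp_fst _).integrable le_rfl
  have h2 : Integrable (fun z : ℝ × ℝ => z.2)
      ((gaussianReal 0 (1 / 2)).prod (gaussianReal 0 (1 / 2))) :=
    ((memLp_id_gaussianReal' 1 (by simp)).comp_snd _).integrable le_rfl
  unfold complexGaussian
  rw [integral_map (f := fun z : ℂ => z) measurable_complexMk.aemeasurable (by fun_prop)]
  have h : ∀ z : ℝ × ℝ, (⟨z.1, z.2⟩ : ℂ) = (z.1 : ℂ) + (z.2 : ℂ) * Complex.I := fun z =>
    Complex.mk_eq_add_mul_I _ _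
  simp_rw [h]
  rw [integral_add h1.ofReal (h2.ofReal.mul_const _), integral_mul_const]
  have e1 := integral_fun_fst (μ := gaussianReal 0 (1 / 2)) (ν := gaussianReal 0 (1 / 2))
    (fun x : ℝ => (x : ℂ))
  have e2 := integral_fun_snd (μ := gaussianReal 0 (1 / 2)) (ν := gaussianReal 0 (1 / 2))
    (fun x : ℝ => (x : ℂ))
  have e3 : ∫ x : ℝ, (x : ℂ) ∂(gaussianReal 0 (1 / 2)) = 0 := by
    rw [integral_complex_ofReal, integral_id_gaussianReal]; simp
  rw [e1, e2, e3]
  simp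

lemma integral_sq_complexGaussian : ∫ z, ‖z‖ ^ 2 ∂complexGaussian = 1 := by
  have h1 : Integrable (fun z : ℝ × ℝ => z.1 ^ 2)
      ((gaussianReal 0 (1 / 2)).prod (gaussianReal 0 (1 / 2))) :=
    ((memLp_id_gaussianReal' 2 (by simp)).comp_fst _).integrable_sq
  have h2 : Integrable (fun z : ℝ × ℝ => z.2 ^ 2)
      ((gaussianReal 0 (1 / 2)).prod (gaussianReal 0 (1 / 2))) :=
    ((memLp_id_gaussianReal' 2 (by simp)).comp_snd _).integrable_sq
  unfold complexGaussian
  rw [integral_map measurable_complexMk.aemeasurable (by fun_prop)]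
  have h : ∀ z : ℝ × ℝ, ‖(⟨z.1, z.2⟩ : ℂ)‖ ^ 2 = z.1 ^ 2 + z.2 ^ 2 := fun z => by
    rw [Complex.sq_norm, Complex.normSq_mk]; ring
  simp_rw [h]
  rw [integral_add h1 h2]
  have e1 := integral_fun_fst (μ := gaussianReal 0 (1 / 2)) (ν := gaussianReal 0 (1 / 2))
    (fun x : ℝ => x ^ 2)
  have e2 := integral_fun_snd (μ := gaussianReal 0 (1 / 2)) (ν := gaussianReal 0 (1 / 2))
    (fun x : ℝ => x ^ 2)
  have e3 : ∫ x : ℝ, x ^ 2 ∂(gaussianReal 0 (1 / 2)) = 1 / 2 := by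
    have := variance_fun_id_gaussianReal (μ := 0) (v := 1 / 2)
    rw [variance_of_integral_eq_zero (by fun_prop) (by simp)] at this
    simpa using this
  rw [e1, e2, e3]
  simp
  norm_num

lemma memLp_fading_eval (i : Fin K × Option ℕ × Fin M) :
    MemLp (fun h : Fading K M => h i) 2 (fadingLaw K M) :=
  memLp_complexGaussian.comp_measurePreserving (measurePreserving_fading_eval i)

lemma integral_conj_mul_fading (i i' : Fin K × Option ℕ × Fin M) :
    ∫ h : Fading K M, starRingEnd ℂ (h i) * h i' ∂(fadingLaw K M) = if i = i' then 1 else 0 := by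
  split_ifs with hii
  · subst hii
    have h1 : ∀ h : Fading K M, starRingEnd ℂ (h i) * h i = ((‖h i‖ ^ 2 : ℝ) : ℂ) := fun h => by
      rw [mul_comm, Complex.mul_conj, Complex.normSq_eq_norm_sq]
    simp_rw [h1]
    rw [integral_complex_ofReal]
    have := integral_map (μ := fadingLaw K M) (φ := fun h : Fading K M => h i)
      (measurable_pi_apply i).aemeasurable (f := fun z : ℂ => ‖z‖ ^ 2) (by fun_prop)
    rw [(measurePreserving_fading_eval i).map_eq, integral_sq_complexGaussian] at this
    rw [← this, Complex.ofReal_one]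
  · have hind : IndepFun (fun h : Fading K M => starRingEnd ℂ (h i)) (fun h => h i')
        (fadingLaw K M) :=
      (iIndepFun_fading.indepFun hii).comp (φ := starRingEnd ℂ) (ψ := id)
        Complex.continuous_conj.measurable measurable_id
    have := hind.integral_fun_mul_eq_mul_integral
      (Complex.continuous_conj.measurable.comp (measurable_pi_apply i)).aestronglyMeasurable
      (measurable_pi_apply i').aestronglyMeasurable
    rw [this]
    have h0 : ∫ h : Fading K M, h i' ∂(fadingLaw K M) = 0 := by
      have := integral_map (μ := fadingLaw K M) (φ := fun h : Fading K M => h i')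
        (measurable_pi_apply i').aemeasurable (f := fun z : ℂ => z)
        measurable_id.aestronglyMeasurable
      rw [← this, (measurePreserving_fading_eval i').map_eq, integral_complexGaussian]
    rw [h0, mul_zero]

lemma memLp_fadingVec (k : Fin K) (j : Option ℕ) :
    MemLp (fadingVec (M := M) k j) 2 (fadingLaw K M) :=
  MemLp.of_eval_piLp fun m => memLp_fading_eval (k, j, m)

lemma integrable_conj_mul_fading (i i' : Fin K × Option ℕ × Fin M) :
    Integrable (fun h : Fading K M => starRingEnd ℂ (h i) * h i') (fadingLaw K M) :=
  MemLp.integrable_mul (memLp_fading_eval i).star (memLp_fading_eval i')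

lemma integral_inner_fadingVec (a b : Fin K × Option ℕ) :
    ∫ h : Fading K M, inner ℂ (fadingVec a.1 a.2 h) (fadingVec b.1 b.2 h) ∂(fadingLaw K M) =
      if a = b then (M : ℂ) else 0 := by
  have h1 : ∀ h : Fading K M, inner ℂ (fadingVec a.1 a.2 h) (fadingVec b.1 b.2 h) =
      ∑ m : Fin M, starRingEnd ℂ (h (a.1, a.2, m)) * h (b.1, b.2, m) := fun h => by
    rw [PiLp.inner_apply]
    exact Finset.sum_congr rfl fun m _ => by simp [fadingVec, mul_comm]
  simp_rw [h1]
  rw [integral_finsetSum _ fun m _ => integrable_conj_mul_fading _ _]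
  simp_rw [integral_conj_mul_fading]
  obtain ⟨a1, a2⟩ := a
  obtain ⟨b1, b2⟩ := b
  by_cases h : a1 = b1 ∧ a2 = b2
  · simp [h]
  · have h' : ∀ m : Fin M, ¬ ((a1, a2, m) = (b1, b2, m)) := by
      intro m hm; simp only [Prod.mk.injEq] at hm; exact h ⟨hm.1, hm.2.1⟩
    simp [h', h]

lemma inner_toLp_fadingVec (a b : Fin K × Option ℕ) :
    inner ℂ ((memLp_fadingVec (M := M) a.1 a.2).toLp _) ((memLp_fadingVec b.1 b.2).toLp _) =
      if a = b then (M : ℂ) else 0 := by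
  rw [← integral_inner_fadingVec (K := K), L2.inner_def]
  refine integral_congr_ae ?_
  filter_upwards [(memLp_fadingVec (M := M) a.1 a.2).coeFn_toLp,
    (memLp_fadingVec (M := M) b.1 b.2).coeFn_toLp] with h h1 h2
  rw [h1, h2]

lemma toLp_channel (β : Fin K → Option ℕ → ℝ) (k : Fin K) (j : Option ℕ) :
    (memLp_channel (M := M) β k j).toLp (channel β k j) =
      ((√(β k j) : ℝ) : ℂ) • (memLp_fadingVec k j).toLp _ :=
  (memLp_fadingVec k j).toLp_const_smul ((√(β k j) : ℝ) : ℂ)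

/-- Divided by `√M`, the fading vectors of different users are orthonormal in `L²`, so the series
converges when the squared coefficients `M β` are summable. Convergence is essential: otherwise the
`∑'` in `pilotSignal` would take its default value 0. -/
lemma summable_toLp_channel (hM : 1 ≤ M) {β : Fin K → Option ℕ → ℝ} {k : Fin K}
    (hβ : ∀ n, 0 ≤ β k (some n)) (hs : Summable fun n => β k (some n)) :
    Summable fun n => (memLp_channel (M := M) β k (some n)).toLp (channel β k (some n)) := by
  have hM0 : (0 : ℝ) < M := by exact_mod_cast hM
  have hMs : (√(M : ℝ) : ℂ) ≠ 0 := by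
    exact_mod_cast (Real.sqrt_pos.2 hM0).ne'
  let v : ℕ → Lp (EuclideanSpace ℂ (Fin M)) 2 (fadingLaw K M) := fun n =>
    ((√(M : ℝ) : ℝ) : ℂ)⁻¹ • (memLp_fadingVec k (some n)).toLp _
  have hv : Orthonormal ℂ v := by
    rw [orthonormal_iff_ite]
    intro i j
    simp only [v]
    rw [inner_smul_left, inner_smul_right, inner_toLp_fadingVec (k, some i) (k, some j)]
    by_cases hij : i = j
    · subst hij
      simp only [map_inv₀, Complex.conj_ofReal, if_true]
      have : (M : ℂ) = ((√(M : ℝ) : ℝ) : ℂ) * ((√(M : ℝ) : ℝ) : ℂ) := by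
        rw [← Complex.ofReal_mul, Real.mul_self_sqrt hM0.le, Complex.ofReal_natCast]
      rw [this]
      field_simp
    · simp [hij]
  have key := (hv.orthogonalFamily.summable_iff_norm_sq_summable
    (fun n => ((√(β k (some n)) * √(M : ℝ) : ℝ) : ℂ))).2 (by
      refine (hs.mul_right (M : ℝ)).congr fun n => ?_
      rw [Complex.norm_real, Real.norm_eq_abs, sq_abs, mul_pow, Real.sq_sqrt (hβ n),
        Real.sq_sqrt hM0.le])
  refine key.congr fun n => ?_
  rw [toLp_channel, LinearIsometry.toSpanSingleton_apply]
  simp only [v]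
  rw [smul_smul]
  congr 1
  push_cast
  field_simp

/-! ### The joint law of the pilot signal and a fading vector -/

variable {K M : ℕ}

/-- Two random pairs of vectors have the same law if their characteristic functions agree. -/
lemma map_pair_eq_of_integral_exp {Ω : Type*} [MeasurableSpace Ω] {P : Measure Ω}
    [IsProbabilityMeasure P] {X Y X' Y' : Ω → EuclideanSpace ℂ (Fin M)}
    (hX : AEMeasurable X P) (hY : AEMeasurable Y P) (hX' : AEMeasurable X' P)
    (hY' : AEMeasurable Y' P)
    (h : ∀ t t' : EuclideanSpace ℂ (Fin M),
      ∫ ω, Complex.exp (((inner ℂ t (X ω)).re + (inner ℂ t' (Y ω)).re : ℝ) * Complex.I) ∂P =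
      ∫ ω, Complex.exp (((inner ℂ t (X' ω)).re + (inner ℂ t' (Y' ω)).re : ℝ) * Complex.I) ∂P) :
    P.map (fun ω => (X ω, Y ω)) = P.map (fun ω => (X' ω, Y' ω)) := by
  -- Characteristic functions refer to a real inner product, here the real part of the complex one.
  -- The pair is moved to the `L²` product `WithLp 2` so that it lives in an inner product space.
  have hre : ∀ x y : EuclideanSpace ℂ (Fin M), inner ℝ x y = (inner ℂ x y).re := by
    intro x y
    rw [PiLp.inner_apply, PiLp.inner_apply, Complex.re_sum]
    rfl
  have key : ∀ {X Y : Ω → EuclideanSpace ℂ (Fin M)}, AEMeasurable X P → AEMeasurable Y P →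
      ∀ t : WithLp 2 (EuclideanSpace ℂ (Fin M) × EuclideanSpace ℂ (Fin M)),
      charFun ((P.map fun ω => (X ω, Y ω)).map (MeasurableEquiv.toLp 2 _)) t =
      ∫ ω, Complex.exp (((inner ℂ t.fst (X ω)).re + (inner ℂ t.snd (Y ω)).re : ℝ) *
          Complex.I) ∂P := by
    intro X Y hX hY t
    rw [charFun_apply, integral_map (MeasurableEquiv.measurable _).aemeasurable,
      integral_map (hX.prodMk hY)]
    · refine integral_congr_ae (Filter.Eventually.of_forall fun ω => ?_)
      simp only [WithLp.prod_inner_apply, MeasurableEquiv.coe_toLp]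
      rw [real_inner_comm, real_inner_comm t.ofLp.2, hre, hre]
      rfl
    · rw [MeasurableEquiv.coe_toLp]
      exact (Continuous.aestronglyMeasurable (by fun_prop))
    · exact (Continuous.aestronglyMeasurable (by fun_prop))
  have := Measure.isProbabilityMeasure_map (hX.prodMk hY)
  have := Measure.isProbabilityMeasure_map (hX'.prodMk hY')
  refine (MeasurableEquiv.toLp 2
    (EuclideanSpace ℂ (Fin M) × EuclideanSpace ℂ (Fin M))).map_measurableEquiv_injective
      (Measure.ext_of_charFun (funext fun t => ?_))
  rw [key hX hY, key hX' hY', h]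

/-- The coefficients of the pilot signal with respect to the fading vectors. -/
def pilotCoeff (β : Fin K → Option ℕ → ℝ) (k : Fin K) (j : Fin K × Option ℕ) : ℝ :=
  if j.1 = k then √(β k j.2) else 0

/-- The users in the first cells of an enumeration that use the pilot `k`. -/
def pilotUsers (k : Fin K) (A : Finset ℕ) : Finset (Fin K × Option ℕ) :=
  (Finset.insertNone A).map ⟨fun j => (k, j), fun _ _ h => (Prod.mk.inj h).2⟩

lemma sum_pilotUsers {E : Type*} [AddCommMonoid E] (k : Fin K) (A : Finset ℕ)
    (f : Fin K × Option ℕ → E) :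
    ∑ j ∈ pilotUsers k A, f j = f (k, none) + ∑ n ∈ A, f (k, some n) := by
  unfold pilotUsers
  rw [Finset.sum_map, Finset.sum_insertNone]
  rfl

/-- Mean-square convergence implies almost sure convergence along a suitable sequence of finite
sets. That the sequence is cofinal matters later: every given user is eventually included, and the
partial sums of `β` tend to `alpha`. -/
lemma exists_seq_tendsto_pilotSignal (hM : 1 ≤ M) {β : Fin K → Option ℕ → ℝ} {k : Fin K}
    (hβ : ∀ n, 0 ≤ β k (some n)) (hs : Summable fun n => β k (some n)) :
    ∃ ns : ℕ → Finset ℕ, Filter.Tendsto ns Filter.atTop Filter.atTop ∧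
      ∀ᵐ h ∂(fadingLaw K M), Filter.Tendsto
        (fun i => fadingSum (pilotUsers k (ns i)) (pilotCoeff β k) h) Filter.atTop
        (nhds (pilotSignal M β k h)) := by
  have h1 := (summable_toLp_channel hM hβ hs).hasSum
  have h2 : Filter.Tendsto (fun A : Finset ℕ =>
      (memLp_channel (M := M) β k none).toLp (channel β k none) +
        ∑ n ∈ A, (memLp_channel (M := M) β k (some n)).toLp (channel β k (some n)))
      Filter.atTop (nhds (pilotSignal M β k)) :=
    Filter.Tendsto.const_add _ h1
  obtain ⟨ns, hns, hlim⟩ := (tendstoInMeasure_of_tendsto_Lp h2).exists_seq_tendsto_ae'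
  refine ⟨ns, hns, ?_⟩
  -- There are countably many finite sets `A`, so one null set serves all of these almost everywhere
  -- equalities.
  have h3 : ∀ᵐ h ∂(fadingLaw K M), ∀ A : Finset ℕ,
      ((memLp_channel (M := M) β k none).toLp (channel β k none) +
        ∑ n ∈ A, (memLp_channel (M := M) β k (some n)).toLp (channel β k (some n)) :
        Lp (EuclideanSpace ℂ (Fin M)) 2 (fadingLaw K M)) h =
      fadingSum (pilotUsers k A) (pilotCoeff β k) h := by
    rw [ae_all_iff]
    intro A
    filter_upwards [Lp.coeFn_add ((memLp_channel (M := M) β k none).toLp (channel β k none))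
      (∑ n ∈ A, (memLp_channel (M := M) β k (some n)).toLp (channel β k (some n))),
      Lp.coeFn_finsetSum A
        (fun n => (memLp_channel (M := M) β k (some n)).toLp (channel β k (some n))),
      (memLp_channel (M := M) β k none).coeFn_toLp,
      ae_all_iff.2 fun n => (memLp_channel (M := M) β k (some n)).coeFn_toLp] with h e1 e2 e3 e4
    rw [e1, Pi.add_apply, e2, e3, fadingSum, sum_pilotUsers]
    simp [e4, channel, pilotCoeff]
  filter_upwards [hlim, h3] with h e1 e2
  exact e1.congr fun i => e2 _

lemma measurable_pilotSignal (β : Fin K → Option ℕ → ℝ) (k : Fin K) :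
    AEMeasurable (pilotSignal M β k : Fading K M → EuclideanSpace ℂ (Fin M)) (fadingLaw K M) :=
  (Lp.aestronglyMeasurable _).aemeasurable

/-- The finite formula `integral_exp_fadingSum` passes to the limit, by dominated convergence, since
the exponentials have modulus 1. -/
lemma integral_exp_pilotSignal (hM : 1 ≤ M) {β : Fin K → Option ℕ → ℝ} {k : Fin K}
    (hβ : ∀ j, 0 ≤ β k j) (hs : Summable fun n => β k (some n)) (y : Fin K × Option ℕ)
    (t t' : EuclideanSpace ℂ (Fin M)) :
    ∫ h : Fading K M, Complex.exp (((inner ℂ t (pilotSignal M β k h)).re +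
        (inner ℂ t' (fadingVec y.1 y.2 h)).re : ℝ) * Complex.I) ∂(fadingLaw K M) =
      Complex.exp (-((alpha β k * ‖t‖ ^ 2 + 2 * pilotCoeff β k y * (inner ℂ t t').re +
        ‖t'‖ ^ 2) / 4 : ℝ)) := by
  classical
  obtain ⟨ns, hns, hlim⟩ := exists_seq_tendsto_pilotSignal hM (fun n => hβ (some n)) hs
  let v : Fin K × Option ℕ → ℝ := Pi.single y 1
  -- Both vectors must be combinations over one index set, so `y` is adjoined. Eventually this does
  -- not change the pilot sum: either `y` does not use the pilot `k` and has coefficient 0, or it is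
  -- already present.
  let G : ℕ → Finset (Fin K × Option ℕ) := fun i => pilotUsers k (ns i) ∪ {y}
  have hG : ∀ᶠ i in Filter.atTop, ∀ j ∈ G i, j ∉ pilotUsers k (ns i) → pilotCoeff β k j = 0 := by
    have h1 : ∀ᶠ i in Filter.atTop, pilotCoeff β k y = 0 ∨ y ∈ pilotUsers k (ns i) := by
      obtain ⟨k', j⟩ := y
      by_cases hk : k' = k
      · subst hk
        cases j with
        | none =>
          refine Filter.Eventually.of_forall fun i => Or.inr ?_
          simp only [pilotUsers, Finset.mem_map, Finset.mem_insertNone]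
          exact ⟨none, fun a ha => by simp at ha, rfl⟩
        | some n =>
          filter_upwards [hns.eventually (Filter.eventually_ge_atTop {n})] with i hi
          right
          simp only [pilotUsers, Finset.mem_map, Finset.mem_insertNone]
          exact ⟨some n, fun a ha => hi (by simpa using ha.symm), rfl⟩
      · exact Filter.Eventually.of_forall fun i => Or.inl (by simp [pilotCoeff, hk])
    filter_upwards [h1] with i hi j hj hj'
    simp only [G, Finset.mem_union, Finset.mem_singleton] at hj
    rcases hj with hj | rfl
    · exact absurd hj hj'
    · exact hi.resolve_right hj'
  have hv : ∀ i (h : Fading K M), fadingSum (G i) v h = fadingVec y.1 y.2 h := by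
    intro i h
    unfold fadingSum
    rw [Finset.sum_eq_single y]
    · simp [v]
    · intro j _ hj; simp [v, Pi.single_eq_of_ne hj]
    · intro hy; simp [G] at hy
  have hv2 : ∀ i, ∑ j ∈ G i, v j ^ 2 = 1 := by
    intro i
    rw [Finset.sum_eq_single y]
    · simp [v]
    · intro j _ hj; simp [v, Pi.single_eq_of_ne hj]
    · intro hy; simp [G] at hy
  have huv : ∀ i, ∑ j ∈ G i, pilotCoeff β k j * v j = pilotCoeff β k y := by
    intro i
    rw [Finset.sum_eq_single y]
    · simp [v]
    · intro j _ hj; simp [v, Pi.single_eq_of_ne hj]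
    · intro hy; simp [G] at hy
  have hu : ∀ᶠ i in Filter.atTop,
      β k none + ∑ n ∈ ns i, β k (some n) = ∑ j ∈ G i, pilotCoeff β k j ^ 2 := by
    filter_upwards [hG] with i hi
    rw [← Finset.sum_subset (s₁ := pilotUsers k (ns i)) Finset.subset_union_left
      (fun j hj hj' => by rw [hi j hj hj']; ring), sum_pilotUsers]
    simp [pilotCoeff, Real.sq_sqrt (hβ _)]
  have hus : ∀ᶠ i in Filter.atTop, ∀ h : Fading K M,
      fadingSum (pilotUsers k (ns i)) (pilotCoeff β k) h = fadingSum (G i) (pilotCoeff β k) h := by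
    filter_upwards [hG] with i hi h
    unfold fadingSum
    exact Finset.sum_subset Finset.subset_union_left
      (fun j hj hj' => by rw [hi j hj hj']; simp)
  have hα : Filter.Tendsto (fun i => ∑ j ∈ G i, pilotCoeff β k j ^ 2) Filter.atTop
      (nhds (alpha β k)) :=
    (Filter.Tendsto.const_add _ (hs.hasSum.comp hns)).congr' hu
  have hL : Filter.Tendsto (fun i => ∫ h : Fading K M, Complex.exp
      (((inner ℂ t (fadingSum (pilotUsers k (ns i)) (pilotCoeff β k) h)).re +
        (inner ℂ t' (fadingVec y.1 y.2 h)).re : ℝ) * Complex.I) ∂(fadingLaw K M)) Filter.atTop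
      (nhds (∫ h : Fading K M, Complex.exp (((inner ℂ t (pilotSignal M β k h)).re +
        (inner ℂ t' (fadingVec y.1 y.2 h)).re : ℝ) * Complex.I) ∂(fadingLaw K M))) := by
    refine tendsto_integral_of_dominated_convergence (fun _ => 1) (fun i => ?_)
      (integrable_const 1) (fun i => Filter.Eventually.of_forall fun h => ?_) ?_
    · have hc : Continuous fun z : EuclideanSpace ℂ (Fin M) × EuclideanSpace ℂ (Fin M) =>
          Complex.exp (((inner ℂ t z.1).re + (inner ℂ t' z.2).re : ℝ) * Complex.I) := by
        fun_prop
      exact (hc.measurable.comp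
        ((measurable_fadingSum _ _).prodMk (measurable_fadingVec _ _))).aestronglyMeasurable
    · rw [Complex.norm_exp_ofReal_mul_I]
    · filter_upwards [hlim] with h hh
      have hc : Continuous fun z : EuclideanSpace ℂ (Fin M) =>
          Complex.exp (((inner ℂ t z).re + (inner ℂ t' (fadingVec y.1 y.2 h)).re : ℝ) *
            Complex.I) := by
        fun_prop
      exact (hc.tendsto _).comp hh
  refine tendsto_nhds_unique hL ?_
  have hR : Filter.Tendsto (fun i => Complex.exp (-(((∑ j ∈ G i, pilotCoeff β k j ^ 2) * ‖t‖ ^ 2 +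
        2 * pilotCoeff β k y * (inner ℂ t t').re + ‖t'‖ ^ 2) / 4 : ℝ))) Filter.atTop
      (nhds (Complex.exp (-((alpha β k * ‖t‖ ^ 2 + 2 * pilotCoeff β k y * (inner ℂ t t').re +
        ‖t'‖ ^ 2) / 4 : ℝ)))) := by
    have hc : Continuous fun x : ℝ => Complex.exp (-((x * ‖t‖ ^ 2 +
        2 * pilotCoeff β k y * (inner ℂ t t').re + ‖t'‖ ^ 2) / 4 : ℝ)) := by fun_prop
    exact (hc.tendsto _).comp hα
  refine hR.congr' ?_
  filter_upwards [hus] with i hi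
  have := integral_exp_fadingSum (K := K) (G i) (pilotCoeff β k) v t t'
  simp_rw [hv, hv2, huv, one_mul] at this
  simp_rw [hi]
  exact this.symm

/-- The pilot signal and a fading vector are jointly distributed like two explicit combinations
of two independent fading vectors. -/
lemma map_pilotSignal_fadingVec (hM : 1 ≤ M) {β : Fin K → Option ℕ → ℝ} {k : Fin K}
    (hβ : ∀ j, 0 ≤ β k j) (hα : 0 ≤ alpha β k) (hs : Summable fun n => β k (some n))
    (y : Fin K × Option ℕ) {a b : ℝ} (ha : √(alpha β k) * a = pilotCoeff β k y)
    (hab : a ^ 2 + b ^ 2 = 1) :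
    (fadingLaw K M).map (fun h => (pilotSignal M β k h, fadingVec y.1 y.2 h)) =
      (fadingLaw K M).map (fun h => (((√(alpha β k) : ℝ) : ℂ) • fadingVec k none h,
        (a : ℂ) • fadingVec k none h + (b : ℂ) • fadingVec k (some 0) h)) := by
  classical
  -- The users `(k, none)` and `(k, some 0)` merely provide two independent fading vectors. The
  -- hypotheses on `a` and `b` say that the variances and the covariance agree with those of the
  -- original pair.
  let F : Finset (Fin K × Option ℕ) := pilotUsers k {0}
  let u : Fin K × Option ℕ → ℝ := fun j => if j.2 = none then √(alpha β k) else 0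
  let v : Fin K × Option ℕ → ℝ := fun j => if j.2 = none then a else b
  have hu : ∀ h : Fading K M, fadingSum F u h = ((√(alpha β k) : ℝ) : ℂ) • fadingVec k none h := by
    intro h
    unfold fadingSum
    rw [sum_pilotUsers]
    simp [u]
  have hv : ∀ h : Fading K M, fadingSum F v h =
      (a : ℂ) • fadingVec k none h + (b : ℂ) • fadingVec k (some 0) h := by
    intro h
    unfold fadingSum
    rw [sum_pilotUsers]
    simp [v]
  simp_rw [← hu, ← hv]
  refine map_pair_eq_of_integral_exp (measurable_pilotSignal β k)
    (measurable_fadingVec _ _).aemeasurable (measurable_fadingSum _ _).aemeasurable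
    (measurable_fadingSum _ _).aemeasurable fun t t' => ?_
  rw [integral_exp_pilotSignal hM hβ hs, integral_exp_fadingSum]
  simp only [F, sum_pilotUsers]
  simp only [u, v, if_true, reduceCtorEq, if_false, Finset.sum_singleton]
  rw [ha, Real.sq_sqrt hα, hab]
  congr 4
  ring

/-! ### The mean power of a fading vector in a random direction -/

variable {K M : ℕ}

/-- The power of `w` in the direction of `v`. -/
def directionalPower (v w : EuclideanSpace ℂ (Fin M)) : ℝ := ‖inner ℂ v w‖ ^ 2 / ‖v‖ ^ 2

lemma directionalPower_nonneg (v w : EuclideanSpace ℂ (Fin M)) : 0 ≤ directionalPower v w := by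
  unfold directionalPower; positivity

lemma directionalPower_le (v w : EuclideanSpace ℂ (Fin M)) : directionalPower v w ≤ ‖w‖ ^ 2 := by
  unfold directionalPower
  refine div_le_of_le_mul₀ (sq_nonneg _) (sq_nonneg _) ?_
  rw [← mul_pow, mul_comm]
  exact pow_le_pow_left₀ (norm_nonneg _) (norm_inner_le_norm v w) 2

lemma measurable_directionalPower :
    Measurable fun z : EuclideanSpace ℂ (Fin M) × EuclideanSpace ℂ (Fin M) =>
      directionalPower z.1 z.2 := by
  unfold directionalPower
  refine Measurable.div ?_ (by fun_prop)
  exact (by fun_prop : Continuous fun z : EuclideanSpace ℂ (Fin M) × EuclideanSpace ℂ (Fin M) =>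
    ‖inner ℂ z.1 z.2‖ ^ 2).measurable

lemma directionalPower_smul_left {c : ℂ} (hc : c ≠ 0) (v w : EuclideanSpace ℂ (Fin M)) :
    directionalPower (c • v) w = directionalPower v w := by
  unfold directionalPower
  rw [inner_smul_left, norm_mul, norm_smul, mul_pow, mul_pow, RCLike.norm_conj,
    mul_div_mul_left _ _ (by positivity)]

lemma directionalPower_add_smul (a b : ℝ) (v w : EuclideanSpace ℂ (Fin M)) :
    directionalPower v ((a : ℂ) • v + (b : ℂ) • w) =
      a ^ 2 * ‖v‖ ^ 2 + 2 * a * b * (inner ℂ v w).re + b ^ 2 * directionalPower v w := by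
  -- For `v = 0` both sides vanish, since division by zero gives 0.
  by_cases hv : v = 0
  · simp [hv, directionalPower]
  have hv' : ‖v‖ ^ 2 ≠ 0 := by positivity
  unfold directionalPower
  rw [inner_add_right, inner_smul_right, inner_smul_right, inner_self_eq_norm_sq_to_K]
  have h1 : ‖(a : ℂ) * ((‖v‖ : ℂ) ^ 2) + (b : ℂ) * inner ℂ v w‖ ^ 2 =
      a ^ 2 * (‖v‖ ^ 2) ^ 2 + 2 * a * b * ‖v‖ ^ 2 * (inner ℂ v w).re
        + b ^ 2 * ‖inner ℂ v w‖ ^ 2 := by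
    rw [Complex.sq_norm, Complex.sq_norm, Complex.normSq_apply, Complex.normSq_apply]
    simp only [← Complex.ofReal_pow, ← Complex.ofReal_mul, Complex.add_re, Complex.add_im,
      Complex.ofReal_re, Complex.ofReal_im, Complex.re_ofReal_mul, Complex.im_ofReal_mul]
    ring
  have h2 : ((‖v‖ : ℝ) : ℂ) = RCLike.ofReal ‖v‖ := rfl
  rw [← h2, h1]
  field_simp

lemma integrable_directionalPower {X : Fading K M → EuclideanSpace ℂ (Fin M)}
    (hX : AEMeasurable X (fadingLaw K M)) (k : Fin K) (j : Option ℕ) :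
    Integrable (fun h => directionalPower (X h) (fadingVec k j h)) (fadingLaw K M) := by
  refine ((memLp_fadingVec (M := M) k j).norm.integrable_sq).mono'
    (measurable_directionalPower.comp_aemeasurable
      (hX.prodMk (measurable_fadingVec k j).aemeasurable)).aestronglyMeasurable
    (Filter.Eventually.of_forall fun h => ?_)
  rw [Real.norm_of_nonneg (directionalPower_nonneg _ _)]
  exact directionalPower_le _ _

lemma complexGaussian_singleton_zero : complexGaussian {0} = 0 := by
  unfold complexGaussian
  rw [Measure.map_apply measurable_complexMk (measurableSet_singleton 0)]
  have := nullSingletonClass_gaussianReal (μ := 0) (v := 1 / 2) (by simp)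
  refine measure_mono_null (t := ({0} : Set ℝ) ×ˢ Set.univ) ?_ ?_
  · rintro ⟨x, y⟩ hz
    have := congrArg Complex.re hz
    simpa using this
  · rw [Measure.prod_prod, measure_singleton, zero_mul]

lemma ae_fadingVec_ne_zero (hM : 1 ≤ M) (k : Fin K) (j : Option ℕ) :
    ∀ᵐ h ∂(fadingLaw K M), fadingVec (M := M) k j h ≠ 0 := by
  have h1 :=
    (measurePreserving_fading_eval (K := K) (M := M) (k, j, ⟨0, hM⟩)).quasiMeasurePreserving
  have h2 : ∀ᵐ z ∂complexGaussian, z ≠ 0 := by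
    rw [ae_iff]; simpa using complexGaussian_singleton_zero
  filter_upwards [h1.ae h2] with h hh h0
  exact hh (by simpa [fadingVec] using congrArg (fun v => v ⟨0, hM⟩) h0)

lemma indepFun_fadingVec {a b : Fin K × Option ℕ} (hab : a ≠ b) :
    IndepFun (fadingVec (M := M) a.1 a.2) (fadingVec b.1 b.2) (fadingLaw K M) := by
  classical
  let S : Fin K × Option ℕ → Finset (Fin K × Option ℕ × Fin M) := fun a =>
    Finset.univ.image fun m => (a.1, a.2, m)
  have hS : ∀ a m, (a.1, a.2, m) ∈ S a := fun a m => by simp [S]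
  have hd : Disjoint (S a) (S b) := by
    rw [Finset.disjoint_left]
    intro x hx hx'
    simp only [S, Finset.mem_image, Finset.mem_univ, true_and] at hx hx'
    obtain ⟨m, rfl⟩ := hx
    obtain ⟨m', hm⟩ := hx'
    simp only [Prod.mk.injEq] at hm
    exact hab (Prod.ext hm.1.symm hm.2.1.symm)
  have h := iIndepFun_fading.indepFun_finset (S a) (S b) hd (fun i => measurable_pi_apply i)
  have hφ : ∀ a, Measurable fun (z : S a → ℂ) =>
      (WithLp.toLp 2 fun m => z ⟨(a.1, a.2, m), hS a m⟩ : EuclideanSpace ℂ (Fin M)) := by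
    intro a
    refine (MeasurableEquiv.toLp 2 (Fin M → ℂ)).measurable.comp ?_
    exact measurable_pi_lambda _ fun m => measurable_pi_apply _
  exact h.comp (hφ a) (hφ b)

/-- The projection of a standard Gaussian vector onto an independent direction has mean power 1.
Expanding the square separates the two vectors; the second has identity covariance, which leaves the
diagonal terms `|v_m|² / ‖v‖²`. These add up to 1 because `v ≠ 0` almost surely. -/
lemma integral_directionalPower_indep (hM : 1 ≤ M) {a b : Fin K × Option ℕ} (hab : a ≠ b) :
    ∫ h : Fading K M, directionalPower (fadingVec a.1 a.2 h) (fadingVec b.1 b.2 h)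
      ∂(fadingLaw K M) = 1 := by
  let f : Fin M → Fin M → EuclideanSpace ℂ (Fin M) → ℂ := fun m m' v =>
    starRingEnd ℂ (v m) * v m' / ((‖v‖ ^ 2 : ℝ) : ℂ)
  let g : Fin M → Fin M → EuclideanSpace ℂ (Fin M) → ℂ := fun m m' v =>
    starRingEnd ℂ (v m') * v m
  have hf : ∀ m m', Measurable (f m m') := fun m m' => by
    refine Measurable.div ?_ ?_
    · exact (by fun_prop : Continuous fun v : EuclideanSpace ℂ (Fin M) =>
        starRingEnd ℂ (v m) * v m').measurable
    · exact (by fun_prop : Continuous fun v : EuclideanSpace ℂ (Fin M) =>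
        ((‖v‖ ^ 2 : ℝ) : ℂ)).measurable
  have hg : ∀ m m', Measurable (g m m') := fun m m' =>
    (by fun_prop : Continuous fun v : EuclideanSpace ℂ (Fin M) =>
      starRingEnd ℂ (v m') * v m).measurable
  have hexp : ∀ v w : EuclideanSpace ℂ (Fin M),
      ((directionalPower v w : ℝ) : ℂ) = ∑ m, ∑ m', f m m' v * g m m' w := by
    intro v w
    unfold directionalPower
    rw [Complex.ofReal_div, ← Complex.normSq_eq_norm_sq, ← Complex.mul_conj, PiLp.inner_apply,
      map_sum, Finset.sum_mul_sum, Finset.sum_div]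
    refine Finset.sum_congr rfl fun m _ => ?_
    rw [Finset.sum_div]
    refine Finset.sum_congr rfl fun m' _ => ?_
    simp [f, g]
    ring
  have hfb : ∀ m m' v, ‖f m m' v‖ ≤ 1 := by
    intro m m' v
    simp only [f, norm_div, norm_mul, RCLike.norm_conj, Complex.norm_real, norm_pow, norm_norm]
    refine div_le_one_of_le₀ ?_ (sq_nonneg _)
    rw [sq]
    exact mul_le_mul (PiLp.norm_apply_le v m) (PiLp.norm_apply_le v m') (norm_nonneg _)
      (norm_nonneg _)
  have hga : ∀ m m', Measurable fun h : Fading K M => g m m' (fadingVec b.1 b.2 h) := fun m m' =>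
    (hg m m').comp (measurable_fadingVec _ _)
  have hfa : ∀ m m', Measurable fun h : Fading K M => f m m' (fadingVec a.1 a.2 h) := fun m m' =>
    (hf m m').comp (measurable_fadingVec _ _)
  have hgi : ∀ m m', Integrable (fun h : Fading K M => g m m' (fadingVec b.1 b.2 h))
      (fadingLaw K M) := fun m m' => integrable_conj_mul_fading (b.1, b.2, m') (b.1, b.2, m)
  have hfgi : ∀ m m', Integrable (fun h : Fading K M =>
      f m m' (fadingVec a.1 a.2 h) * g m m' (fadingVec b.1 b.2 h)) (fadingLaw K M) := fun m m' =>
    (hgi m m').bdd_mul (hfa m m').aestronglyMeasurable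
      (Filter.Eventually.of_forall fun h => hfb m m' _)
  have hfi : ∀ m m', Integrable (fun h : Fading K M => f m m' (fadingVec a.1 a.2 h))
      (fadingLaw K M) := fun m m' =>
    (integrable_const (1 : ℝ)).mono' (hfa m m').aestronglyMeasurable
      (Filter.Eventually.of_forall fun h => hfb m m' _)
  have hval : ∀ m m', ∫ h : Fading K M,
      f m m' (fadingVec a.1 a.2 h) * g m m' (fadingVec b.1 b.2 h) ∂(fadingLaw K M) =
      (∫ h : Fading K M, f m m' (fadingVec a.1 a.2 h) ∂(fadingLaw K M)) *
        if m' = m then 1 else 0 := by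
    intro m m'
    have h1 := ((indepFun_fadingVec (M := M) hab).comp (hf m m') (hg m m')
      ).integral_fun_mul_eq_mul_integral (hfa m m').aestronglyMeasurable
        (hga m m').aestronglyMeasurable
    simp only [Function.comp_apply] at h1
    rw [h1]
    congr 1
    have h2 := integral_conj_mul_fading (K := K) (b.1, b.2, m') (b.1, b.2, m)
    simp only [Prod.mk.injEq, true_and] at h2
    exact h2
  apply Complex.ofReal_injective
  rw [← integral_complex_ofReal]
  simp_rw [hexp]
  rw [integral_finsetSum _ fun m _ => integrable_finsetSum _ fun m' _ => hfgi m m']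
  simp_rw [integral_finsetSum _ fun m' _ => hfgi _ m', hval]
  simp only [mul_ite, mul_one, mul_zero, Finset.sum_ite_eq', Finset.mem_univ, if_true]
  rw [← integral_finsetSum _ fun m _ => hfi m m]
  have h1 : ∀ᵐ h ∂(fadingLaw K M), ∑ m, f m m (fadingVec a.1 a.2 h) = 1 := by
    filter_upwards [ae_fadingVec_ne_zero hM a.1 a.2] with h hh
    simp only [f]
    rw [← Finset.sum_div]
    have h2 : ∀ v : EuclideanSpace ℂ (Fin M),
        ∑ m, starRingEnd ℂ (v m) * v m = ((‖v‖ ^ 2 : ℝ) : ℂ) := by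
      intro v
      rw [EuclideanSpace.norm_sq_eq, Complex.ofReal_sum]
      refine Finset.sum_congr rfl fun m _ => ?_
      rw [mul_comm, Complex.mul_conj, Complex.normSq_eq_norm_sq]
    rw [h2, div_self]
    exact_mod_cast (by positivity : ‖fadingVec a.1 a.2 h‖ ^ 2 ≠ 0)
  rw [integral_congr_ae h1]
  simp

lemma integral_directionalPower_add_smul (hM : 1 ≤ M) {x y : Fin K × Option ℕ} (hxy : x ≠ y)
    (a b : ℝ) :
    ∫ h : Fading K M, directionalPower (fadingVec x.1 x.2 h)
      ((a : ℂ) • fadingVec x.1 x.2 h + (b : ℂ) • fadingVec y.1 y.2 h) ∂(fadingLaw K M) =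
      a ^ 2 * M + b ^ 2 := by
  simp_rw [directionalPower_add_smul]
  have hsq : ∀ x : Fin K × Option ℕ, Integrable (fun h : Fading K M => ‖fadingVec x.1 x.2 h‖ ^ 2)
      (fadingLaw K M) := fun x => (memLp_fadingVec x.1 x.2).norm.integrable_sq
  have hin : Integrable (fun h : Fading K M =>
      inner ℂ (fadingVec x.1 x.2 h) (fadingVec y.1 y.2 h)) (fadingLaw K M) := by
    refine ((hsq x).add (hsq y)).mono' ?_ (Filter.Eventually.of_forall fun h => ?_)
    · exact ((measurable_fadingVec _ _).inner (measurable_fadingVec _ _)).aestronglyMeasurable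
    · refine (norm_inner_le_norm _ _).trans ?_
      simp only [Pi.add_apply]
      nlinarith [sq_nonneg (‖fadingVec x.1 x.2 h‖ - ‖fadingVec y.1 y.2 h‖),
        sq_nonneg ‖fadingVec x.1 x.2 h‖, sq_nonneg ‖fadingVec y.1 y.2 h‖]
  have h1 : ∫ h : Fading K M, ‖fadingVec x.1 x.2 h‖ ^ 2 ∂(fadingLaw K M) = M := by
    have h2 := integral_inner_fadingVec (M := M) x x
    simp only [inner_self_eq_norm_sq_to_K, if_true] at h2
    have h3 : ∀ h : Fading K M, ((‖fadingVec x.1 x.2 h‖ : ℂ)) ^ 2 =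
      ((‖fadingVec x.1 x.2 h‖ ^ 2 : ℝ) : ℂ) := fun h => by push_cast; rfl
    have h4 : ∫ h : Fading K M, ((‖fadingVec x.1 x.2 h‖ ^ 2 : ℝ) : ℂ) ∂(fadingLaw K M) = M := by
      rw [← h2]
      exact integral_congr_ae (Filter.Eventually.of_forall fun h => (h3 h).symm)
    rw [integral_complex_ofReal] at h4
    exact_mod_cast h4
  have h2 : ∫ h : Fading K M, (inner ℂ (fadingVec x.1 x.2 h) (fadingVec y.1 y.2 h)).re
      ∂(fadingLaw K M) = 0 := by
    have := integral_re hin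
    simp only [RCLike.re_eq_complex_re] at this
    rw [this, integral_inner_fadingVec, if_neg hxy]
    simp
  have hQ := integrable_directionalPower (K := K)
    (measurable_fadingVec (M := M) x.1 x.2).aemeasurable y.1 y.2
  have hre : Integrable (fun h : Fading K M =>
      (inner ℂ (fadingVec x.1 x.2 h) (fadingVec y.1 y.2 h)).re) (fadingLaw K M) := hin.re
  have i1 := (hsq x).const_mul (a ^ 2)
  have i2 := hre.const_mul (2 * a * b)
  rw [integral_add (f := fun h : Fading K M => a ^ 2 * ‖fadingVec x.1 x.2 h‖ ^ 2 +
      2 * a * b * (inner ℂ (fadingVec x.1 x.2 h) (fadingVec y.1 y.2 h)).re) (i1.add i2)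
      (hQ.const_mul (b ^ 2)), integral_add i1 i2, integral_const_mul,
    integral_const_mul, integral_const_mul, integral_directionalPower_indep hM hxy, h1, h2]
  ring

/-! ### Received powers and interference averaged over the fading -/

variable {K M : ℕ}

lemma integral_directionalPower_pilotSignal (hM : 1 ≤ M) {β : Fin K → Option ℕ → ℝ} {k : Fin K}
    (hβ : ∀ j, 0 ≤ β k j) (hα : 0 ≤ alpha β k) (hα' : alpha β k ≠ 0)
    (hs : Summable fun n => β k (some n))
    (y : Fin K × Option ℕ) {a b : ℝ} (ha : √(alpha β k) * a = pilotCoeff β k y)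
    (hab : a ^ 2 + b ^ 2 = 1) :
    ∫ h : Fading K M, directionalPower (pilotSignal M β k h) (fadingVec y.1 y.2 h)
      ∂(fadingLaw K M) = a ^ 2 * M + b ^ 2 := by
  have h1 := integral_map (μ := fadingLaw K M)
    ((measurable_pilotSignal (M := M) β k).prodMk (measurable_fadingVec y.1 y.2).aemeasurable)
    (measurable_directionalPower (M := M)).aestronglyMeasurable
  have hc : ((√(alpha β k) : ℝ) : ℂ) ≠ 0 := by
    exact_mod_cast (Real.sqrt_pos.2 (lt_of_le_of_ne hα (Ne.symm hα'))).ne'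
  simp only at h1
  rw [← h1, map_pilotSignal_fadingVec hM hβ hα hs y ha hab, integral_map]
  · simp only [directionalPower_smul_left hc]
    exact integral_directionalPower_add_smul hM (x := (k, none)) (y := (k, some 0)) (by simp) a b
  · exact (((measurable_fadingVec _ _).const_smul ((√(alpha β k) : ℝ) : ℂ)).prodMk
      (((measurable_fadingVec _ _).const_smul (a : ℂ)).add
        ((measurable_fadingVec _ _).const_smul (b : ℂ)))).aemeasurable
  · exact measurable_directionalPower.aestronglyMeasurable

lemma alpha_pos {β : Fin K → Option ℕ → ℝ} {k : Fin K} (hβ : ∀ j, 0 ≤ β k j)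
    (h0 : 0 < β k none) : 0 < alpha β k :=
  add_pos_of_pos_of_nonneg h0 (tsum_nonneg fun n => hβ (some n))

lemma le_alpha {β : Fin K → Option ℕ → ℝ} {k : Fin K} (hβ : ∀ j, 0 ≤ β k j)
    (hs : Summable fun n => β k (some n)) (j : Option ℕ) : β k j ≤ alpha β k := by
  unfold alpha
  cases j with
  | none => exact le_add_of_nonneg_right (tsum_nonneg fun n => hβ (some n))
  | some n => exact le_add_of_nonneg_of_le (hβ none) (hs.le_tsum n fun i _ => hβ (some i))

/-- The MMSE factor `β / α` cancels in the normalization of `w_k`; it only has to be nonzero, which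
is why `0 < β k none` is assumed. -/
lemma mrcPower_eq {β : Fin K → Option ℕ → ℝ} {k : Fin K} (hβ : ∀ k j, 0 ≤ β k j)
    (h0 : 0 < β k none) (k' : Fin K) (j : Option ℕ) (h : Fading K M) :
    mrcPower β k k' j h = alpha β k / M * β k' j *
      directionalPower (pilotSignal M β k h) (fadingVec k' j h) := by
  have hα := alpha_pos (hβ k) h0
  have hc : ((β k none / alpha β k : ℝ) : ℂ) ≠ 0 := by
    exact_mod_cast (div_pos h0 hα).ne'
  rw [← directionalPower_smul_left hc]
  change _ = _ * directionalPower (estimate β k h) _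
  unfold mrcPower mrc channel directionalPower
  rw [inner_smul_left, inner_smul_right, norm_mul, norm_mul, RCLike.norm_conj, Complex.norm_real,
    Complex.norm_real, Real.norm_of_nonneg (by positivity), Real.norm_of_nonneg (by positivity),
    mul_pow, mul_pow, div_pow, Real.sq_sqrt (by positivity), Real.sq_sqrt (hβ k' j)]
  ring

lemma integrable_mrcPower {β : Fin K → Option ℕ → ℝ} {k : Fin K} (hβ : ∀ k j, 0 ≤ β k j)
    (h0 : 0 < β k none) (k' : Fin K) (j : Option ℕ) :
    Integrable (mrcPower (M := M) β k k' j) (fadingLaw K M) := by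
  have h1 : mrcPower (M := M) β k k' j = fun h => alpha β k / M * β k' j *
      directionalPower (pilotSignal M β k h) (fadingVec k' j h) :=
    funext fun h => mrcPower_eq hβ h0 k' j h
  rw [h1]
  exact (integrable_directionalPower (measurable_pilotSignal β k) k' j).const_mul _

lemma integral_mrcPower_of_ne (hM : 1 ≤ M) {β : Fin K → Option ℕ → ℝ} {k k' : Fin K}
    (hβ : ∀ k j, 0 ≤ β k j) (h0 : 0 < β k none) (hs : Summable fun n => β k (some n))
    (hk : k' ≠ k) (j : Option ℕ) :
    ∫ h, mrcPower (M := M) β k k' j h ∂(fadingLaw K M) = alpha β k / M * β k' j := by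
  have hα := alpha_pos (hβ k) h0
  simp_rw [mrcPower_eq hβ h0, integral_const_mul]
  have := integral_directionalPower_pilotSignal hM (hβ k) hα.le hα.ne' hs (k', j) (a := 0) (b := 1)
    (by simp [pilotCoeff, hk]) (by norm_num)
  rw [this]
  ring

/-- The user's own share of the pilot signal is `a² = β / α ≤ 1`. The mean `a² M + b² = 1 + (M - 1)
β / α` splits into the incoherent part and the coherent gain, and the latter produces the term in
`β²`. -/
lemma integral_mrcPower_self (hM : 1 ≤ M) {β : Fin K → Option ℕ → ℝ} {k : Fin K}
    (hβ : ∀ k j, 0 ≤ β k j) (h0 : 0 < β k none) (hs : Summable fun n => β k (some n))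
    (j : Option ℕ) :
    ∫ h, mrcPower (M := M) β k k j h ∂(fadingLaw K M) =
      alpha β k / M * β k j + (1 - 1 / M) * β k j ^ 2 := by
  have hα := alpha_pos (hβ k) h0
  have hM0 : (0 : ℝ) < M := by exact_mod_cast hM
  have hle : β k j / alpha β k ≤ 1 := (div_le_one hα).2 (le_alpha (hβ k) hs j)
  have h2 : 0 ≤ β k j / alpha β k := div_nonneg (hβ k j) hα.le
  simp_rw [mrcPower_eq hβ h0, integral_const_mul]
  have := integral_directionalPower_pilotSignal hM (hβ k) hα.le hα.ne' hs (k, j)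
    (a := √(β k j / alpha β k)) (b := √(1 - β k j / alpha β k))
    (by
      rw [← Real.sqrt_mul hα.le, mul_div_cancel₀ _ hα.ne']
      simp [pilotCoeff])
    (by rw [Real.sq_sqrt h2, Real.sq_sqrt (by linarith)]; ring)
  rw [this, Real.sq_sqrt h2, Real.sq_sqrt (by linarith)]
  field_simp
  ring

lemma integral_tsum_mrcPower {ι : Type*} [Countable ι] {β : Fin K → Option ℕ → ℝ} {k : Fin K}
    (hβ : ∀ k j, 0 ≤ β k j) (h0 : 0 < β k none) (e : ι → Fin K × Option ℕ)
    (hs : Summable fun i => ∫ h, mrcPower (M := M) β k (e i).1 (e i).2 h ∂(fadingLaw K M)) :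
    ∫ h, ∑' i, mrcPower (M := M) β k (e i).1 (e i).2 h ∂(fadingLaw K M) =
      ∑' i, ∫ h, mrcPower (M := M) β k (e i).1 (e i).2 h ∂(fadingLaw K M) := by
  refine (hasSum_integral_of_summable_integral_norm
    (fun i => integrable_mrcPower hβ h0 (e i).1 (e i).2) ?_).tsum_eq.symm
  refine hs.congr fun i => integral_congr_ae (Filter.Eventually.of_forall fun h => ?_)
  exact (Real.norm_of_nonneg (sq_nonneg _)).symm

/-- The inter-cell interference given the large-scale fading. -/
theorem interInterference_eq (hM : 1 ≤ M) {β : Fin K → Option ℕ → ℝ} {k : Fin K}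
    (hβ : ∀ k j, 0 ≤ β k j) (h0 : 0 < β k none)
    (hs : ∀ k, Summable fun n => β k (some n)) :
    interInterference M β k = alpha β k / M * ∑ k', ∑' n, β k' (some n) := by
  have hα := alpha_pos (hβ k) h0
  have hsum : Summable fun y : {k' : Fin K // k' ≠ k} × ℕ => β y.1 (some y.2) := by
    rw [summable_prod_of_nonneg fun y => hβ _ _]
    exact ⟨fun k' => hs k', Summable.of_finite⟩
  have hv : ∀ y : {k' : Fin K // k' ≠ k} × ℕ,
      ∫ h, mrcPower (M := M) β k y.1 (some y.2) h ∂(fadingLaw K M) =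
        alpha β k / M * β y.1 (some y.2) := fun y =>
    integral_mrcPower_of_ne hM hβ h0 (hs k) y.1.2 _
  unfold interInterference reuseNonCoherent
  rw [integral_tsum_mrcPower hβ h0
    (fun y : {k' : Fin K // k' ≠ k} × ℕ => ((y.1 : Fin K), some y.2))
    (by simp only [hv]; exact hsum.mul_left _)]
  simp only [hv]
  -- The term `k' = k`, absent from the sum over the subtype, is exactly `reuseNonCoherent`.
  rw [tsum_mul_left, hsum.tsum_prod, tsum_fintype, Fintype.sum_eq_add_sum_subtype_ne _ k]
  ring

/-- The pilot-contamination interference given the large-scale fading. -/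
theorem contInterference_eq (hM : 1 ≤ M) {β : Fin K → Option ℕ → ℝ} {k : Fin K}
    (hβ : ∀ k j, 0 ≤ β k j) (h0 : 0 < β k none)
    (hs : Summable fun n => β k (some n)) :
    contInterference M β k = (1 - 1 / M) * ∑' n, β k (some n) ^ 2 := by
  have hsq : Summable fun n => β k (some n) ^ 2 := by
    have h1 : ∀ n, β k (some n) ≤ ∑' n, β k (some n) := fun n =>
      hs.le_tsum n fun i _ => hβ k (some i)
    refine Summable.of_nonneg_of_le (fun n => sq_nonneg _) (fun n => ?_)
      (hs.mul_left (∑' n, β k (some n)))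
    rw [sq]
    exact mul_le_mul_of_nonneg_right (h1 n) (hβ k (some n))
  unfold contInterference reuseInterference reuseNonCoherent
  have hv : ∀ n, ∫ h, mrcPower (M := M) β k k (some n) h ∂(fadingLaw K M) =
      alpha β k / M * β k (some n) + (1 - 1 / M) * β k (some n) ^ 2 := fun n =>
    integral_mrcPower_self hM hβ h0 hs _
  rw [integral_tsum_mrcPower hβ h0 (fun n : ℕ => (k, some n))
    (by simp only [hv]; exact (hs.mul_left _).add (hsq.mul_left _))]
  simp only [hv]
  rw [(hs.mul_left _).tsum_add (hsq.mul_left _), tsum_mul_left, tsum_mul_left]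
  ring

/-! ### Moments from a Laplace transform -/

section LaplaceMoments

lemma pow_mul_exp_neg_le {s x : ℝ} (hs : 0 < s) (hx : 0 ≤ x) (n : ℕ) :
    x ^ n * Real.exp (-(s * x)) ≤ n.factorial / s ^ n := by
  have h := Real.pow_div_factorial_le_exp (s * x) (by positivity) n
  rw [div_le_iff₀ (by positivity), mul_pow] at h
  rw [Real.exp_neg, ← div_eq_mul_inv, div_le_div_iff₀ (Real.exp_pos _) (by positivity)]
  linarith

variable {A : Type*} [MeasurableSpace A] {ν : Measure A} {b : A → ℝ}

/-- The measure `ν` may be infinite, so boundedness alone is not enough: the exponential absorbs `n`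
of the `n + 1` factors, and the last one supplies integrability. -/
lemma integrable_pow_mul_exp_neg (hb : ∀ a, 0 ≤ b a) (hi : Integrable b ν) {t : ℝ} (ht : 0 < t)
    (n : ℕ) : Integrable (fun a => b a ^ (n + 1) * Real.exp (-(t * b a))) ν := by
  refine (hi.const_mul (n.factorial / t ^ n)).mono' ?_ (Filter.Eventually.of_forall fun a => ?_)
  · exact (hi.aestronglyMeasurable.pow _).mul
      ((by fun_prop : Continuous fun x : ℝ => Real.exp (-(t * x))).comp_aestronglyMeasurable
        hi.aestronglyMeasurable)
  · rw [Real.norm_of_nonneg (mul_nonneg (pow_nonneg (hb a) _) (Real.exp_pos _).le), pow_succ,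
      mul_right_comm]
    exact mul_le_mul_of_nonneg_right (pow_mul_exp_neg_le ht (hb a) n) (hb a)

lemma hasDerivAt_integral_pow_mul_exp_neg (hb : ∀ a, 0 ≤ b a) (hi : Integrable b ν) {t : ℝ}
    (ht : 0 < t) (n : ℕ) :
    HasDerivAt (fun t => ∫ a, b a ^ (n + 1) * Real.exp (-(t * b a)) ∂ν)
      (-∫ a, b a ^ (n + 2) * Real.exp (-(t * b a)) ∂ν) t := by
  rw [← integral_neg]
  -- Keeping `s > t / 2` bounds the derivative uniformly by the integrand at `t / 2`, which is
  -- integrable by the preceding lemma.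
  refine (hasDerivAt_integral_of_dominated_loc_of_deriv_le (s := Set.Ioi (t / 2))
    (F := fun t a => b a ^ (n + 1) * Real.exp (-(t * b a)))
    (F' := fun t a => -(b a ^ (n + 2) * Real.exp (-(t * b a))))
    (bound := fun a => b a ^ (n + 2) * Real.exp (-(t / 2 * b a)))
    (Ioi_mem_nhds (by linarith)) ?_ (integrable_pow_mul_exp_neg hb hi ht n) ?_ ?_ ?_ ?_).2
  · filter_upwards [Ioi_mem_nhds ht] with s hs
    exact (integrable_pow_mul_exp_neg hb hi hs n).aestronglyMeasurable
  · exact (integrable_pow_mul_exp_neg hb hi ht (n + 1)).aestronglyMeasurable.neg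
  · refine Filter.Eventually.of_forall fun a s hs => ?_
    rw [norm_neg, Real.norm_of_nonneg (mul_nonneg (pow_nonneg (hb a) _) (Real.exp_pos _).le)]
    refine mul_le_mul_of_nonneg_left (Real.exp_le_exp.2 ?_) (pow_nonneg (hb a) _)
    have : t / 2 < s := hs
    nlinarith [mul_le_mul_of_nonneg_right this.le (hb a)]
  · exact integrable_pow_mul_exp_neg hb hi (by linarith) (n + 1)
  · refine Filter.Eventually.of_forall fun a s _ => ?_
    have h1 : HasDerivAt (fun s => Real.exp (-(s * b a))) (Real.exp (-(s * b a)) * -(b a)) s := by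
      have := ((hasDerivAt_id s).mul_const (b a)).neg.exp
      simpa using this
    refine (h1.const_mul (b a ^ (n + 1))).congr_deriv ?_
    ring

/-- For an infinite `ν` the exponential itself is not integrable, but `1 - e^{-tb} ≤ t b` is. -/
lemma integrable_one_sub_exp_neg (hb : ∀ a, 0 ≤ b a) (hi : Integrable b ν) {t : ℝ} (ht : 0 ≤ t) :
    Integrable (fun a => 1 - Real.exp (-(t * b a))) ν := by
  refine (hi.const_mul t).mono' ?_ (Filter.Eventually.of_forall fun a => ?_)
  · exact (by fun_prop : Continuous fun x : ℝ => 1 - Real.exp (-(t * x))).comp_aestronglyMeasurable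
        hi.aestronglyMeasurable
  · have h0 : 0 ≤ t * b a := mul_nonneg ht (hb a)
    rw [Real.norm_of_nonneg (by linarith [Real.exp_le_one_iff.2 (neg_nonpos.2 h0)])]
    linarith [Real.add_one_le_exp (-(t * b a))]

lemma hasDerivAt_integral_one_sub_exp_neg (hb : ∀ a, 0 ≤ b a) (hi : Integrable b ν) {t : ℝ}
    (ht : 0 < t) :
    HasDerivAt (fun t => ∫ a, (1 - Real.exp (-(t * b a))) ∂ν)
      (∫ a, b a ^ 1 * Real.exp (-(t * b a)) ∂ν) t := by
  refine (hasDerivAt_integral_of_dominated_loc_of_deriv_le (s := Set.Ioi 0)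
    (F := fun t a => 1 - Real.exp (-(t * b a)))
    (F' := fun t a => b a ^ 1 * Real.exp (-(t * b a))) (bound := b)
    (Ioi_mem_nhds ht) ?_ (integrable_one_sub_exp_neg hb hi ht.le) ?_ ?_ hi ?_).2
  · filter_upwards [Ioi_mem_nhds ht] with s hs
    exact (integrable_one_sub_exp_neg hb hi (le_of_lt hs)).aestronglyMeasurable
  · exact (integrable_pow_mul_exp_neg hb hi ht 0).aestronglyMeasurable
  · refine Filter.Eventually.of_forall fun a s hs => ?_
    rw [Real.norm_of_nonneg (mul_nonneg (pow_nonneg (hb a) _) (Real.exp_pos _).le), pow_one]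
    have h0 : 0 ≤ s * b a := mul_nonneg (le_of_lt hs) (hb a)
    exact mul_le_of_le_one_right (hb a) (Real.exp_le_one_iff.2 (neg_nonpos.2 h0))
  · refine Filter.Eventually.of_forall fun a s _ => ?_
    have h1 : HasDerivAt (fun s => Real.exp (-(s * b a))) (Real.exp (-(s * b a)) * -(b a)) s := by
      have := ((hasDerivAt_id s).mul_const (b a)).neg.exp
      simpa using this
    refine (h1.const_sub 1).congr_deriv ?_
    ring

lemma tendsto_one_div_add_one :
    Filter.Tendsto (fun n : ℕ => 1 / ((n : ℝ) + 1)) Filter.atTop (nhds 0) :=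
  tendsto_one_div_add_atTop_nhds_zero_nat

lemma tendsto_integral_pow_mul_exp_neg (hb : ∀ a, 0 ≤ b a) {r : ℕ}
    (hi : Integrable (fun a => b a ^ r) ν) (hm : AEStronglyMeasurable b ν) :
    Filter.Tendsto (fun n : ℕ => ∫ a, b a ^ r * Real.exp (-(1 / ((n : ℝ) + 1) * b a)) ∂ν)
      Filter.atTop (nhds (∫ a, b a ^ r ∂ν)) := by
  refine tendsto_integral_of_dominated_convergence (fun a => b a ^ r) (fun n => ?_) hi
    (fun n => Filter.Eventually.of_forall fun a => ?_) (Filter.Eventually.of_forall fun a => ?_)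
  · exact hi.aestronglyMeasurable.mul
      ((by fun_prop : Continuous fun x : ℝ =>
        Real.exp (-(1 / ((n : ℝ) + 1) * x))).comp_aestronglyMeasurable hm)
  · rw [Real.norm_of_nonneg (mul_nonneg (pow_nonneg (hb a) _) (Real.exp_pos _).le)]
    have h0 : 0 ≤ 1 / ((n : ℝ) + 1) * b a := mul_nonneg (by positivity) (hb a)
    exact mul_le_of_le_one_right (pow_nonneg (hb a) _) (Real.exp_le_one_iff.2 (neg_nonpos.2 h0))
  · have hc : Continuous fun t : ℝ => b a ^ r * Real.exp (-(t * b a)) := by fun_prop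
    simpa [Function.comp_def] using (hc.tendsto 0).comp tendsto_one_div_add_one

/-- The damped integrands increase as `1 / (n + 1)` decreases, so monotone convergence turns a
finite limit into both integrability and the value. No moment beyond the first is presupposed. -/
lemma integrable_pow_of_tendsto (hb : ∀ a, 0 ≤ b a) (hi : Integrable b ν) {r : ℕ} {L : ℝ}
    (h : Filter.Tendsto
      (fun n : ℕ => ∫ a, b a ^ (r + 1) * Real.exp (-(1 / ((n : ℝ) + 1) * b a)) ∂ν)
      Filter.atTop (nhds L)) :
    Integrable (fun a => b a ^ (r + 1)) ν ∧ ∫ a, b a ^ (r + 1) ∂ν = L := by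
  have hm : AEStronglyMeasurable (fun a => b a ^ (r + 1)) ν := hi.aestronglyMeasurable.pow _
  have hint : ∀ n : ℕ, Integrable
      (fun a => b a ^ (r + 1) * Real.exp (-(1 / ((n : ℝ) + 1) * b a))) ν := fun n =>
    integrable_pow_mul_exp_neg hb hi (by positivity) r
  have hnn : ∀ (n : ℕ) a, 0 ≤ b a ^ (r + 1) * Real.exp (-(1 / ((n : ℝ) + 1) * b a)) :=
    fun n a => mul_nonneg (pow_nonneg (hb a) _) (Real.exp_pos _).le
  have h1 : Filter.Tendsto (fun n : ℕ => ∫⁻ a, ENNReal.ofReal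
      (b a ^ (r + 1) * Real.exp (-(1 / ((n : ℝ) + 1) * b a))) ∂ν) Filter.atTop
      (nhds (∫⁻ a, ENNReal.ofReal (b a ^ (r + 1)) ∂ν)) := by
    refine lintegral_tendsto_of_tendsto_of_monotone
      (fun n => (hint n).aestronglyMeasurable.aemeasurable.ennreal_ofReal)
      (Filter.Eventually.of_forall fun a n n' hn => ?_) (Filter.Eventually.of_forall fun a => ?_)
    · refine ENNReal.ofReal_le_ofReal (mul_le_mul_of_nonneg_left (Real.exp_le_exp.2 ?_)
        (pow_nonneg (hb a) _))
      refine neg_le_neg (mul_le_mul_of_nonneg_right ?_ (hb a))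
      have : (n : ℝ) ≤ n' := by exact_mod_cast hn
      exact one_div_le_one_div_of_le (by positivity) (by linarith)
    · refine ENNReal.tendsto_ofReal ?_
      have hc : Continuous fun t : ℝ => b a ^ (r + 1) * Real.exp (-(t * b a)) := by fun_prop
      simpa [Function.comp_def] using (hc.tendsto 0).comp tendsto_one_div_add_one
  have h2 : Filter.Tendsto (fun n : ℕ => ∫⁻ a, ENNReal.ofReal
      (b a ^ (r + 1) * Real.exp (-(1 / ((n : ℝ) + 1) * b a))) ∂ν) Filter.atTop
      (nhds (ENNReal.ofReal L)) := by
    refine (ENNReal.tendsto_ofReal h).congr fun n => ?_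
    exact ofReal_integral_eq_lintegral_ofReal (hint n) (Filter.Eventually.of_forall (hnn n))
  have h3 := tendsto_nhds_unique h1 h2
  have hL : 0 ≤ L := ge_of_tendsto' h fun n => integral_nonneg (hnn n)
  have hn0 : ∀ a, 0 ≤ b a ^ (r + 1) := fun a => pow_nonneg (hb a) _
  refine ⟨⟨hm, ?_⟩, ?_⟩
  · rw [hasFiniteIntegral_iff_ofReal (Filter.Eventually.of_forall hn0), h3]
    exact ENNReal.ofReal_lt_top
  · rw [integral_eq_lintegral_of_nonneg_ae (Filter.Eventually.of_forall hn0) hm, h3,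
      ENNReal.toReal_ofReal hL]

/-- The first four moments of a nonnegative random variable whose Laplace transform is that of
a compound Poisson sum with Lévy measure the image of `ν` under `b`. -/
theorem moments_of_laplace {Ω : Type*} [MeasurableSpace Ω] {P : Measure Ω} [IsProbabilityMeasure P]
    {S : Ω → ℝ} (hS : ∀ ω, 0 ≤ S ω) (hSi : Integrable S P) (hb : ∀ a, 0 ≤ b a)
    (hbi : ∀ r : ℕ, 1 ≤ r → r ≤ 4 → Integrable (fun a => b a ^ r) ν)
    (hlap : ∀ t : ℝ, 0 < t → ∫ ω, Real.exp (-(t * S ω)) ∂P =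
      Real.exp (-∫ a, (1 - Real.exp (-(t * b a))) ∂ν))
    {c : ℕ → ℝ} (hc : ∀ r, c r = ∫ a, b a ^ r ∂ν) :
    (∫ ω, S ω ∂P = c 1) ∧
    (Integrable (fun ω => S ω ^ 2) P ∧ ∫ ω, S ω ^ 2 ∂P = c 2 + c 1 ^ 2) ∧
    (Integrable (fun ω => S ω ^ 3) P ∧ ∫ ω, S ω ^ 3 ∂P = c 3 + 3 * c 1 * c 2 + c 1 ^ 3) ∧
    (Integrable (fun ω => S ω ^ 4) P ∧ ∫ ω, S ω ^ 4 ∂P =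
      c 4 + 4 * c 1 * c 3 + 3 * c 2 ^ 2 + 6 * c 1 ^ 2 * c 2 + c 1 ^ 4) := by
  have hi : Integrable b ν := by simpa using hbi 1 le_rfl (by norm_num)
  -- Up to sign, `m r` is the `r`-th derivative of the Laplace transform, and `ψ r` (for `r ≥ 1`)
  -- that of its exponent. The derivative of the hypothesis is `m 1 = ψ 1 * m 0`; the Leibniz rule
  -- then yields the recursions up to order four.
  let m : ℕ → ℝ → ℝ := fun r t => ∫ ω, S ω ^ r * Real.exp (-(t * S ω)) ∂P
  let ψ : ℕ → ℝ → ℝ := fun r t => ∫ a, b a ^ r * Real.exp (-(t * b a)) ∂ν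
  have hm0 : ∀ t, 0 < t → m 0 t = 1 - ∫ ω, (1 - Real.exp (-(t * S ω))) ∂P := by
    intro t ht
    have h1 := integrable_one_sub_exp_neg hS hSi ht.le
    have h2 : ∫ ω, (1 - (1 - Real.exp (-(t * S ω)))) ∂P =
        1 - ∫ ω, (1 - Real.exp (-(t * S ω))) ∂P := by
      rw [integral_sub (integrable_const _) h1]; simp
    rw [← h2]
    simp [m]
  have hmd : ∀ r t, 0 < t → HasDerivAt (m r) (-(m (r + 1) t)) t := by
    intro r t ht
    cases r with
    | zero =>
      refine ((hasDerivAt_integral_one_sub_exp_neg hS hSi ht).const_sub 1).congr_of_eventuallyEq ?_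
      filter_upwards [Ioi_mem_nhds ht] with s hs using hm0 s hs
    | succ r => exact hasDerivAt_integral_pow_mul_exp_neg hS hSi ht r
  have hψd : ∀ r t, 0 < t → HasDerivAt (ψ (r + 1)) (-(ψ (r + 2) t)) t := fun r t ht =>
    hasDerivAt_integral_pow_mul_exp_neg hb hi ht r
  have h1 : ∀ t, 0 < t → m 1 t = ψ 1 t * m 0 t := by
    intro t ht
    have e1 := (hasDerivAt_integral_one_sub_exp_neg hb hi ht).neg.exp
    have e2 := (hmd 0 t ht).congr_of_eventuallyEq (f₁ := fun t =>
        Real.exp (-∫ a, (1 - Real.exp (-(t * b a))) ∂ν)) (by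
      filter_upwards [Ioi_mem_nhds ht] with s hs
      rw [← hlap s hs]; simp [m])
    have e3 := e1.unique e2
    have e4 := hlap t ht
    simp only [Pi.neg_apply] at e3
    rw [← e4] at e3
    simp only [m, ψ, pow_zero, one_mul, zero_add] at e3 ⊢
    linarith
  have h2 : ∀ t, 0 < t → m 2 t = ψ 2 t * m 0 t + ψ 1 t * m 1 t := by
    intro t ht
    have e1 := ((hψd 0 t ht).mul (hmd 0 t ht)).unique
      ((hmd 1 t ht).congr_of_eventuallyEq (by
        filter_upwards [Ioi_mem_nhds ht] with s hs using (h1 s hs).symm))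
    simp only [zero_add, Nat.reduceAdd] at e1
    linarith
  have h3 : ∀ t, 0 < t → m 3 t = ψ 3 t * m 0 t + 2 * ψ 2 t * m 1 t + ψ 1 t * m 2 t := by
    intro t ht
    have e1 := (((hψd 1 t ht).mul (hmd 0 t ht)).add ((hψd 0 t ht).mul (hmd 1 t ht))).unique
      ((hmd 2 t ht).congr_of_eventuallyEq (by
        filter_upwards [Ioi_mem_nhds ht] with s hs using (h2 s hs).symm))
    simp only [zero_add, Nat.reduceAdd] at e1
    linarith
  have h4 : ∀ t, 0 < t → m 4 t =
      ψ 4 t * m 0 t + 3 * ψ 3 t * m 1 t + 3 * ψ 2 t * m 2 t + ψ 1 t * m 3 t := by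
    intro t ht
    have e1 := ((((hψd 2 t ht).mul (hmd 0 t ht)).add
      (((hψd 1 t ht).const_mul 2).mul (hmd 1 t ht))).add ((hψd 0 t ht).mul (hmd 2 t ht))).unique
      ((hmd 3 t ht).congr_of_eventuallyEq (by
        filter_upwards [Ioi_mem_nhds ht] with s hs using (h3 s hs).symm))
    simp only [zero_add, Nat.reduceAdd] at e1
    linarith
  -- Along `τ n → 0`, `ψ r` tends to `c r` and `m 0` to 1, so the recursions force the limits of `m
  -- 1, …, m 4` in turn.
  let τ : ℕ → ℝ := fun n => 1 / ((n : ℝ) + 1)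
  have hτ : ∀ n, 0 < τ n := fun n => by positivity
  have lψ : ∀ r, 1 ≤ r → r ≤ 4 →
      Filter.Tendsto (fun n => ψ r (τ n)) Filter.atTop (nhds (c r)) := by
    intro r hr hr'
    rw [hc]
    exact tendsto_integral_pow_mul_exp_neg hb (hbi r hr hr') hi.aestronglyMeasurable
  have l0 : Filter.Tendsto (fun n => m 0 (τ n)) Filter.atTop (nhds 1) := by
    have := tendsto_integral_pow_mul_exp_neg (ν := P) hS (r := 0) (by simp)
      hSi.aestronglyMeasurable
    simpa [m, τ] using this
  have l1 := ((lψ 1 (by norm_num) (by norm_num)).mul l0).congr fun n => (h1 _ (hτ n)).symm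
  have l2 := (((lψ 2 (by norm_num) (by norm_num)).mul l0).add
    ((lψ 1 (by norm_num) (by norm_num)).mul l1)).congr fun n => (h2 _ (hτ n)).symm
  have l3 := ((((lψ 3 (by norm_num) (by norm_num)).mul l0).add
    (((lψ 2 (by norm_num) (by norm_num)).const_mul 2).mul l1)).add
    ((lψ 1 (by norm_num) (by norm_num)).mul l2)).congr fun n => (h3 _ (hτ n)).symm
  have l4 := (((((lψ 4 (by norm_num) (by norm_num)).mul l0).add
    (((lψ 3 (by norm_num) (by norm_num)).const_mul 3).mul l1)).add
    (((lψ 2 (by norm_num) (by norm_num)).const_mul 3).mul l2)).add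
    ((lψ 1 (by norm_num) (by norm_num)).mul l3)).congr fun n => (h4 _ (hτ n)).symm
  have r1 := integrable_pow_of_tendsto hS hSi l1
  have r2 := integrable_pow_of_tendsto hS hSi l2
  have r3 := integrable_pow_of_tendsto hS hSi l3
  have r4 := integrable_pow_of_tendsto hS hSi l4
  refine ⟨?_, ⟨r2.1, r2.2.trans (by ring)⟩, ⟨r3.1, r3.2.trans (by ring)⟩,
    r4.1, r4.2.trans (by ring)⟩
  simpa using r1.2

end LaplaceMoments

/-! ### Campbell's formula and the Laplace functional of a Poisson process -/

section Poisson

lemma lintegral_natCast_poissonMeasure (r : ℝ≥0) :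
    ∫⁻ n : ℕ, (n : ℝ≥0∞) ∂(poissonMeasure r) = r := by
  rw [lintegral_countable', tsum_eq_zero_add' ENNReal.summable]
  simp only [Nat.cast_zero, zero_mul, zero_add]
  have h1 : ∀ n : ℕ, ((n + 1 : ℕ) : ℝ≥0∞) * poissonMeasure r {n + 1} =
      r * poissonMeasure r {n} := by
    intro n
    rw [poissonMeasure_singleton, poissonMeasure_singleton, ← ENNReal.ofReal_natCast,
      ← ENNReal.ofReal_coe_nnreal (p := r), ← ENNReal.ofReal_mul (by positivity),
      ← ENNReal.ofReal_mul (by positivity)]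
    congr 1
    rw [Nat.factorial_succ]
    push_cast
    field_simp
    ring
  simp_rw [h1]
  rw [ENNReal.tsum_mul_left]
  have h2 := lintegral_countable' (μ := poissonMeasure r) (fun _ => 1)
  simp only [lintegral_const, measure_univ, one_mul] at h2
  rw [← h2, mul_one]

lemma integral_exp_neg_poissonMeasure (r : ℝ≥0) (t : ℝ) :
    ∫ n : ℕ, Real.exp (-(t * n)) ∂(poissonMeasure r) = Real.exp (-(r * (1 - Real.exp (-t)))) := by
  rw [integral_poissonMeasure]
  have h1 : ∀ n : ℕ, (Real.exp (-r) * (r : ℝ) ^ n / n.factorial) • Real.exp (-(t * n)) =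
      Real.exp (-r) * ((r * Real.exp (-t)) ^ n / n.factorial) := by
    intro n
    rw [mul_pow, ← Real.exp_nat_mul, smul_eq_mul]
    ring_nf
  simp_rw [h1]
  rw [tsum_mul_left]
  have h2 : ∑' n : ℕ, (r * Real.exp (-t)) ^ n / n.factorial = Real.exp (r * Real.exp (-t)) := by
    rw [Real.exp_eq_exp_ℝ, NormedSpace.exp_eq_tsum_div]
  rw [h2, ← Real.exp_add]
  congr 1
  ring

variable {Ω : Type*} [MeasurableSpace Ω] {P : Measure Ω} {X : ℕ → Ω → Plane} {Λ : Measure Plane}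

lemma measurable_pointCount (hX : ∀ n, Measurable (X n)) {A : Set Plane} (hA : MeasurableSet A) :
    Measurable fun ω => pointCount (fun n => X n ω) A := by
  unfold pointCount
  exact Measurable.tsum fun n => (measurable_one.indicator hA).comp (hX n)

lemma IsPoissonProcess.lintegral_pointCount (hX : IsPoissonProcess P X Λ) {A : Set Plane}
    (hA : MeasurableSet A) (hf : Λ A ≠ ∞) :
    ∫⁻ ω, pointCount (fun n => X n ω) A ∂P = Λ A := by
  have h1 := lintegral_map (μ := P) (f := fun x : ℝ≥0∞ => x) measurable_id
    (measurable_pointCount hX.measurable hA)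
  rw [← h1, (hX.hasLaw A hA hf).map_eq, lintegral_map (f := fun x : ℝ≥0∞ => x) measurable_id
      measurable_from_nat,
    lintegral_natCast_poissonMeasure, ENNReal.coe_toNNReal hf]

/-- Campbell's formula, on the level of measures. -/
lemma IsPoissonProcess.sum_map_eq [SigmaFinite Λ] (hX : IsPoissonProcess P X Λ) :
    Measure.sum (fun n => P.map (X n)) = Λ := by
  have key : ∀ A, MeasurableSet A → Λ A ≠ ∞ → Measure.sum (fun n => P.map (X n)) A = Λ A := by
    intro A hA hf
    rw [← hX.lintegral_pointCount hA hf, Measure.sum_apply _ hA]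
    unfold pointCount
    have h1 : ∀ n, Measurable fun ω => A.indicator (1 : Plane → ℝ≥0∞) (X n ω) := fun n =>
      (measurable_one.indicator hA).comp (hX.measurable n)
    rw [lintegral_tsum fun n => (h1 n).aemeasurable]
    refine tsum_congr fun n => ?_
    rw [Measure.map_apply (hX.measurable n) hA, ← lintegral_indicator_one (hX.measurable n hA)]
    rfl
  -- The counts have a prescribed law only on sets of finite intensity; σ-finiteness extends the
  -- equality to all measurable sets.
  rw [Measure.ext_iff_of_iUnion_eq_univ (iUnion_spanningSets Λ)]
  intro i
  ext A hA
  rw [Measure.restrict_apply hA, Measure.restrict_apply hA]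
  refine key _ (hA.inter (measurableSet_spanningSets Λ i)) ?_
  exact (lt_of_le_of_lt (measure_mono Set.inter_subset_right)
    (measure_spanningSets_lt_top Λ i)).ne

lemma IsPoissonProcess.tsum_lintegral [SigmaFinite Λ] (hX : IsPoissonProcess P X Λ)
    {f : Plane → ℝ≥0∞} (hf : Measurable f) :
    ∑' n, ∫⁻ ω, f (X n ω) ∂P = ∫⁻ x, f x ∂Λ := by
  conv_rhs => rw [← hX.sum_map_eq]
  rw [lintegral_sum_measure]
  exact tsum_congr fun n => (lintegral_map hf (hX.measurable n)).symm

lemma summable_of_tsum_ofReal_ne_top {u : ℕ → ℝ} (hu : ∀ n, 0 ≤ u n)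
    (h : ∑' n, ENNReal.ofReal (u n) ≠ ∞) : Summable u :=
  (ENNReal.summable_toReal h).congr fun n => ENNReal.toReal_ofReal (hu n)

lemma IsPoissonProcess.ae_summable [SigmaFinite Λ] (hX : IsPoissonProcess P X Λ)
    {f : Plane → ℝ} (hf : Measurable f) (hf0 : ∀ x, 0 ≤ f x) (hfi : Integrable f Λ) :
    ∀ᵐ ω ∂P, Summable fun n => f (X n ω) := by
  have h0 : ∀ n, Measurable fun ω => ENNReal.ofReal (f (X n ω)) := fun n =>
    hf.ennreal_ofReal.comp (hX.measurable n)
  have h1 : ∫⁻ ω, ∑' n, ENNReal.ofReal (f (X n ω)) ∂P ≠ ∞ := by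
    rw [lintegral_tsum fun n => (h0 n).aemeasurable,
      hX.tsum_lintegral hf.ennreal_ofReal]
    exact ((hasFiniteIntegral_iff_ofReal (Filter.Eventually.of_forall hf0)).1 hfi.2).ne
  filter_upwards [ae_lt_top (Measurable.tsum h0) h1] with ω hω
  exact summable_of_tsum_ofReal_ne_top (fun n => hf0 _) hω.ne

lemma IsPoissonProcess.integral_exp_neg_pointCount (hX : IsPoissonProcess P X Λ) {A : Set Plane}
    (hA : MeasurableSet A) (hf : Λ A ≠ ∞) (c : ℝ) :
    ∫ ω, Real.exp (-(c * (pointCount (fun n => X n ω) A).toReal)) ∂P =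
      Real.exp (-(Λ.real A * (1 - Real.exp (-c)))) := by
  have hm : Measurable fun x : ℝ≥0∞ => Real.exp (-(c * x.toReal)) := by fun_prop
  have h1 := integral_map (μ := P) (measurable_pointCount hX.measurable hA).aemeasurable
    hm.aestronglyMeasurable
  rw [← h1, (hX.hasLaw A hA hf).map_eq, integral_map measurable_from_nat.aemeasurable
    hm.aestronglyMeasurable]
  simp only [ENNReal.toReal_natCast]
  rw [integral_exp_neg_poissonMeasure]
  rfl

/-- The Laplace functional of a Poisson process at a simple function. -/
lemma IsPoissonProcess.integral_exp_neg_tsum_simpleFunc [IsProbabilityMeasure P]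
    [SigmaFinite Λ] (hX : IsPoissonProcess P X Λ) (G : SimpleFunc Plane ℝ)
    (hGi : Integrable G Λ) :
    ∫ ω, Real.exp (-∑' n, G (X n ω)) ∂P = Real.exp (-∫ x, (1 - Real.exp (-G x)) ∂Λ) := by
  classical
  -- The value 0 is left out because its fibre may have infinite intensity. The other fibres are
  -- disjoint with finite intensity, so the counts on them are independent Poisson variables.
  let s : Finset ℝ := G.range.filter (· ≠ 0)
  let e := s.equivFin.symm
  let A : Fin s.card → Set Plane := fun i => G ⁻¹' {(e i : ℝ)}
  have hne : ∀ i, (e i : ℝ) ≠ 0 := fun i => (Finset.mem_filter.1 (e i).2).2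
  have hA : ∀ i, MeasurableSet (A i) := fun i => G.measurableSet_fiber _
  have hfin : ∀ i, Λ (A i) ≠ ∞ := fun i =>
    ((SimpleFunc.integrable_iff.1 hGi) _ (hne i)).ne
  have hdisj : Pairwise (Function.onFun Disjoint A) := by
    intro i j hij
    rw [Function.onFun, Set.disjoint_left]
    intro x hx hx'
    exact hij (e.injective (Subtype.ext (hx.symm.trans hx')))
  -- Used twice: for `φ y = 1 - e^{-y}` in the exponent and for `φ = id` in the sum over the points.
  have hsum : ∀ (φ : ℝ → ℝ), φ 0 = 0 → ∀ x,
      φ (G x) = ∑ i, (A i).indicator (fun _ => φ (e i)) x := by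
    intro φ hφ x
    by_cases hx : G x = 0
    · rw [hx, hφ, Finset.sum_eq_zero]
      intro i _
      refine Set.indicator_of_notMem ?_ _
      intro (h : G x = e i)
      exact hne i (h.symm.trans hx)
    · have hxs : G x ∈ s := Finset.mem_filter.2 ⟨G.mem_range_self x, hx⟩
      rw [Finset.sum_eq_single (e.symm ⟨G x, hxs⟩)]
      · rw [Set.indicator_of_mem]
        · simp
        · change G x = _; simp
      · intro i _ hi
        refine Set.indicator_of_notMem ?_ _
        intro (h : G x = e i)
        apply hi
        rw [Equiv.eq_symm_apply]
        exact Subtype.ext h.symm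
      · intro h; exact absurd (Finset.mem_univ _) h
  have hint : ∫ x, (1 - Real.exp (-G x)) ∂Λ = ∑ i, Λ.real (A i) * (1 - Real.exp (-(e i))) := by
    have h1 : ∀ x, 1 - Real.exp (-G x) =
        ∑ i, (A i).indicator (fun _ => 1 - Real.exp (-(e i : ℝ))) x :=
      fun x => hsum (fun y => 1 - Real.exp (-y)) (by simp) x
    simp_rw [h1]
    rw [integral_finsetSum]
    · refine Finset.sum_congr rfl fun i _ => ?_
      rw [integral_indicator_const _ (hA i), smul_eq_mul]
    · intro i _
      exact (integrable_indicator_iff (hA i)).2 (integrableOn_const (hfin i))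
  have hcount : ∀ᵐ ω ∂P, ∑' n, G (X n ω) =
      ∑ i, (e i : ℝ) * (pointCount (fun n => X n ω) (A i)).toReal := by
    have h1 : ∀ᵐ ω ∂P, ∀ i, pointCount (fun n => X n ω) (A i) < ∞ := by
      rw [ae_all_iff]
      intro i
      refine ae_lt_top (measurable_pointCount hX.measurable (hA i)) ?_
      rw [hX.lintegral_pointCount (hA i) (hfin i)]
      exact hfin i
    filter_upwards [h1] with ω hω
    have h2 : ∀ i, HasSum (fun n => (A i).indicator (fun _ => (e i : ℝ)) (X n ω))
        ((e i : ℝ) * (pointCount (fun n => X n ω) (A i)).toReal) := by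
      intro i
      have h3 : HasSum (fun n => ((A i).indicator (1 : Plane → ℝ≥0∞) (X n ω)).toReal)
          (pointCount (fun n => X n ω) (A i)).toReal := by
        have h4 := ENNReal.hasSum_toReal (hω i).ne
        rwa [← ENNReal.tsum_toReal_eq fun n => ENNReal.ne_top_of_tsum_ne_top (hω i).ne n] at h4
      refine (h3.mul_left (e i : ℝ)).congr_fun fun n => ?_
      by_cases hx : X n ω ∈ A i <;> simp [hx]
    have h4 := hasSum_sum (s := Finset.univ) fun i _ => h2 i
    rw [← h4.tsum_eq]
    exact tsum_congr fun n => hsum id rfl _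
  have hind := (hX.indep s.card A hA hfin hdisj).comp
    (fun i x => Real.exp (-((e i : ℝ) * x.toReal))) (fun i => by fun_prop)
  have hprod := hind.integral_fun_prod_eq_prod_integral fun i =>
    ((by fun_prop : Measurable fun x : ℝ≥0∞ => Real.exp (-((e i : ℝ) * x.toReal))).comp
      (measurable_pointCount hX.measurable (hA i))).aestronglyMeasurable
  simp only [Function.comp_apply] at hprod
  calc ∫ ω, Real.exp (-∑' n, G (X n ω)) ∂P
      = ∫ ω, ∏ i, Real.exp (-((e i : ℝ) * (pointCount (fun n => X n ω) (A i)).toReal)) ∂P := by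
        refine integral_congr_ae ?_
        filter_upwards [hcount] with ω hω
        rw [hω, ← Real.exp_sum, Finset.sum_neg_distrib]
    _ = _ := by
        rw [hprod, hint, ← Finset.sum_neg_distrib, Real.exp_sum]
        exact Finset.prod_congr rfl fun i _ => hX.integral_exp_neg_pointCount (hA i) (hfin i) _

/-- The Laplace functional of a Poisson process. -/
theorem IsPoissonProcess.integral_exp_neg_tsum [IsProbabilityMeasure P] [SigmaFinite Λ]
    (hX : IsPoissonProcess P X Λ) {g : Plane → ℝ} (hg : Measurable g) (hg0 : ∀ x, 0 ≤ g x)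
    (hgi : Integrable g Λ) :
    ∫ ω, Real.exp (-∑' n, g (X n ω)) ∂P = Real.exp (-∫ x, (1 - Real.exp (-g x)) ∂Λ) := by
  let f : Plane → ℝ≥0∞ := fun x => ENNReal.ofReal (g x)
  have hf : Measurable f := hg.ennreal_ofReal
  -- Simple functions increasing to `g`. Being below `g`, they are integrable, and `g` dominates
  -- both the sums over the points and the integrals in the exponent.
  let G : ℕ → SimpleFunc Plane ℝ := fun m => (SimpleFunc.eapprox f m).map ENNReal.toReal
  have hG0 : ∀ m x, 0 ≤ G m x := fun m x => ENNReal.toReal_nonneg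
  have hle : ∀ m x, SimpleFunc.eapprox f m x ≤ f x := fun m x => by
    rw [← SimpleFunc.iSup_eapprox_apply hf x]
    exact le_iSup (fun m => SimpleFunc.eapprox f m x) m
  have hGg : ∀ m x, G m x ≤ g x := fun m x => by
    have := ENNReal.toReal_mono ENNReal.ofReal_ne_top (hle m x)
    rwa [ENNReal.toReal_ofReal (hg0 x)] at this
  have hlim : ∀ x, Filter.Tendsto (fun m => G m x) Filter.atTop (nhds (g x)) := fun x => by
    have h1 : Filter.Tendsto (fun m => SimpleFunc.eapprox f m x) Filter.atTop (nhds (f x)) := by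
      rw [← SimpleFunc.iSup_eapprox_apply hf x]
      exact tendsto_atTop_iSup fun m n hmn => SimpleFunc.monotone_eapprox f hmn x
    have := (ENNReal.tendsto_toReal ENNReal.ofReal_ne_top).comp h1
    rwa [ENNReal.toReal_ofReal (hg0 x)] at this
  have hGi : ∀ m, Integrable (G m) Λ := fun m =>
    hgi.mono' (G m).aestronglyMeasurable
      (Filter.Eventually.of_forall fun x => by
        rw [Real.norm_of_nonneg (hG0 m x)]; exact hGg m x)
  have hL : Filter.Tendsto (fun m => ∫ ω, Real.exp (-∑' n, G m (X n ω)) ∂P) Filter.atTop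
      (nhds (∫ ω, Real.exp (-∑' n, g (X n ω)) ∂P)) := by
    refine tendsto_integral_of_dominated_convergence (fun _ => 1) (fun m => ?_)
      (integrable_const 1) (fun m => Filter.Eventually.of_forall fun ω => ?_) ?_
    · refine Measurable.aestronglyMeasurable ?_
      exact (Measurable.tsum fun n => (G m).measurable.comp (hX.measurable n)).neg.exp
    · rw [Real.norm_of_nonneg (Real.exp_pos _).le, Real.exp_le_one_iff]
      exact neg_nonpos.2 (tsum_nonneg fun n => hG0 m _)
    · filter_upwards [hX.ae_summable hg hg0 hgi] with ω hω
      refine ((Real.continuous_exp.tendsto _).comp (Filter.Tendsto.neg ?_))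
      refine tendsto_tsum_of_dominated_convergence hω (fun n => hlim _)
        (Filter.Eventually.of_forall fun m n => ?_)
      rw [Real.norm_of_nonneg (hG0 m _)]
      exact hGg m _
  have hR : Filter.Tendsto (fun m => ∫ x, (1 - Real.exp (-G m x)) ∂Λ) Filter.atTop
      (nhds (∫ x, (1 - Real.exp (-g x)) ∂Λ)) := by
    refine tendsto_integral_of_dominated_convergence g (fun m => ?_) hgi
      (fun m => Filter.Eventually.of_forall fun x => ?_) (Filter.Eventually.of_forall fun x => ?_)
    · exact (((G m).measurable.neg.exp).const_sub 1).aestronglyMeasurable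
    · rw [Real.norm_of_nonneg
        (by linarith [Real.exp_le_one_iff.2 (neg_nonpos.2 (hG0 m x))])]
      linarith [Real.add_one_le_exp (-(G m x)), hGg m x]
    · exact (((Real.continuous_exp.tendsto _).comp (hlim x).neg).const_sub 1)
  refine tendsto_nhds_unique hL ?_
  have := (Real.continuous_exp.tendsto _).comp hR.neg
  refine this.congr fun m => ?_
  exact (hX.integral_exp_neg_tsum_simpleFunc (G m) (hGi m)).symm

end Poisson

/-! ### Sums over a Poisson process with independent marks -/

section MarkedPoisson

/-- Fubini for independent variables; it serves to average over the marks with the locations frozen.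
-/
lemma integral_prodMk_of_indepFun {Ω α β : Type*} [MeasurableSpace Ω] [MeasurableSpace α]
    [MeasurableSpace β] {P : Measure Ω} [IsProbabilityMeasure P] {X : Ω → α} {Y : Ω → β}
    (hX : Measurable X) (hY : Measurable Y) (h : IndepFun X Y P) {H : α × β → ℝ}
    (hH : Measurable H) {C : ℝ} (hC : ∀ z, ‖H z‖ ≤ C) :
    ∫ ω, H (X ω, Y ω) ∂P = ∫ ω, ∫ ω', H (X ω, Y ω') ∂P ∂P := by
  have := Measure.isProbabilityMeasure_map (μ := P) hX.aemeasurable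
  have := Measure.isProbabilityMeasure_map (μ := P) hY.aemeasurable
  have h1 := integral_map (μ := P) (hX.prodMk hY).aemeasurable hH.aestronglyMeasurable
  rw [← h1, (indepFun_iff_map_prod_eq_prod_map_map hX.aemeasurable hY.aemeasurable).1 h,
    integral_prod H ((integrable_const C).mono' hH.aestronglyMeasurable
      (Filter.Eventually.of_forall hC)),
    integral_map hX.aemeasurable
      (hH.stronglyMeasurable.integral_prod_right').aestronglyMeasurable]
  refine integral_congr_ae (Filter.Eventually.of_forall fun ω => ?_)
  exact integral_map hY.aemeasurable (hH.comp measurable_prodMk_left).aestronglyMeasurable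

variable {ρ : Measure ℝ} {w : ℝ → ℝ}

lemma integrable_exp_neg_mark [IsProbabilityMeasure ρ] (hw : Measurable w) (hw0 : ∀ z, 0 ≤ w z)
    {u : ℝ}
    (hu : 0 ≤ u) : Integrable (fun z => Real.exp (-(u * w z))) ρ :=
  (integrable_const (1 : ℝ)).mono' ((hw.const_mul u).neg.exp).aestronglyMeasurable
    (Filter.Eventually.of_forall fun z => by
      rw [Real.norm_of_nonneg (Real.exp_pos _).le, Real.exp_le_one_iff]
      exact neg_nonpos.2 (mul_nonneg hu (hw0 z)))

/-- Jensen's inequality for the Laplace transform of the marks. -/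
lemma exp_neg_le_laplace [IsProbabilityMeasure ρ] (hw : Measurable w) (hw0 : ∀ z, 0 ≤ w z)
    (hwi : Integrable w ρ) {u : ℝ} (hu : 0 ≤ u) :
    Real.exp (-(u * ∫ z, w z ∂ρ)) ≤ ∫ z, Real.exp (-(u * w z)) ∂ρ := by
  set m := ∫ z, w z ∂ρ
  -- The integrand is the tangent to `e^{-u·}` at the mean `m`, which lies below the convex
  -- function.
  have h1 : ∫ z, Real.exp (-(u * m)) * (1 + u * m - u * w z) ∂ρ = Real.exp (-(u * m)) := by
    rw [integral_const_mul, integral_sub (integrable_const _) (hwi.const_mul u),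
      integral_const_mul]
    simp [m]
  rw [← h1]
  refine integral_mono (((integrable_const _).sub (hwi.const_mul u)).const_mul _)
    (integrable_exp_neg_mark hw hw0 hu) fun z => ?_
  simp only
  have h2 : Real.exp (-(u * w z)) = Real.exp (-(u * m)) * Real.exp (u * m - u * w z) := by
    rw [← Real.exp_add]; congr 1; ring
  rw [h2]
  refine mul_le_mul_of_nonneg_left ?_ (Real.exp_pos _).le
  linarith [Real.add_one_le_exp (u * m - u * w z)]

lemma laplace_le_one [IsProbabilityMeasure ρ] (hw : Measurable w) (hw0 : ∀ z, 0 ≤ w z)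
    {u : ℝ} (hu : 0 ≤ u) :
    ∫ z, Real.exp (-(u * w z)) ∂ρ ≤ 1 := by
  have h1 : ∫ _, (1 : ℝ) ∂ρ = 1 := by simp
  rw [← h1]
  refine integral_mono (integrable_exp_neg_mark hw hw0 hu) (integrable_const _) fun z => ?_
  exact Real.exp_le_one_iff.2 (neg_nonpos.2 (mul_nonneg hu (hw0 z)))

variable {Ω : Type*} [MeasurableSpace Ω] {P : Measure Ω} {X : ℕ → Ω → Plane} {Λ : Measure Plane}
  {ζ : ℕ → Ω → ℝ} {f : Plane → ℝ}

/-- A Poisson process whose points carry i.i.d. marks of law `ρ`. -/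
structure IsMarkedPoissonProcess (P : Measure Ω) (X : ℕ → Ω → Plane) (Λ : Measure Plane)
    (ζ : ℕ → Ω → ℝ) (ρ : Measure ℝ) : Prop where
  poisson : IsPoissonProcess P X Λ
  measurable_mark : ∀ n, Measurable (ζ n)
  map_mark : ∀ n, P.map (ζ n) = ρ
  iIndep_mark : iIndepFun ζ P
  indep : IndepFun (fun ω n => X n ω) (fun ω n => ζ n ω) P

namespace IsMarkedPoissonProcess

lemma lintegral_tsum_ne_top [SigmaFinite Λ] (hX : IsMarkedPoissonProcess P X Λ ζ ρ)
    (hw : Measurable w) (hw0 : ∀ z, 0 ≤ w z) (hwi : Integrable w ρ)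
    (hf : Measurable f) (hf0 : ∀ x, 0 ≤ f x) (hfi : Integrable f Λ) :
    ∫⁻ ω, ∑' n, ENNReal.ofReal (f (X n ω) * w (ζ n ω)) ∂P ≠ ∞ := by
  have hm : ∀ n, Measurable fun ω => ENNReal.ofReal (f (X n ω) * w (ζ n ω)) := fun n =>
    ((hf.comp (hX.poisson.measurable n)).mul
      (hw.comp (hX.measurable_mark n))).ennreal_ofReal
  rw [lintegral_tsum fun n => (hm n).aemeasurable]
  have h1 : ∀ n, ∫⁻ ω, ENNReal.ofReal (f (X n ω) * w (ζ n ω)) ∂P =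
      (∫⁻ ω, ENNReal.ofReal (f (X n ω)) ∂P) * ∫⁻ z, ENNReal.ofReal (w z) ∂ρ := by
    intro n
    have h2 : IndepFun (fun ω => ENNReal.ofReal (f (X n ω))) (fun ω => ENNReal.ofReal (w (ζ n ω)))
        P :=
      hX.indep.comp (φ := fun x : ℕ → Plane => ENNReal.ofReal (f (x n)))
        (ψ := fun z : ℕ → ℝ => ENNReal.ofReal (w (z n)))
        (hf.ennreal_ofReal.comp (measurable_pi_apply n))
        (hw.ennreal_ofReal.comp (measurable_pi_apply n))
    have hfm : Measurable fun ω => ENNReal.ofReal (f (X n ω)) :=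
      hf.ennreal_ofReal.comp (hX.poisson.measurable n)
    have hwm : Measurable fun ω => ENNReal.ofReal (w (ζ n ω)) :=
      hw.ennreal_ofReal.comp (hX.measurable_mark n)
    simp_rw [ENNReal.ofReal_mul (hf0 _)]
    rw [lintegral_mul_eq_lintegral_mul_lintegral_of_indepFun''
      hfm.aemeasurable hwm.aemeasurable h2, ← hX.map_mark n,
      lintegral_map hw.ennreal_ofReal (hX.measurable_mark n)]
  simp_rw [h1]
  rw [ENNReal.tsum_mul_right, hX.poisson.tsum_lintegral hf.ennreal_ofReal]
  exact ENNReal.mul_ne_top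
    ((hasFiniteIntegral_iff_ofReal (Filter.Eventually.of_forall hf0)).1 hfi.2).ne
    ((hasFiniteIntegral_iff_ofReal (Filter.Eventually.of_forall hw0)).1 hwi.2).ne

lemma ae_summable [SigmaFinite Λ] (hX : IsMarkedPoissonProcess P X Λ ζ ρ)
    (hw : Measurable w) (hw0 : ∀ z, 0 ≤ w z) (hwi : Integrable w ρ)
    (hf : Measurable f) (hf0 : ∀ x, 0 ≤ f x) (hfi : Integrable f Λ) :
    ∀ᵐ ω ∂P, Summable fun n => f (X n ω) * w (ζ n ω) := by
  have hm : ∀ n, Measurable fun ω => ENNReal.ofReal (f (X n ω) * w (ζ n ω)) := fun n =>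
    ((hf.comp (hX.poisson.measurable n)).mul
      (hw.comp (hX.measurable_mark n))).ennreal_ofReal
  filter_upwards [ae_lt_top (Measurable.tsum hm)
    (hX.lintegral_tsum_ne_top hw hw0 hwi hf hf0 hfi)] with ω hω
  exact summable_of_tsum_ofReal_ne_top (fun n => mul_nonneg (hf0 _) (hw0 _)) hω.ne

lemma measurable_tsum (hX : IsMarkedPoissonProcess P X Λ ζ ρ) (hw : Measurable w)
    (hf : Measurable f) : Measurable fun ω => ∑' n, f (X n ω) * w (ζ n ω) :=
  Measurable.tsum fun n =>
    (hf.comp (hX.poisson.measurable n)).mul (hw.comp (hX.measurable_mark n))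

lemma integrable_tsum [SigmaFinite Λ] (hX : IsMarkedPoissonProcess P X Λ ζ ρ)
    (hw : Measurable w) (hw0 : ∀ z, 0 ≤ w z) (hwi : Integrable w ρ)
    (hf : Measurable f) (hf0 : ∀ x, 0 ≤ f x) (hfi : Integrable f Λ) :
    Integrable (fun ω => ∑' n, f (X n ω) * w (ζ n ω)) P := by
  refine ⟨(hX.measurable_tsum hw hf).aestronglyMeasurable, ?_⟩
  rw [hasFiniteIntegral_iff_ofReal (Filter.Eventually.of_forall fun ω =>
    tsum_nonneg fun n => mul_nonneg (hf0 _) (hw0 _))]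
  refine lt_of_le_of_lt (lintegral_mono_ae ?_)
    (hX.lintegral_tsum_ne_top hw hw0 hwi hf hf0 hfi).lt_top
  filter_upwards [hX.ae_summable hw hw0 hwi hf hf0 hfi] with ω hω
  rw [ENNReal.ofReal_tsum_of_nonneg (fun n => mul_nonneg (hf0 _) (hw0 _)) hω]

/-- The Laplace transform of a sum over a marked Poisson process. -/
theorem integral_exp_neg_tsum [IsProbabilityMeasure ρ] [IsProbabilityMeasure P] [SigmaFinite Λ]
    (hX : IsMarkedPoissonProcess P X Λ ζ ρ)
    (hw : Measurable w) (hw0 : ∀ z, 0 ≤ w z) (hwi : Integrable w ρ)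
    (hf : Measurable f) (hf0 : ∀ x, 0 ≤ f x) (hfi : Integrable f Λ) :
    ∫ ω, Real.exp (-∑' n, f (X n ω) * w (ζ n ω)) ∂P =
      Real.exp (-∫ a, (1 - Real.exp (-(f a.1 * w a.2))) ∂(Λ.prod ρ)) := by
  -- Averaging over the mark of a point at `x` replaces `e^{-f(x) w}` by `V x = e^{-g x}` with `g =
  -- -log V`. This reduces the claim to an unmarked process, and Jensen gives `g ≤ f · ∫ w`, hence
  -- integrability.
  let V : Plane → ℝ := fun x => ∫ z, Real.exp (-(f x * w z)) ∂ρ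
  have hV : Measurable V := by
    have h1 : Measurable fun a : Plane × ℝ => Real.exp (-(f a.1 * w a.2)) := by fun_prop
    exact h1.stronglyMeasurable.integral_prod_right'.measurable
  have hVpos : ∀ x, 0 < V x := fun x =>
    (Real.exp_pos _).trans_le (exp_neg_le_laplace hw hw0 hwi (hf0 x))
  let g : Plane → ℝ := fun x => -Real.log (V x)
  have hg : Measurable g := hV.log.neg
  have hexpg : ∀ x, Real.exp (-g x) = V x := fun x => by simp [g, Real.exp_log (hVpos x)]
  have hg0 : ∀ x, 0 ≤ g x := fun x =>
    neg_nonneg.2 (Real.log_nonpos (hVpos x).le (laplace_le_one hw hw0 (hf0 x)))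
  have hgi : Integrable g Λ := by
    refine (hfi.mul_const (∫ z, w z ∂ρ)).mono' hg.aestronglyMeasurable
      (Filter.Eventually.of_forall fun x => ?_)
    rw [Real.norm_of_nonneg (hg0 x)]
    have := (Real.le_log_iff_exp_le (hVpos x)).2 (exp_neg_le_laplace hw hw0 hwi (hf0 x))
    simp only [g]
    linarith
  have hXm : Measurable fun ω n => X n ω := measurable_pi_lambda _ hX.poisson.measurable
  have hζm : Measurable fun ω n => ζ n ω := measurable_pi_lambda _ hX.measurable_mark
  -- Independence of the marks factors finite products only, so the reduction is made for partial
  -- sums and followed by a limit.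
  have hpart : ∀ N : ℕ, ∫ ω, Real.exp (-∑ n ∈ Finset.range N, f (X n ω) * w (ζ n ω)) ∂P =
      ∫ ω, Real.exp (-∑ n ∈ Finset.range N, g (X n ω)) ∂P := by
    intro N
    let H : (ℕ → Plane) × (ℕ → ℝ) → ℝ := fun a =>
      Real.exp (-∑ n ∈ Finset.range N, f (a.1 n) * w (a.2 n))
    have hH : Measurable H := by
      refine (Finset.measurable_sum _ fun n _ => ?_).neg.exp
      exact (hf.comp ((measurable_pi_apply n).comp measurable_fst)).mul
        (hw.comp ((measurable_pi_apply n).comp measurable_snd))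
    have hC : ∀ a, ‖H a‖ ≤ 1 := fun a => by
      rw [Real.norm_of_nonneg (Real.exp_pos _).le, Real.exp_le_one_iff]
      exact neg_nonpos.2 (Finset.sum_nonneg fun n _ => mul_nonneg (hf0 _) (hw0 _))
    rw [integral_prodMk_of_indepFun hXm hζm hX.indep hH hC]
    refine integral_congr_ae (Filter.Eventually.of_forall fun ω => ?_)
    simp only [H]
    rw [← Finset.sum_neg_distrib, Real.exp_sum]
    simp_rw [hexpg, ← Finset.sum_neg_distrib, Real.exp_sum]
    have hmn : ∀ n, Measurable fun z => Real.exp (-(f (X n ω) * w z)) := fun n =>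
      (hw.const_mul _).neg.exp
    have hind := (hX.iIndep_mark.precomp (g := fun i : Finset.range N => (i : ℕ))
      Subtype.val_injective).comp (fun i z => Real.exp (-(f (X i ω) * w z))) (fun i => hmn i)
    have hprod := hind.integral_fun_prod_eq_prod_integral fun i =>
      ((hmn i).comp (hX.measurable_mark i)).aestronglyMeasurable
    simp only [Function.comp_apply] at hprod
    have hleft : ∀ ω', ∏ i : Finset.range N, Real.exp (-(f (X i ω) * w (ζ i ω'))) =
        ∏ n ∈ Finset.range N, Real.exp (-(f (X n ω) * w (ζ n ω'))) := fun ω' =>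
      Finset.prod_coe_sort (Finset.range N) fun n => Real.exp (-(f (X n ω) * w (ζ n ω')))
    simp_rw [hleft] at hprod
    rw [hprod, ← Finset.prod_coe_sort (Finset.range N)]
    refine Finset.prod_congr rfl fun i _ => ?_
    have := integral_map (μ := P) (hX.measurable_mark i).aemeasurable
      (hmn i).aestronglyMeasurable
    rw [← this, hX.map_mark]
  have hL : Filter.Tendsto (fun N : ℕ =>
      ∫ ω, Real.exp (-∑ n ∈ Finset.range N, f (X n ω) * w (ζ n ω)) ∂P) Filter.atTop
      (nhds (∫ ω, Real.exp (-∑' n, f (X n ω) * w (ζ n ω)) ∂P)) := by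
    refine tendsto_integral_of_dominated_convergence (fun _ => 1) (fun N => ?_)
      (integrable_const 1) (fun N => Filter.Eventually.of_forall fun ω => ?_) ?_
    · refine Measurable.aestronglyMeasurable (Finset.measurable_sum _ fun n _ => ?_).neg.exp
      exact (hf.comp (hX.poisson.measurable n)).mul (hw.comp (hX.measurable_mark n))
    · rw [Real.norm_of_nonneg (Real.exp_pos _).le, Real.exp_le_one_iff]
      exact neg_nonpos.2 (Finset.sum_nonneg fun n _ => mul_nonneg (hf0 _) (hw0 _))
    · filter_upwards [hX.ae_summable hw hw0 hwi hf hf0 hfi] with ω hω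
      exact (Real.continuous_exp.tendsto _).comp hω.hasSum.tendsto_sum_nat.neg
  have hR : Filter.Tendsto (fun N : ℕ =>
      ∫ ω, Real.exp (-∑ n ∈ Finset.range N, g (X n ω)) ∂P) Filter.atTop
      (nhds (∫ ω, Real.exp (-∑' n, g (X n ω)) ∂P)) := by
    refine tendsto_integral_of_dominated_convergence (fun _ => 1) (fun N => ?_)
      (integrable_const 1) (fun N => Filter.Eventually.of_forall fun ω => ?_) ?_
    · refine Measurable.aestronglyMeasurable (Finset.measurable_sum _ fun n _ => ?_).neg.exp
      exact hg.comp (hX.poisson.measurable n)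
    · rw [Real.norm_of_nonneg (Real.exp_pos _).le, Real.exp_le_one_iff]
      exact neg_nonpos.2 (Finset.sum_nonneg fun n _ => hg0 _)
    · filter_upwards [hX.poisson.ae_summable hg hg0 hgi] with ω hω
      exact (Real.continuous_exp.tendsto _).comp hω.hasSum.tendsto_sum_nat.neg
  rw [tendsto_nhds_unique (hL.congr hpart) hR, hX.poisson.integral_exp_neg_tsum hg hg0 hgi]
  congr 2
  have hbi : Integrable (fun a : Plane × ℝ => f a.1 * w a.2) (Λ.prod ρ) := hfi.mul_prod hwi
  have h1 := integrable_one_sub_exp_neg (ν := Λ.prod ρ) (b := fun a => f a.1 * w a.2)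
    (fun a => mul_nonneg (hf0 _) (hw0 _)) hbi (t := 1) zero_le_one
  simp only [one_mul] at h1
  rw [integral_prod _ h1]
  refine integral_congr_ae (Filter.Eventually.of_forall fun x => ?_)
  simp only
  rw [hexpg, integral_sub (integrable_const _) (integrable_exp_neg_mark hw hw0 (hf0 x))]
  simp [V]

/-- The first four moments of a sum over a marked Poisson process, in terms of its cumulants. -/
theorem moments [IsProbabilityMeasure ρ] [IsProbabilityMeasure P] [SigmaFinite Λ]
    (hX : IsMarkedPoissonProcess P X Λ ζ ρ) (hw : Measurable w) (hw0 : ∀ z, 0 ≤ w z)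
    (hwi : ∀ r : ℕ, 1 ≤ r → r ≤ 4 → Integrable (fun z => w z ^ r) ρ)
    (hf : Measurable f) (hf0 : ∀ x, 0 ≤ f x)
    (hfi : ∀ r : ℕ, 1 ≤ r → r ≤ 4 → Integrable (fun x => f x ^ r) Λ)
    {c : ℕ → ℝ} (hc : ∀ r, c r = (∫ x, f x ^ r ∂Λ) * ∫ z, w z ^ r ∂ρ) {S : Ω → ℝ}
    (hS : S = fun ω => ∑' n, f (X n ω) * w (ζ n ω)) :
    (Integrable S P ∧ ∫ ω, S ω ∂P = c 1) ∧
    (Integrable (fun ω => S ω ^ 2) P ∧ ∫ ω, S ω ^ 2 ∂P = c 2 + c 1 ^ 2) ∧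
    (Integrable (fun ω => S ω ^ 3) P ∧ ∫ ω, S ω ^ 3 ∂P = c 3 + 3 * c 1 * c 2 + c 1 ^ 3) ∧
    (Integrable (fun ω => S ω ^ 4) P ∧ ∫ ω, S ω ^ 4 ∂P =
      c 4 + 4 * c 1 * c 3 + 3 * c 2 ^ 2 + 6 * c 1 ^ 2 * c 2 + c 1 ^ 4) := by
  have hw1 : Integrable w ρ := by simpa using hwi 1 le_rfl (by norm_num)
  have hf1 : Integrable f Λ := by simpa using hfi 1 le_rfl (by norm_num)
  have hSi : Integrable S P := hS ▸ hX.integrable_tsum hw hw0 hw1 hf hf0 hf1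
  have h := moments_of_laplace (P := P) (ν := Λ.prod ρ) (b := fun a => f a.1 * w a.2) (S := S)
    (fun ω => hS ▸ tsum_nonneg fun n => mul_nonneg (hf0 _) (hw0 _)) hSi
    (fun a => mul_nonneg (hf0 _) (hw0 _))
    (fun r hr hr' => by
      simp_rw [mul_pow]
      exact (hfi r hr hr').mul_prod (hwi r hr hr'))
    (fun t ht => by
      have := hX.integral_exp_neg_tsum hw hw0 hw1 (hf.const_mul t)
        (fun x => mul_nonneg ht.le (hf0 x)) (hf1.const_mul t)
      simp_rw [mul_assoc, tsum_mul_left] at this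
      rw [hS]
      exact this)
    (c := c) (fun r => by
      rw [hc]
      simp_rw [mul_pow]
      exact (integral_prod_mul (fun x => f x ^ r) (fun z => w z ^ r)).symm)
  exact ⟨⟨hSi, h.1⟩, h.2⟩

end IsMarkedPoissonProcess

end MarkedPoisson

/-! ### Moments of the log-normal shadowing -/

section Shadowing

lemma measurable_shadowing : Measurable fun u : ℝ => (10 : ℝ) ^ (u / 10) := by fun_prop

instance (σ : ℝ) : IsProbabilityMeasure (shadowingLaw σ) :=
  Measure.isProbabilityMeasure_map measurable_shadowing.aemeasurable

lemma ae_shadowing_pos (σ : ℝ) : ∀ᵐ z ∂(shadowingLaw σ), 0 < z := by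
  unfold shadowingLaw
  rw [ae_map_iff measurable_shadowing.aemeasurable measurableSet_Ioi]
  exact Filter.Eventually.of_forall fun u => Real.rpow_pos_of_pos (by norm_num) _

/-- Absolute values make the marks nonnegative everywhere, as the shot noise lemmas require, and
change nothing almost surely. Since `10^{u/10} = e^{u/ξ}`, the moments are values of the Gaussian
moment generating function at `r / ξ`. -/
lemma abs_shadowing_pow (u : ℝ) (r : ℕ) :
    |(10 : ℝ) ^ (u / 10)| ^ r = Real.exp (r / (10 / Real.log 10) * u) := by
  have h10 : Real.log 10 ≠ 0 := (Real.log_pos (by norm_num)).ne'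
  rw [abs_of_pos (Real.rpow_pos_of_pos (by norm_num) _), Real.rpow_def_of_pos (by norm_num),
    ← Real.exp_nat_mul]
  congr 1
  field_simp

lemma integrable_abs_pow_shadowingLaw (σ : ℝ) (r : ℕ) :
    Integrable (fun z => |z| ^ r) (shadowingLaw σ) := by
  unfold shadowingLaw
  rw [integrable_map_measure (by fun_prop) measurable_shadowing.aemeasurable]
  simp only [Function.comp_def, abs_shadowing_pow]
  exact integrable_exp_mul_gaussianReal _

/-- The base on the right is `√μ`; with it the exponent `r²` is an integer. -/
lemma integral_abs_pow_shadowingLaw (σ : ℝ) (r : ℕ) :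
    ∫ z, |z| ^ r ∂(shadowingLaw σ) =
      Real.exp (σ ^ 2 / (10 / Real.log 10) ^ 2 / 2) ^ (r ^ 2) := by
  unfold shadowingLaw
  rw [integral_map measurable_shadowing.aemeasurable (by fun_prop)]
  simp only [abs_shadowing_pow]
  have h := congrFun (mgf_fun_id_gaussianReal (μ := 0) (v := (σ ^ 2).toNNReal))
    (r / (10 / Real.log 10))
  unfold mgf at h
  rw [h, ← Real.exp_nat_mul, Real.coe_toNNReal _ (sq_nonneg σ)]
  congr 1
  push_cast
  ring

end Shadowing

/-! ### Moments of the path loss outside and inside the typical cell -/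

section PathLoss

lemma measurable_pathLoss (A₀ d₀ γ : ℝ) : Measurable (pathLoss A₀ d₀ γ) := by
  unfold pathLoss
  refine Measurable.ite (measurableSet_lt measurable_norm measurable_const) measurable_const ?_
  fun_prop

variable {A₀ d₀ γ R : ℝ}

lemma pathLoss_pos (hA : 0 < A₀) (hd : 0 < d₀) (x : Plane) : 0 < pathLoss A₀ d₀ γ x := by
  unfold pathLoss
  split_ifs with h
  · exact hA
  · have : 0 < ‖x‖ := hd.trans_le (not_lt.1 h)
    positivity

/-- A power of a path loss is a path loss with other parameters, so first moments give all moments.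
-/
lemma pathLoss_pow (hd : 0 < d₀) (x : Plane) (s : ℕ) :
    pathLoss A₀ d₀ γ x ^ s = pathLoss (A₀ ^ s) d₀ (s * γ) x := by
  unfold pathLoss
  split_ifs with h
  · rfl
  · rw [mul_pow, ← Real.rpow_mul_natCast (by positivity)]
    congr 2
    ring

/-- Integration of a radial function over the plane. -/
lemma integral_radial (f : ℝ → ℝ) :
    ∫ x : Plane, f ‖x‖ = 2 * Real.pi * ∫ y in Set.Ioi (0 : ℝ), y * f y := by
  rw [integral_fun_norm_addHaar]
  simp [Measure.real, Real.pi_pos.le]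
  ring

lemma integrable_radial_iff (f : ℝ → ℝ) :
    Integrable (fun x : Plane => f ‖x‖) ↔ IntegrableOn (fun y => y * f y) (Set.Ioi 0) := by
  rw [integrable_fun_norm_addHaar]
  simp

lemma mul_div_rpow_neg (hd : 0 < d₀) {y : ℝ} (hy : 0 < y) :
    y * (A₀ * (y / d₀) ^ (-γ)) = A₀ * d₀ ^ γ * y ^ (1 - γ) := by
  rw [Real.div_rpow hy.le hd.le, Real.rpow_neg hd.le, Real.rpow_sub hy, Real.rpow_one,
    Real.rpow_neg hy.le]
  field_simp

lemma pathLoss_outside (hdR : d₀ ≤ R) :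
    (Metric.closedBall (0 : Plane) R)ᶜ.indicator (pathLoss A₀ d₀ γ) =
      fun x => (Set.Ioi R).indicator (fun y => A₀ * (y / d₀) ^ (-γ)) ‖x‖ := by
  funext x
  by_cases hx : R < ‖x‖
  · rw [Set.indicator_of_mem (by simpa using hx), Set.indicator_of_mem (by simpa using hx),
      pathLoss,
      if_neg (not_lt.2 (hdR.trans hx.le))]
  · rw [Set.indicator_of_notMem (by simpa using hx), Set.indicator_of_notMem (by simpa using hx)]

lemma mul_indicator_outside (hd : 0 < d₀) (hR : 0 < R) :
    (fun y : ℝ => y * (Set.Ioi R).indicator (fun y => A₀ * (y / d₀) ^ (-γ)) y) =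
      (Set.Ioi R).indicator fun y => A₀ * d₀ ^ γ * y ^ (1 - γ) := by
  funext y
  by_cases hy : y ∈ Set.Ioi R
  · rw [Set.indicator_of_mem hy, Set.indicator_of_mem hy, mul_div_rpow_neg hd (hR.trans hy)]
  · rw [Set.indicator_of_notMem hy, Set.indicator_of_notMem hy, mul_zero]

lemma integrable_pathLoss_outside (hd : 0 < d₀) (hdR : d₀ ≤ R) (hγ : 2 < γ) :
    Integrable (pathLoss A₀ d₀ γ) (volume.restrict (Metric.closedBall 0 R)ᶜ) := by
  have hR := hd.trans_le hdR
  rw [← IntegrableOn, ← integrable_indicator_iff measurableSet_closedBall.compl,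
    pathLoss_outside hdR, integrable_radial_iff, mul_indicator_outside hd hR]
  refine Integrable.integrableOn ?_
  rw [integrable_indicator_iff measurableSet_Ioi]
  exact (integrableOn_Ioi_rpow_of_lt (by linarith) hR).const_mul _

lemma integral_pathLoss_outside (hd : 0 < d₀) (hdR : d₀ ≤ R) (hγ : 2 < γ) {lam : ℝ}
    (hlam : lam * Real.pi * R ^ 2 = 1) :
    ∫ x, pathLoss A₀ d₀ γ x ∂(ENNReal.ofReal lam • volume.restrict (Metric.closedBall 0 R)ᶜ) =
      A₀ * (d₀ / R) ^ γ * (2 / (γ - 2)) := by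
  have hR := hd.trans_le hdR
  have hlam0 : 0 ≤ lam := by
    by_contra h
    have h1 : lam * (Real.pi * R ^ 2) < 0 :=
      mul_neg_of_neg_of_pos (not_le.1 h) (by positivity)
    linarith
  rw [integral_smul_measure, ENNReal.toReal_ofReal hlam0,
    ← integral_indicator measurableSet_closedBall.compl, pathLoss_outside hdR, integral_radial,
    mul_indicator_outside hd hR, setIntegral_indicator measurableSet_Ioi,
    Set.inter_eq_right.2 (Set.Ioi_subset_Ioi hR.le), integral_const_mul,
    integral_Ioi_rpow_of_lt (by linarith) hR, smul_eq_mul, Real.div_rpow hd.le hR.le,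
    show (1 : ℝ) - γ + 1 = 2 - γ by ring, Real.rpow_sub hR, Real.rpow_two]
  have h1 : γ - 2 ≠ 0 := by linarith
  have h2 : 2 - γ ≠ 0 := by linarith
  have h3 : R ^ γ ≠ 0 := (Real.rpow_pos_of_pos hR _).ne'
  calc lam * (2 * Real.pi * (A₀ * d₀ ^ γ * (-(R ^ 2 / R ^ γ) / (2 - γ))))
      = (lam * Real.pi * R ^ 2) * (2 * A₀ * d₀ ^ γ / R ^ γ * (-1 / (2 - γ))) := by ring
    _ = _ := by
      rw [hlam, show (-1 : ℝ) / (2 - γ) = 1 / (γ - 2) by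
        rw [div_eq_div_iff h2 h1]; ring]
      ring

/-- The path loss as a function of the distance. -/
def radialPathLoss (A₀ d₀ γ y : ℝ) : ℝ := if y < d₀ then A₀ else A₀ * (y / d₀) ^ (-γ)

lemma pathLoss_inside :
    (Metric.closedBall (0 : Plane) R).indicator (pathLoss A₀ d₀ γ) =
      fun x => (Set.Iic R).indicator (radialPathLoss A₀ d₀ γ) ‖x‖ := by
  funext x
  by_cases hx : ‖x‖ ≤ R
  · rw [Set.indicator_of_mem (by simpa using hx), Set.indicator_of_mem (by simpa using hx)]; rfl
  · rw [Set.indicator_of_notMem (by simpa using hx), Set.indicator_of_notMem (by simpa using hx)]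

lemma pathLoss_le (hA : 0 < A₀) (hd : 0 < d₀) (hγ : 2 < γ) (x : Plane) :
    pathLoss A₀ d₀ γ x ≤ A₀ := by
  unfold pathLoss
  split_ifs with h
  · exact le_rfl
  · exact mul_le_of_le_one_right hA.le
      (Real.rpow_le_one_of_one_le_of_nonpos ((one_le_div hd).2 (not_lt.1 h)) (by linarith))

/-- In polar coordinates the radial integral splits at `d₀` into a constant part and a power-law
part; combining the two `d₀²` contributions produces the numerator `γ l^{2-γ} - 2`. -/
lemma integral_pathLoss_inside (hd : 0 < d₀) (hdR : d₀ ≤ R) (hγ : 2 < γ) :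
    ∫ x in Metric.closedBall 0 R, pathLoss A₀ d₀ γ x =
      Real.pi * R ^ 2 * (A₀ * (d₀ / R) ^ γ * ((γ * (d₀ / R) ^ (2 - γ) - 2) / (γ - 2))) := by
  have hR := hd.trans_le hdR
  have h1 : γ - 2 ≠ 0 := by linarith
  have h2 : 2 - γ ≠ 0 := by linarith
  have hmul : (fun y : ℝ => y * (Set.Iic R).indicator (radialPathLoss A₀ d₀ γ) y) =
      (Set.Iic R).indicator fun y => y * radialPathLoss A₀ d₀ γ y := by
    funext y
    by_cases hy : y ∈ Set.Iic R
    · rw [Set.indicator_of_mem hy, Set.indicator_of_mem hy]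
    · rw [Set.indicator_of_notMem hy, Set.indicator_of_notMem hy, mul_zero]
  have e1 : ∀ y ∈ Set.uIcc 0 d₀, y * radialPathLoss A₀ d₀ γ y = A₀ * y := by
    intro y hy
    rw [Set.uIcc_of_le hd.le] at hy
    unfold radialPathLoss
    rcases hy.2.lt_or_eq with h | h
    · rw [if_pos h]; ring
    -- At `y = d₀` the power-law branch applies, with the same value `A₀`.
    · rw [h, if_neg (lt_irrefl _), div_self hd.ne', Real.one_rpow]; ring
  have e2 : ∀ y ∈ Set.uIcc d₀ R, y * radialPathLoss A₀ d₀ γ y = A₀ * d₀ ^ γ * y ^ (1 - γ) := by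
    intro y hy
    rw [Set.uIcc_of_le hdR] at hy
    unfold radialPathLoss
    rw [if_neg (not_lt.2 hy.1), mul_div_rpow_neg hd (hd.trans_le hy.1)]
  have hnot : (0 : ℝ) ∉ Set.uIcc d₀ R := by
    rw [Set.uIcc_of_le hdR]; exact fun h => absurd h.1 (not_le.2 hd)
  have i1 : IntervalIntegrable (fun y => y * radialPathLoss A₀ d₀ γ y) volume 0 d₀ :=
    (intervalIntegrable_congr fun y hy => e1 y (Set.uIoc_subset_uIcc hy)).2
      ((continuous_const.mul continuous_id).intervalIntegrable 0 d₀)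
  have i2 : IntervalIntegrable (fun y => y * radialPathLoss A₀ d₀ γ y) volume d₀ R :=
    (intervalIntegrable_congr fun y hy => e2 y (Set.uIoc_subset_uIcc hy)).2
      ((intervalIntegral.intervalIntegrable_rpow (Or.inr hnot)).const_mul _)
  rw [← integral_indicator measurableSet_closedBall, pathLoss_inside, integral_radial, hmul,
    setIntegral_indicator measurableSet_Iic, Set.Ioi_inter_Iic,
    ← intervalIntegral.integral_of_le hR.le,
    ← intervalIntegral.integral_add_adjacent_intervals i1 i2,
    intervalIntegral.integral_congr e1, intervalIntegral.integral_congr e2,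
    intervalIntegral.integral_const_mul, intervalIntegral.integral_const_mul, integral_id,
    integral_rpow (Or.inr ⟨by linarith, hnot⟩), show (1 : ℝ) - γ + 1 = 2 - γ by ring,
    Real.div_rpow hd.le hR.le, Real.div_rpow hd.le hR.le, Real.rpow_sub hR, Real.rpow_sub hd,
    Real.rpow_two, Real.rpow_two]
  have h3 : R ^ γ ≠ 0 := (Real.rpow_pos_of_pos hR _).ne'
  have h4 : d₀ ^ γ ≠ 0 := (Real.rpow_pos_of_pos hd _).ne'
  rw [show (R ^ 2 / R ^ γ - d₀ ^ 2 / d₀ ^ γ) / (2 - γ) =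
    (d₀ ^ 2 / d₀ ^ γ - R ^ 2 / R ^ γ) / (γ - 2) by rw [div_eq_div_iff h2 h1]; ring]
  field_simp
  ring

end PathLoss

section Uniform

variable {Ω : Type*} [MeasurableSpace Ω] {P : Measure Ω} {Y : Ω → Plane} {A₀ d₀ γ R : ℝ}

lemma integral_pathLoss_uniform (hY : Measurable Y)
    (hU : pdf.IsUniform Y (Metric.closedBall 0 R) P volume) (hd : 0 < d₀) (hdR : d₀ ≤ R)
    (hγ : 2 < γ) :
    ∫ ω, pathLoss A₀ d₀ γ (Y ω) ∂P =
      A₀ * (d₀ / R) ^ γ * ((γ * (d₀ / R) ^ (2 - γ) - 2) / (γ - 2)) := by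
  have hR := hd.trans_le hdR
  have h1 := integral_map (μ := P) hY.aemeasurable
    (measurable_pathLoss A₀ d₀ γ).aestronglyMeasurable
  rw [← h1, hU, ProbabilityTheory.cond, integral_smul_measure, integral_pathLoss_inside hd hdR hγ,
    EuclideanSpace.volume_closedBall_fin_two, smul_eq_mul, ← mul_assoc]
  rw [ENNReal.toReal_inv, ENNReal.toReal_mul, ENNReal.toReal_pow, ENNReal.toReal_ofReal hR.le,
    ENNReal.toReal_ofReal Real.pi_pos.le, mul_comm (R ^ 2), inv_mul_cancel₀ (by positivity),
    one_mul]

end Uniform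

/-! ### Regrouping independent variables -/

section Independence

variable {Ω : Type*} [MeasurableSpace Ω] {P : Measure Ω}

/-- The whole space, as a sequence of measurable rectangles of finite measure. -/
def finiteSpanningSetsInRectangles {α β : Type*} [MeasurableSpace α] [MeasurableSpace β]
    (μ : Measure (α × β)) [IsFiniteMeasure μ] : μ.FiniteSpanningSetsIn
      (Set.image2 (· ×ˢ ·) {s : Set α | MeasurableSet s} {t : Set β | MeasurableSet t}) where
  set _ := Set.univ
  set_mem _ := ⟨Set.univ, MeasurableSet.univ, Set.univ, MeasurableSet.univ, Set.univ_prod_univ⟩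
  finite _ := measure_lt_top _ _
  spanning := Set.iUnion_const _

/-- Two independent pairs of independent variables can be regrouped into two independent pairs. -/
lemma indepFun_prodMk_prodMk [IsProbabilityMeasure P] {α β γ δ : Type*}
    [MeasurableSpace α] [MeasurableSpace β]
    [MeasurableSpace γ] [MeasurableSpace δ] {X : Ω → α} {X' : Ω → β} {Y : Ω → γ} {Y' : Ω → δ}
    (hX : Measurable X) (hX' : Measurable X') (hY : Measurable Y) (hY' : Measurable Y')
    (hXX : IndepFun X X' P) (hYY : IndepFun Y Y' P)
    (h : IndepFun (fun ω => (X ω, X' ω)) (fun ω => (Y ω, Y' ω)) P) :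
    IndepFun (fun ω => (X ω, Y ω)) (fun ω => (X' ω, Y' ω)) P := by
  have h1 : IndepFun X Y P := h.comp measurable_fst measurable_fst
  have h2 : IndepFun X' Y' P := h.comp measurable_snd measurable_snd
  rw [indepFun_iff_map_prod_eq_prod_map_map (hX.prodMk hY).aemeasurable
    (hX'.prodMk hY').aemeasurable]
  have := Measure.isProbabilityMeasure_map (μ := P) (hX.prodMk hY).aemeasurable
  have := Measure.isProbabilityMeasure_map (μ := P) (hX'.prodMk hY').aemeasurable
  refine (Measure.prod_eq_generateFrom generateFrom_prod generateFrom_prod isPiSystem_prod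
    isPiSystem_prod (finiteSpanningSetsInRectangles _)
    (finiteSpanningSetsInRectangles _) ?_).symm
  rintro _ ⟨A, hA, B, hB, rfl⟩ _ ⟨C, hC, D, hD, rfl⟩
  have hA : MeasurableSet A := hA
  have hB : MeasurableSet B := hB
  have hC : MeasurableSet C := hC
  have hD : MeasurableSet D := hD
  rw [Measure.map_apply ((hX.prodMk hY).prodMk (hX'.prodMk hY'))
      ((hA.prod hB).prod (hC.prod hD)), Measure.map_apply (hX.prodMk hY) (hA.prod hB),
    Measure.map_apply (hX'.prodMk hY') (hC.prod hD)]
  have e0 := h.measure_inter_preimage_eq_mul _ _ (hA.prod hC) (hB.prod hD)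
  have e1 := h1.measure_inter_preimage_eq_mul _ _ hA hB
  have e2 := h2.measure_inter_preimage_eq_mul _ _ hC hD
  have e3 := hXX.measure_inter_preimage_eq_mul _ _ hA hC
  have e4 := hYY.measure_inter_preimage_eq_mul _ _ hB hD
  have s0 : (fun ω => ((X ω, Y ω), (X' ω, Y' ω))) ⁻¹' ((A ×ˢ B) ×ˢ (C ×ˢ D)) =
      (fun ω => (X ω, X' ω)) ⁻¹' (A ×ˢ C) ∩ (fun ω => (Y ω, Y' ω)) ⁻¹' (B ×ˢ D) := by
    ext ω; simp only [Set.mem_preimage, Set.mem_prod, Set.mem_inter_iff]; tauto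
  rw [s0, e0]
  simp only [Set.mk_preimage_prod]
  rw [e1, e2, e3, e4]
  ring

/-- Independent families that are independent of each other form an independent family of pairs. -/
lemma iIndepFun_prodMk [IsProbabilityMeasure P] {ι α β : Type*} [Fintype ι]
    [MeasurableSpace α] [MeasurableSpace β]
    {X : ι → Ω → α} {Y : ι → Ω → β} (hX : ∀ i, Measurable (X i)) (hY : ∀ i, Measurable (Y i))
    (hXi : iIndepFun X P) (hYi : iIndepFun Y P)
    (h : IndepFun (fun ω i => X i ω) (fun ω i => Y i ω) P) :
    iIndepFun (fun i ω => (X i ω, Y i ω)) P := by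
  have hX' : ∀ i, AEMeasurable (X i) P := fun i => (hX i).aemeasurable
  have hY' : ∀ i, AEMeasurable (Y i) P := fun i => (hY i).aemeasurable
  have hXm : Measurable fun ω i => X i ω := measurable_pi_lambda _ hX
  have hYm : Measurable fun ω i => Y i ω := measurable_pi_lambda _ hY
  have hp : ∀ i, IsProbabilityMeasure (P.map (X i)) := fun i =>
    Measure.isProbabilityMeasure_map (hX' i)
  have hq : ∀ i, IsProbabilityMeasure (P.map (Y i)) := fun i =>
    Measure.isProbabilityMeasure_map (hY' i)
  have hm : ∀ i, P.map (fun ω => (X i ω, Y i ω)) = (P.map (X i)).prod (P.map (Y i)) := fun i =>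
    (indepFun_iff_map_prod_eq_prod_map_map (hX' i) (hY' i)).1
      (h.comp (measurable_pi_apply i) (measurable_pi_apply i))
  rw [iIndepFun_iff_map_fun_eq_pi_map fun i => ((hX i).prodMk (hY i)).aemeasurable]
  simp_rw [hm]
  refine (MeasurableEquiv.arrowProdEquivProdArrow α β ι).map_measurableEquiv_injective ?_
  rw [(measurePreserving_arrowProdEquivProdArrow α β ι _ _).map_eq,
    Measure.map_map (MeasurableEquiv.measurable _)
      (measurable_pi_lambda _ fun i => (hX i).prodMk (hY i)),
    ← hXi.map_fun_eq_pi_map hX', ← hYi.map_fun_eq_pi_map hY',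
    ← (indepFun_iff_map_prod_eq_prod_map_map hXm.aemeasurable hYm.aemeasurable).1 h]
  rfl

/-- The rows of an independent array are independent. -/
lemma iIndepFun_rows [IsProbabilityMeasure P] {ι κ α : Type*} [MeasurableSpace α]
    {Y : ι × κ → Ω → α}
    (hY : ∀ i, Measurable (Y i)) (h : iIndepFun Y P) :
    iIndepFun (fun i ω j => Y (i, j) ω) P := by
  have hp : ∀ i, IsProbabilityMeasure (P.map (Y i)) := fun i =>
    Measure.isProbabilityMeasure_map (hY i).aemeasurable
  rw [iIndepFun_iff_map_fun_eq_infinitePi_map fun i => measurable_pi_lambda _ fun j => hY (i, j)]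
  have h1 : ∀ i, P.map (fun ω j => Y (i, j) ω) = Measure.infinitePi fun j => P.map (Y (i, j)) :=
    fun i => (iIndepFun_iff_map_fun_eq_infinitePi_map fun j => hY (i, j)).1
      (h.precomp fun a b hab => (Prod.mk.inj hab).2)
  simp_rw [h1]
  have h2 := Measure.infinitePi_map_curry (fun i j => P.map (Y (i, j)))
  rw [← h2, ← (iIndepFun_iff_map_fun_eq_infinitePi_map hY).1 h,
    Measure.map_map (MeasurableEquiv.measurable _) (measurable_pi_lambda _ hY)]
  rfl

/-- One member of an independent family is independent of the others. -/
lemma indepFun_none_some {α : Type*} [MeasurableSpace α] {Y : Option ℕ → Ω → α}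
    (hY : ∀ j, Measurable (Y j)) (h : iIndepFun Y P) :
    IndepFun (Y none) (fun ω n => Y (some n) ω) P := by
  have h1 := indep_iSup_of_disjoint (fun j => (hY j).comap_le) h
    (S := {none}) (T := Set.range some) (by
      rw [Set.disjoint_singleton_left]; rintro ⟨n, hn⟩; simp at hn)
  refine indep_of_indep_of_le_left (indep_of_indep_of_le_right h1 ?_) ?_
  · rw [MeasurableSpace.pi, MeasurableSpace.comap_iSup]
    refine iSup_le fun n => ?_
    rw [MeasurableSpace.comap_comp]
    exact le_iSup₂_of_le (some n) ⟨n, rfl⟩ le_rfl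
  · exact le_iSup₂_of_le none rfl le_rfl

end Independence

/-! ### The variance of `(X + S)(S + T)` -/

section Moments

variable {Ω : Type*} [MeasurableSpace Ω] {P : Measure Ω}

lemma integrable_pow_of_memLp_two [IsProbabilityMeasure P] {T : Ω → ℝ} (hT : MemLp T 2 P)
    {c : ℕ} (hc : c ≤ 2) :
    Integrable (fun ω => T ω ^ c) P := by
  interval_cases c
  · simp
  · simpa using hT.integrable one_le_two
  · exact hT.integrable_sq

lemma integral_mul_mul_of_indepFun {X S T : Ω → ℝ} (hXS : IndepFun X S P)
    (hXST : IndepFun (fun ω => (X ω, S ω)) T P) {a b c : ℕ}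
    (ha : Integrable (fun ω => X ω ^ a) P) (hb : Integrable (fun ω => S ω ^ b) P)
    (hc : Integrable (fun ω => T ω ^ c) P) :
    Integrable (fun ω => X ω ^ a * S ω ^ b * T ω ^ c) P ∧
      ∫ ω, X ω ^ a * S ω ^ b * T ω ^ c ∂P =
        (∫ ω, X ω ^ a ∂P) * (∫ ω, S ω ^ b ∂P) * ∫ ω, T ω ^ c ∂P := by
  have h1 : IndepFun (fun ω => X ω ^ a) (fun ω => S ω ^ b) P :=
    hXS.comp (φ := fun x => x ^ a) (ψ := fun x => x ^ b) (by fun_prop) (by fun_prop)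
  have h2 : IndepFun (fun ω => X ω ^ a * S ω ^ b) (fun ω => T ω ^ c) P :=
    hXST.comp (φ := fun x : ℝ × ℝ => x.1 ^ a * x.2 ^ b) (ψ := fun x => x ^ c)
      (by fun_prop) (by fun_prop)
  have i1 : Integrable (fun ω => X ω ^ a * S ω ^ b) P := h1.integrable_mul ha hb
  refine ⟨h2.integrable_mul i1 hc, ?_⟩
  rw [h2.integral_fun_mul_eq_mul_integral i1.aestronglyMeasurable hc.aestronglyMeasurable,
    h1.integral_fun_mul_eq_mul_integral ha.aestronglyMeasurable hb.aestronglyMeasurable]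

/-- The variance of `(X + S) (S + T)` for independent `X`, `S` and `T`. -/
lemma variance_add_mul_add [IsProbabilityMeasure P] {X S T : Ω → ℝ}
    (hX : Measurable X) (hS : Measurable S)
    (hT : Measurable T) (hXS : IndepFun X S P) (hXST : IndepFun (fun ω => (X ω, S ω)) T P)
    (hX2 : MemLp X 2 P) (hT2 : MemLp T 2 P)
    (hSi : ∀ b : ℕ, b ≤ 4 → Integrable (fun ω => S ω ^ b) P)
    {x1 x2 s1 s2 s3 s4 t1 t2 : ℝ} (ex1 : ∫ ω, X ω ∂P = x1) (ex2 : ∫ ω, X ω ^ 2 ∂P = x2)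
    (es1 : ∫ ω, S ω ∂P = s1) (es2 : ∫ ω, S ω ^ 2 ∂P = s2) (es3 : ∫ ω, S ω ^ 3 ∂P = s3)
    (es4 : ∫ ω, S ω ^ 4 ∂P = s4) (et1 : ∫ ω, T ω ∂P = t1) (et2 : ∫ ω, T ω ^ 2 ∂P = t2) :
    MemLp (fun ω => (X ω + S ω) * (S ω + T ω)) 2 P ∧
    variance (fun ω => (X ω + S ω) * (S ω + T ω)) P =
      (x2 * s2 + 2 * x2 * s1 * t1 + x2 * t2 + 2 * x1 * s3 + 4 * x1 * s2 * t1 + 2 * x1 * s1 * t2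
        + s4 + 2 * s3 * t1 + s2 * t2) - (x1 * s1 + x1 * t1 + s2 + s1 * t1) ^ 2 := by
  have key : ∀ a b c : ℕ, a ≤ 2 → b ≤ 4 → c ≤ 2 →
      Integrable (fun ω => X ω ^ a * S ω ^ b * T ω ^ c) P ∧
      ∫ ω, X ω ^ a * S ω ^ b * T ω ^ c ∂P =
        (∫ ω, X ω ^ a ∂P) * (∫ ω, S ω ^ b ∂P) * ∫ ω, T ω ^ c ∂P := fun a b c ha hb hc =>
    integral_mul_mul_of_indepFun hXS hXST (integrable_pow_of_memLp_two hX2 ha) (hSi b hb)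
      (integrable_pow_of_memLp_two hT2 hc)
  -- The exponents `(a, b, c)` of the monomials in `(X + S)(S + T)` and in its square.
  have h110 := key 1 1 0 (by norm_num) (by norm_num) (by norm_num)
  have h101 := key 1 0 1 (by norm_num) (by norm_num) (by norm_num)
  have h020 := key 0 2 0 (by norm_num) (by norm_num) (by norm_num)
  have h011 := key 0 1 1 (by norm_num) (by norm_num) (by norm_num)
  have h220 := key 2 2 0 (by norm_num) (by norm_num) (by norm_num)
  have h211 := key 2 1 1 (by norm_num) (by norm_num) (by norm_num)
  have h202 := key 2 0 2 (by norm_num) (by norm_num) (by norm_num)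
  have h130 := key 1 3 0 (by norm_num) (by norm_num) (by norm_num)
  have h121 := key 1 2 1 (by norm_num) (by norm_num) (by norm_num)
  have h112 := key 1 1 2 (by norm_num) (by norm_num) (by norm_num)
  have h040 := key 0 4 0 (by norm_num) (by norm_num) (by norm_num)
  have h031 := key 0 3 1 (by norm_num) (by norm_num) (by norm_num)
  have h022 := key 0 2 2 (by norm_num) (by norm_num) (by norm_num)
  clear key
  simp only [pow_zero, pow_one, one_mul, mul_one, integral_const, probReal_univ, smul_eq_mul,
    ex1, ex2, es1, es2, et1, et2] at h110 h101 h020 h011 h220 h211 h202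
  simp only [pow_zero, pow_one, one_mul, mul_one, integral_const, probReal_univ, smul_eq_mul,
    ex1, es1, es2, es3, es4, et1, et2] at h130 h121 h112 h040 h031 h022
  have e1 : ∫ ω, (X ω + S ω) * (S ω + T ω) ∂P = x1 * s1 + x1 * t1 + s2 + s1 * t1 := by
    have hexp : ∀ ω, (X ω + S ω) * (S ω + T ω) =
        ((X ω * S ω + X ω * T ω) + S ω ^ 2) + S ω * T ω := fun ω => by ring
    simp_rw [hexp]
    have i1 := h110.1.fun_add h101.1
    have i2 := i1.fun_add h020.1
    rw [integral_add i2 h011.1, integral_add i1 h020.1, integral_add h110.1 h101.1, h110.2, h101.2,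
      es2, h011.2]
  have hexp2 : ∀ ω, ((X ω + S ω) * (S ω + T ω)) ^ 2 =
      X ω ^ 2 * S ω ^ 2 + 2 * (X ω ^ 2 * S ω * T ω) + X ω ^ 2 * T ω ^ 2 + 2 * (X ω * S ω ^ 3)
        + 4 * (X ω * S ω ^ 2 * T ω) + 2 * (X ω * S ω * T ω ^ 2) + S ω ^ 4
        + 2 * (S ω ^ 3 * T ω) + S ω ^ 2 * T ω ^ 2 := fun ω => by ring
  have i1 := h220.1.fun_add (h211.1.const_mul 2)
  have i2 := i1.fun_add h202.1
  have i3 := i2.fun_add (h130.1.const_mul 2)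
  have i4 := i3.fun_add (h121.1.const_mul 4)
  have i5 := i4.fun_add (h112.1.const_mul 2)
  have i6 := i5.fun_add h040.1
  have i7 := i6.fun_add (h031.1.const_mul 2)
  have i8 := i7.fun_add h022.1
  have hm : AEStronglyMeasurable (fun ω => (X ω + S ω) * (S ω + T ω)) P :=
    ((hX.add hS).mul (hS.add hT)).aestronglyMeasurable
  have hmem : MemLp (fun ω => (X ω + S ω) * (S ω + T ω)) 2 P := by
    rw [memLp_two_iff_integrable_sq hm]
    simp_rw [hexp2]
    exact i8
  refine ⟨hmem, ?_⟩
  rw [variance_eq_sub hmem]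
  simp only [Pi.pow_apply]
  rw [e1]
  simp_rw [hexp2]
  rw [integral_add i7 h022.1, integral_add i6 (h031.1.const_mul 2), integral_add i5 h040.1,
    integral_add i4 (h112.1.const_mul 2), integral_add i3 (h121.1.const_mul 4),
    integral_add i2 (h130.1.const_mul 2), integral_add i1 h202.1,
    integral_add h220.1 (h211.1.const_mul 2)]
  simp only [integral_const_mul]
  rw [h220.2, h211.2, h202.2, h130.2, h121.2, h112.2, es4, h031.2, h022.2]
  ring

end Moments

/-! ### Independence and moments in the cellular model -/

section Model

variable {Ω : Type*} [MeasurableSpace Ω] {P : Measure Ω} {K : ℕ} {R lam σ A₀ d₀ γ : ℝ}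
  {loc : Fin K → Option ℕ → Ω → Plane} {η : Fin K → Option ℕ → Ω → ℝ}

/-- The intensity measure of the users outside the typical cell. -/
abbrev userIntensity (lam R : ℝ) : Measure Plane :=
  ENNReal.ofReal lam • volume.restrict (Metric.closedBall 0 R)ᶜ

instance (lam R : ℝ) : SigmaFinite (userIntensity lam R) :=
  inferInstanceAs (SigmaFinite (lam.toNNReal • volume.restrict (Metric.closedBall 0 R)ᶜ))

namespace CellularModel

lemma measurable_loc (h : CellularModel P K R lam σ loc η) (k : Fin K) (j : Option ℕ) :
    Measurable (loc k j) := by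
  cases j with
  | none => exact h.measurable_cell k
  | some n => exact (h.poisson k).measurable n

lemma markedReuse (h : CellularModel P K R lam σ loc η) (k : Fin K) :
    IsMarkedPoissonProcess P (fun n => loc k (some n)) (userIntensity lam R)
      (fun n => η k (some n)) (shadowingLaw σ) where
  poisson := h.poisson k
  measurable_mark n := h.measurable_shadowing k (some n)
  map_mark n := (h.shadowing k (some n)).map_eq
  iIndep_mark := h.indep_shadowing.precomp (g := fun n : ℕ => (k, some n))
    fun a b hab => by simpa using hab
  indep := h.indep_loc_shadowing.comp
    (φ := fun (x : Fin K → Option ℕ → Plane) (n : ℕ) => x k (some n))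
    (ψ := fun (x : Fin K → Option ℕ → ℝ) (n : ℕ) => x k (some n)) (by fun_prop) (by fun_prop)

lemma ae_shadowing_pos (h : CellularModel P K R lam σ loc η) :
    ∀ᵐ ω ∂P, ∀ k j, 0 < η k j ω := by
  rw [ae_all_iff]
  intro k
  rw [ae_all_iff]
  intro j
  have := MassiveMIMO.ae_shadowing_pos σ
  rw [← (h.shadowing k j).map_eq] at this
  exact ae_of_ae_map (h.measurable_shadowing k j).aemeasurable this

variable [IsProbabilityMeasure P]

/-- The model separates locations from shadowing, and within each of these the typical user from the
others. Here the grouping is by users instead, as needed for the independence of `X` and `S`. -/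
lemma indepFun_cell (h : CellularModel P K R lam σ loc η) (k : Fin K) :
    IndepFun (fun ω => (loc k none ω, η k none ω))
      (fun ω => ((fun n => loc k (some n) ω : ℕ → Plane),
        (fun n => η k (some n) ω : ℕ → ℝ))) P := by
  refine indepFun_prodMk_prodMk (h.measurable_cell k)
    (measurable_pi_lambda _ fun n => h.measurable_loc k (some n))
    (h.measurable_shadowing k none)
    (measurable_pi_lambda _ fun n => h.measurable_shadowing k (some n)) (h.indep_cell k)
    (indepFun_none_some (h.measurable_shadowing k)
      (h.indep_shadowing.precomp (g := fun j => (k, j)) fun a b hab => by simpa using hab)) ?_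
  exact h.indep_loc_shadowing.comp
    (φ := fun (x : Fin K → Option ℕ → Plane) => (x k none, fun n : ℕ => x k (some n)))
    (ψ := fun (x : Fin K → Option ℕ → ℝ) => (x k none, fun n : ℕ => x k (some n)))
    (by fun_prop) (by fun_prop)

lemma iIndepFun_cells (h : CellularModel P K R lam σ loc η) :
    iIndepFun (fun (k : Fin K) ω => ((fun j => loc k j ω), (fun j => η k j ω))) P :=
  iIndepFun_prodMk (fun k => measurable_pi_lambda _ fun j => h.measurable_loc k j)
    (fun k => measurable_pi_lambda _ fun j => h.measurable_shadowing k j) h.indep_pilot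
    (iIndepFun_rows (fun i => h.measurable_shadowing i.1 i.2) h.indep_shadowing)
    h.indep_loc_shadowing

end CellularModel

/-- The large-scale fading coefficient of the user of the typical cell; the absolute value is
almost surely immaterial. -/
def cellPower (A₀ d₀ γ : ℝ) (loc : Fin K → Option ℕ → Ω → Plane) (η : Fin K → Option ℕ → Ω → ℝ)
    (k : Fin K) (ω : Ω) : ℝ :=
  pathLoss A₀ d₀ γ (loc k none ω) * |η k none ω|

/-- The sum of the large-scale fading coefficients of the users outside the typical cell that
use the pilot `k`; the absolute values are almost surely immaterial. -/
def reusePower (A₀ d₀ γ : ℝ) (loc : Fin K → Option ℕ → Ω → Plane) (η : Fin K → Option ℕ → Ω → ℝ)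
    (k : Fin K) (ω : Ω) : ℝ :=
  ∑' n, pathLoss A₀ d₀ γ (loc k (some n) ω) * |η k (some n) ω|

lemma integrable_pathLoss_pow (hd : 0 < d₀) (hdR : d₀ ≤ R) (hγ : 2 < γ) {r : ℕ} (hr : 1 ≤ r) :
    Integrable (fun x => pathLoss A₀ d₀ γ x ^ r) (userIntensity lam R) := by
  have hr' : (1 : ℝ) ≤ r := by exact_mod_cast hr
  simp_rw [pathLoss_pow hd]
  exact (integrable_pathLoss_outside hd hdR (by nlinarith)).smul_measure ENNReal.ofReal_ne_top

/-- The cumulant of order `r` of `reusePower`. -/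
def reuseCumulant (A₀ d₀ γ R σ : ℝ) (r : ℕ) : ℝ :=
  A₀ ^ r * (d₀ / R) ^ (r * γ) * (2 / (r * γ - 2)) *
    Real.exp (σ ^ 2 / (10 / Real.log 10) ^ 2 / 2) ^ (r ^ 2)

/-- The restriction to `r ≥ 1` is needed: at `r = 0` the left side is -1, while the integral of 1
against the infinite intensity measure is 0 by convention. -/
lemma reuseCumulant_eq (hlam : lam * Real.pi * R ^ 2 = 1) (hd : 0 < d₀) (hdR : d₀ ≤ R)
    (hγ : 2 < γ) {r : ℕ} (hr : 1 ≤ r) : reuseCumulant A₀ d₀ γ R σ r =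
      (∫ x, pathLoss A₀ d₀ γ x ^ r ∂(userIntensity lam R)) * ∫ z, |z| ^ r ∂(shadowingLaw σ) := by
  have hr' : (1 : ℝ) ≤ r := by exact_mod_cast hr
  rw [integral_abs_pow_shadowingLaw]
  simp_rw [pathLoss_pow hd]
  rw [integral_pathLoss_outside hd hdR (by nlinarith) hlam]
  rfl

namespace CellularModel

lemma measurable_reusePower (h : CellularModel P K R lam σ loc η) (k : Fin K) :
    Measurable (reusePower A₀ d₀ γ loc η k) :=
  (h.markedReuse k).measurable_tsum (w := fun z => |z|) (by fun_prop)
    (measurable_pathLoss A₀ d₀ γ)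

lemma measurable_cellPower (h : CellularModel P K R lam σ loc η) (k : Fin K) :
    Measurable (cellPower A₀ d₀ γ loc η k) := by
  refine ((measurable_pathLoss A₀ d₀ γ).comp (h.measurable_cell k)).mul ?_
  exact (by fun_prop : Measurable fun z : ℝ => |z|).comp (h.measurable_shadowing k none)

variable [IsProbabilityMeasure P]

lemma moments_reusePower (h : CellularModel P K R lam σ loc η) (hlam : lam * Real.pi * R ^ 2 = 1)
    (hA : 0 < A₀) (hd : 0 < d₀) (hdR : d₀ ≤ R) (hγ : 2 < γ) (k : Fin K)
    {S : Ω → ℝ} (hS : S = reusePower A₀ d₀ γ loc η k) {c : ℕ → ℝ}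
    (hc : c = reuseCumulant A₀ d₀ γ R σ) :
    (Integrable S P ∧ ∫ ω, S ω ∂P = c 1) ∧
    (Integrable (fun ω => S ω ^ 2) P ∧ ∫ ω, S ω ^ 2 ∂P = c 2 + c 1 ^ 2) ∧
    (Integrable (fun ω => S ω ^ 3) P ∧ ∫ ω, S ω ^ 3 ∂P = c 3 + 3 * c 1 * c 2 + c 1 ^ 3) ∧
    (Integrable (fun ω => S ω ^ 4) P ∧ ∫ ω, S ω ^ 4 ∂P =
      c 4 + 4 * c 1 * c 3 + 3 * c 2 ^ 2 + 6 * c 1 ^ 2 * c 2 + c 1 ^ 4) := by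
  -- `moments` asks for the cumulant formula at every `r`, including 0, so it is applied to the
  -- integrals themselves; its result is translated at `r = 1, …, 4`.
  have hval : ∀ r : ℕ, 1 ≤ r → c r =
      (∫ x, pathLoss A₀ d₀ γ x ^ r ∂(userIntensity lam R)) * ∫ z, |z| ^ r ∂(shadowingLaw σ) :=
    fun r hr => hc ▸ reuseCumulant_eq hlam hd hdR hγ hr
  have := (h.markedReuse k).moments (w := fun z => |z|) (by fun_prop) abs_nonneg
    (fun r _ _ => integrable_abs_pow_shadowingLaw σ r) (measurable_pathLoss A₀ d₀ γ)
    (fun x => (pathLoss_pos hA hd x).le) (fun r hr _ => integrable_pathLoss_pow hd hdR hγ hr)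
    (fun r => rfl) hS
  simpa only [← hval 1 le_rfl, ← hval 2 (by norm_num), ← hval 3 (by norm_num),
    ← hval 4 (by norm_num)] using this

lemma moments_cellPower (h : CellularModel P K R lam σ loc η)
    (hA : 0 < A₀) (hd : 0 < d₀) (hdR : d₀ ≤ R) (hγ : 2 < γ) (k : Fin K) {r : ℕ} (hr : 1 ≤ r) :
    Integrable (fun ω => cellPower A₀ d₀ γ loc η k ω ^ r) P ∧
      ∫ ω, cellPower A₀ d₀ γ loc η k ω ^ r ∂P = A₀ ^ r * (d₀ / R) ^ (r * γ) *
        ((r * γ * (d₀ / R) ^ (2 - r * γ) - 2) / (r * γ - 2)) *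
        Real.exp (σ ^ 2 / (10 / Real.log 10) ^ 2 / 2) ^ (r ^ 2) := by
  have hr' : (1 : ℝ) ≤ r := by exact_mod_cast hr
  have hp : Measurable fun ω => pathLoss A₀ d₀ γ (loc k none ω) ^ r :=
    ((measurable_pathLoss A₀ d₀ γ).comp (h.measurable_cell k)).pow_const r
  have hpi : Integrable (fun ω => pathLoss A₀ d₀ γ (loc k none ω) ^ r) P := by
    refine (integrable_const (A₀ ^ r)).mono' hp.aestronglyMeasurable
      (Filter.Eventually.of_forall fun ω => ?_)
    rw [Real.norm_of_nonneg (pow_nonneg (pathLoss_pos hA hd _).le _)]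
    exact pow_le_pow_left₀ (pathLoss_pos hA hd _).le (pathLoss_le hA hd hγ _) r
  have hη := (h.shadowing k none).map_eq
  have hηi : Integrable (fun ω => |η k none ω| ^ r) P := by
    have := integrable_abs_pow_shadowingLaw σ r
    rw [← hη] at this
    exact (integrable_map_measure (by fun_prop)
      (h.measurable_shadowing k none).aemeasurable).1 this
  have hind : IndepFun (fun ω => pathLoss A₀ d₀ γ (loc k none ω) ^ r)
      (fun ω => |η k none ω| ^ r) P :=
    h.indep_loc_shadowing.comp
      (φ := fun (x : Fin K → Option ℕ → Plane) => pathLoss A₀ d₀ γ (x k none) ^ r)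
      (ψ := fun (x : Fin K → Option ℕ → ℝ) => |x k none| ^ r)
      (((measurable_pathLoss A₀ d₀ γ).comp (by fun_prop)).pow_const r) (by fun_prop)
  unfold cellPower
  simp_rw [mul_pow]
  refine ⟨hind.integrable_mul hpi hηi, ?_⟩
  rw [hind.integral_fun_mul_eq_mul_integral hpi.aestronglyMeasurable hηi.aestronglyMeasurable]
  have e1 : ∫ ω, |η k none ω| ^ r ∂P =
      Real.exp (σ ^ 2 / (10 / Real.log 10) ^ 2 / 2) ^ (r ^ 2) := by
    have := integral_map (μ := P) (h.measurable_shadowing k none).aemeasurable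
      (f := fun z => |z| ^ r) (by fun_prop)
    rw [← this, hη, integral_abs_pow_shadowingLaw]
  rw [e1]
  simp_rw [pathLoss_pow hd]
  rw [integral_pathLoss_uniform (h.measurable_cell k) (h.uniform k) hd hdR (by nlinarith)]

lemma measurable_pathLoss_eval (j : Option ℕ) :
    Measurable fun x : (Option ℕ → Plane) × (Option ℕ → ℝ) =>
      pathLoss A₀ d₀ γ (x.1 j) * |x.2 j| :=
  ((measurable_pathLoss A₀ d₀ γ).comp ((measurable_pi_apply j).comp measurable_fst)).mul
    (by fun_prop)

lemma indepFun_cellPower_reusePower (h : CellularModel P K R lam σ loc η) (k : Fin K) :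
    IndepFun (cellPower A₀ d₀ γ loc η k) (reusePower A₀ d₀ γ loc η k) P :=
  (h.indepFun_cell k).comp
    (φ := fun x : Plane × ℝ => pathLoss A₀ d₀ γ x.1 * |x.2|)
    (ψ := fun x : (ℕ → Plane) × (ℕ → ℝ) => ∑' n, pathLoss A₀ d₀ γ (x.1 n) * |x.2 n|)
    (((measurable_pathLoss A₀ d₀ γ).comp measurable_fst).mul (by fun_prop))
    (Measurable.tsum fun n => ((measurable_pathLoss A₀ d₀ γ).comp
      ((measurable_pi_apply n).comp measurable_fst)).mul (by fun_prop))

lemma iIndepFun_cellPower_reusePower (h : CellularModel P K R lam σ loc η) :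
    iIndepFun (fun k ω => (cellPower A₀ d₀ γ loc η k ω, reusePower A₀ d₀ γ loc η k ω)) P :=
  h.iIndepFun_cells.comp
    (fun _ (x : (Option ℕ → Plane) × (Option ℕ → ℝ)) =>
      (pathLoss A₀ d₀ γ (x.1 none) * |x.2 none|,
        ∑' n : ℕ, pathLoss A₀ d₀ γ (x.1 (some n)) * |x.2 (some n)|))
    (fun _ => (measurable_pathLoss_eval none).prodMk
      (Measurable.tsum fun n => measurable_pathLoss_eval (some n)))

lemma iIndepFun_reusePower (h : CellularModel P K R lam σ loc η) :
    iIndepFun (fun k => reusePower A₀ d₀ γ loc η k) P :=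
  h.iIndepFun_cellPower_reusePower.comp (fun _ x => x.2) (fun _ => measurable_snd)

lemma indepFun_others (h : CellularModel P K R lam σ loc η) (k : Fin K) :
    IndepFun (fun ω => (cellPower A₀ d₀ γ loc η k ω, reusePower A₀ d₀ γ loc η k ω))
      (fun ω => ∑ k' ∈ Finset.univ.erase k, reusePower A₀ d₀ γ loc η k' ω) P := by
  have h1 := (h.iIndepFun_cellPower_reusePower (A₀ := A₀) (d₀ := d₀) (γ := γ)).indepFun_finset
    {k} (Finset.univ.erase k) (by simp)
    fun k' => (h.measurable_cellPower k').prodMk (h.measurable_reusePower k')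
  have hφ : Measurable fun x : ↥({k} : Finset (Fin K)) → ℝ × ℝ =>
      x ⟨k, Finset.mem_singleton_self k⟩ := measurable_pi_apply _
  have hψ : Measurable fun x : ↥(Finset.univ.erase k) → ℝ × ℝ => ∑ k', (x k').2 :=
    Finset.measurable_sum _ fun k' _ => measurable_snd.comp (measurable_pi_apply k')
  have h2 := h1.comp hφ hψ
  refine h2.congr (Filter.EventuallyEq.refl _ _) (Filter.Eventually.of_forall fun ω => ?_)
  exact Finset.sum_coe_sort (Finset.univ.erase k) fun k' => reusePower A₀ d₀ γ loc η k' ω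

end CellularModel

end Model

/-! ### The variances of the two interferences -/

namespace CellularModel

variable {Ω : Type*} [MeasurableSpace Ω] {P : Measure Ω} {K : ℕ}
  {R lam σ A₀ d₀ γ : ℝ} {loc : Fin K → Option ℕ → Ω → Plane} {η : Fin K → Option ℕ → Ω → ℝ}

lemma ae_summable_largeScale (h : CellularModel P K R lam σ loc η) (hA : 0 < A₀) (hd : 0 < d₀)
    (hdR : d₀ ≤ R) (hγ : 2 < γ) :
    ∀ᵐ ω ∂P, ∀ k, Summable fun n => largeScale A₀ d₀ γ loc η ω k (some n) := by
  rw [ae_all_iff]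
  intro k
  have hf : Integrable (pathLoss A₀ d₀ γ) (userIntensity lam R) := by
    simpa using integrable_pathLoss_pow (A₀ := A₀) (lam := lam) hd hdR hγ le_rfl
  have hw : Integrable (fun z => |z|) (shadowingLaw σ) := by
    simpa using integrable_abs_pow_shadowingLaw σ 1
  filter_upwards [h.ae_shadowing_pos, (h.markedReuse k).ae_summable (w := fun z => |z|)
    (by fun_prop) abs_nonneg hw (measurable_pathLoss A₀ d₀ γ) (fun x => (pathLoss_pos hA hd x).le)
    hf] with ω hω hs
  exact hs.congr fun n => by rw [largeScale, abs_of_pos (hω k (some n))]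

/-- The first factor is `α_k = X + S`, the second the total power `S + T` from outside the cell.
Singling out `S`, which occurs in both, leaves three independent variables. -/
lemma interInterference_ae_eq (h : CellularModel P K R lam σ loc η) {M : ℕ} (hM : 1 ≤ M)
    (hA : 0 < A₀) (hd : 0 < d₀) (hdR : d₀ ≤ R) (hγ : 2 < γ) (k : Fin K) :
    (fun ω => interInterference M (largeScale A₀ d₀ γ loc η ω) k) =ᵐ[P] fun ω => (M : ℝ)⁻¹ *
      ((cellPower A₀ d₀ γ loc η k ω + reusePower A₀ d₀ γ loc η k ω) *
        (reusePower A₀ d₀ γ loc η k ω +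
          ∑ k' ∈ Finset.univ.erase k, reusePower A₀ d₀ γ loc η k' ω)) := by
  filter_upwards [h.ae_shadowing_pos, h.ae_summable_largeScale hA hd hdR hγ] with ω hω hs
  have hpos : ∀ k j, 0 < largeScale A₀ d₀ γ loc η ω k j := fun k j =>
    mul_pos (pathLoss_pos hA hd _) (hω k j)
  rw [interInterference_eq hM (fun k j => (hpos k j).le) (hpos k none) hs,
    Finset.add_sum_erase _ (fun k' => reusePower A₀ d₀ γ loc η k' ω) (Finset.mem_univ k)]
  simp only [alpha, largeScale, cellPower, reusePower, fun k j => abs_of_pos (hω k j)]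
  ring

lemma contInterference_ae_eq (h : CellularModel P K R lam σ loc η) {M : ℕ} (hM : 1 ≤ M)
    (hA : 0 < A₀) (hd : 0 < d₀) (hdR : d₀ ≤ R) (hγ : 2 < γ) (k : Fin K) :
    (fun ω => contInterference M (largeScale A₀ d₀ γ loc η ω) k) =ᵐ[P] fun ω =>
      (1 - 1 / (M : ℝ)) *
        ∑' n, pathLoss A₀ d₀ γ (loc k (some n) ω) ^ 2 * |η k (some n) ω| ^ 2 := by
  filter_upwards [h.ae_shadowing_pos, h.ae_summable_largeScale hA hd hdR hγ] with ω hω hs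
  have hpos : ∀ k j, 0 < largeScale A₀ d₀ γ loc η ω k j := fun k j =>
    mul_pos (pathLoss_pos hA hd _) (hω k j)
  rw [contInterference_eq hM (fun k j => (hpos k j).le) (hpos k none) (hs k)]
  simp only [largeScale, mul_pow, sq_abs]

variable [IsProbabilityMeasure P]

/-- Independence across pilots makes the variances add; the second moment is recovered from variance
and mean. -/
lemma moments_sum_reusePower (h : CellularModel P K R lam σ loc η)
    (hlam : lam * Real.pi * R ^ 2 = 1) (hA : 0 < A₀) (hd : 0 < d₀) (hdR : d₀ ≤ R) (hγ : 2 < γ)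
    (s : Finset (Fin K)) {c : ℕ → ℝ} (hc : c = reuseCumulant A₀ d₀ γ R σ) :
    MemLp (fun ω => ∑ k ∈ s, reusePower A₀ d₀ γ loc η k ω) 2 P ∧
      ∫ ω, ∑ k ∈ s, reusePower A₀ d₀ γ loc η k ω ∂P = s.card * c 1 ∧
      ∫ ω, (∑ k ∈ s, reusePower A₀ d₀ γ loc η k ω) ^ 2 ∂P =
        s.card * c 2 + (s.card * c 1) ^ 2 := by
  have hmom := fun k => h.moments_reusePower hlam hA hd hdR hγ k rfl hc
  have hL : ∀ k, MemLp (reusePower A₀ d₀ γ loc η k) 2 P := fun k =>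
    (memLp_two_iff_integrable_sq (h.measurable_reusePower k).aestronglyMeasurable).2
      (hmom k).2.1.1
  have hT : MemLp (fun ω => ∑ k ∈ s, reusePower A₀ d₀ γ loc η k ω) 2 P :=
    memLp_finsetSum s fun k _ => hL k
  have h1 : ∫ ω, ∑ k ∈ s, reusePower A₀ d₀ γ loc η k ω ∂P = s.card * c 1 := by
    rw [integral_finsetSum s fun k _ => (hmom k).1.1]
    simp [fun k => (hmom k).1.2]
  refine ⟨hT, h1, ?_⟩
  have hvar : variance (fun ω => ∑ k ∈ s, reusePower A₀ d₀ γ loc η k ω) P = s.card * c 2 := by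
    have := IndepFun.variance_sum (s := s) (fun k _ => hL k)
      (fun i _ j _ hij => (h.iIndepFun_reusePower (A₀ := A₀) (d₀ := d₀) (γ := γ)).indepFun hij)
    rw [show (fun ω => ∑ k ∈ s, reusePower A₀ d₀ γ loc η k ω) =
      ∑ k ∈ s, reusePower A₀ d₀ γ loc η k by ext ω; simp, this,
      Finset.sum_congr rfl fun k _ => show variance (reusePower A₀ d₀ γ loc η k) P = c 2 by
        rw [variance_eq_sub (hL k)]
        simp only [Pi.pow_apply]
        rw [(hmom k).2.1.2, (hmom k).1.2]
        ring]
    simp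
  rw [variance_eq_sub hT, h1] at hvar
  simp only [Pi.pow_apply] at hvar
  linarith

lemma variance_contInterference (h : CellularModel P K R lam σ loc η) {M : ℕ} (hM : 1 ≤ M)
    (hlam : lam * Real.pi * R ^ 2 = 1) (hA : 0 < A₀) (hd : 0 < d₀) (hdR : d₀ ≤ R) (hγ : 2 < γ)
    (k : Fin K) :
    MemLp (fun ω => contInterference M (largeScale A₀ d₀ γ loc η ω) k) 2 P ∧
      variance (fun ω => contInterference M (largeScale A₀ d₀ γ loc η ω) k) P =
        (1 - 1 / (M : ℝ)) ^ 2 * reuseCumulant A₀ d₀ γ R σ 4 := by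
  have hae := h.contInterference_ae_eq hM hA hd hdR hγ k
  have hmeas := (h.markedReuse k).measurable_tsum (w := fun z => |z| ^ 2)
    (f := fun x => pathLoss A₀ d₀ γ x ^ 2) (by fun_prop) ((measurable_pathLoss A₀ d₀ γ).pow_const 2)
  -- With `p²` and `η²` in place of `p` and `η`, the second cumulant is `∫ p⁴ dΛ · E η⁴`, the fourth
  -- cumulant of `reusePower`. The integrability hypotheses now reach `η⁸`, which the log-normal law
  -- allows.
  have hmom := (h.markedReuse k).moments (w := fun z => |z| ^ 2)
    (f := fun x => pathLoss A₀ d₀ γ x ^ 2) (by fun_prop) (fun z => sq_nonneg _)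
    (fun r _ _ => by simpa only [← pow_mul] using integrable_abs_pow_shadowingLaw σ (2 * r))
    ((measurable_pathLoss A₀ d₀ γ).pow_const 2) (fun x => sq_nonneg _)
    (fun r hr _ => by
      simpa only [← pow_mul] using integrable_pathLoss_pow hd hdR hγ (by omega : 1 ≤ 2 * r))
    (fun r => rfl) rfl
  rw [memLp_congr_ae hae, variance_congr hae]
  have hL := (memLp_two_iff_integrable_sq hmeas.aestronglyMeasurable).2 hmom.2.1.1
  refine ⟨hL.const_mul _, ?_⟩
  rw [variance_const_mul, variance_eq_sub hL]
  simp only [Pi.pow_apply]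
  rw [hmom.2.1.2, hmom.1.2]
  simp only [← pow_mul, add_sub_cancel_right]
  rw [reuseCumulant_eq hlam hd hdR hγ (by norm_num)]

lemma variance_interInterference (h : CellularModel P K R lam σ loc η) {M : ℕ} (hM : 1 ≤ M)
    (hlam : lam * Real.pi * R ^ 2 = 1) (hA : 0 < A₀) (hd : 0 < d₀) (hdR : d₀ ≤ R) (hγ : 2 < γ)
    (k : Fin K) {l μ : ℝ} (hl : l = d₀ / R)
    (hμ : μ = Real.exp (σ ^ 2 / (10 / Real.log 10) ^ 2)) :
    MemLp (fun ω => interInterference M (largeScale A₀ d₀ γ loc η ω) k) 2 P ∧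
      variance (fun ω => interInterference M (largeScale A₀ d₀ γ loc η ω) k) P =
        l ^ (4 * γ) * A₀ ^ 4 * μ ^ 2 / M ^ 2 *
        (μ ^ 6 / (2 * γ - 1)
          + 4 * (γ * l ^ (2 - γ) + 2 * K) * μ ^ 3 / ((3 * γ - 2) * (γ - 2))
          + (K * γ * l ^ (2 - 2 * γ) + 1) * μ ^ 2 / (γ - 1) ^ 2
          + 4 * K * (2 * γ * l ^ (2 - γ) + K * γ * l ^ (2 - 2 * γ) - 1) * μ
              / ((γ - 1) * (γ - 2) ^ 2)
          - 4 * K ^ 2 * (γ * l ^ (2 - γ) - 2) ^ 2 / (γ - 2) ^ 4) := by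
  have hae := h.interInterference_ae_eq hM hA hd hdR hγ k
  have hX1 := h.moments_cellPower hA hd hdR hγ k le_rfl
  have hX2 := h.moments_cellPower hA hd hdR hγ k one_le_two
  have hS := h.moments_reusePower hlam hA hd hdR hγ k rfl rfl
  have hT := h.moments_sum_reusePower hlam hA hd hdR hγ (Finset.univ.erase k) rfl
  simp only [pow_one] at hX1
  have hXL : MemLp (cellPower A₀ d₀ γ loc η k) 2 P :=
    (memLp_two_iff_integrable_sq (h.measurable_cellPower k).aestronglyMeasurable).2 hX2.1
  obtain ⟨hL, hV⟩ := variance_add_mul_add (h.measurable_cellPower k) (h.measurable_reusePower k)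
    (Finset.measurable_sum _ fun k' _ => h.measurable_reusePower k')
    (h.indepFun_cellPower_reusePower k) (h.indepFun_others k) hXL hT.1
    (fun b hb => by
      interval_cases b
      · simp
      · simpa using hS.1.1
      · exact hS.2.1.1
      · exact hS.2.2.1.1
      · exact hS.2.2.2.1)
    hX1.2 hX2.2 hS.1.2 hS.2.1.2 hS.2.2.1.2 hS.2.2.2.2 hT.2.1 hT.2.2
  rw [memLp_congr_ae hae, variance_congr hae]
  refine ⟨hL.const_mul _, ?_⟩
  rw [variance_const_mul, hV, Finset.card_erase_of_mem (Finset.mem_univ k), Finset.card_univ,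
    Fintype.card_fin, Nat.cast_sub (Fin.pos k)]
  have hl0 : 0 < l := hl ▸ div_pos hd (hd.trans_le hdR)
  -- All powers are expressed through `L = l^γ`, `u = l^{2-γ}`, `v = l^{2-2γ}` and `ν = √μ`. The
  -- final identity is rational in these and needs no relation between them.
  have hpow : ∀ r : ℕ, l ^ (r * γ) = (l ^ γ) ^ r := fun r => by
    rw [mul_comm, Real.rpow_mul_natCast hl0.le]
  have h4 : l ^ (4 * γ) = (l ^ γ) ^ 4 := by simpa using hpow 4
  have hμν : μ = Real.exp (σ ^ 2 / (10 / Real.log 10) ^ 2 / 2) ^ 2 := by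
    rw [hμ, ← Real.exp_nat_mul]
    congr 1
    push_cast
    ring
  simp only [reuseCumulant, ← hl, hpow, h4, hμν]
  simp only [Nat.cast_one, Nat.cast_ofNat, one_mul, pow_one]
  generalize Real.exp (σ ^ 2 / (10 / Real.log 10) ^ 2 / 2) = ν
  generalize l ^ γ = L
  generalize l ^ (2 - γ) = u
  generalize l ^ (2 - 2 * γ) = v
  have hM0 : (M : ℝ) ≠ 0 := by positivity
  have g1 : γ - 2 ≠ 0 := by linarith
  have g2 : γ - 1 ≠ 0 := by linarith
  have g3 : 3 * γ - 2 ≠ 0 := by linarith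
  have g4 : 2 * γ - 1 ≠ 0 := by linarith
  -- The cumulant denominators `rγ - 2` for `r = 2, 4` are matched with those of the claim, which
  -- are known to be nonzero.
  rw [show 2 * γ - 2 = 2 * (γ - 1) by ring, show 4 * γ - 2 = 2 * (2 * γ - 1) by ring]
  field_simp
  ring

end CellularModel

end MassiveMIMO

end


theorem proposition4 {Ω : Type*} [MeasurableSpace Ω] (P : Measure Ω) [IsProbabilityMeasure P]
    (K M : ℕ) (hM : 1 ≤ M) (k : Fin K)
    (R lam A₀ d₀ γ σ : ℝ) (hR : 0 < R) (hlam : lam * Real.pi * R ^ 2 = 1)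
    (hA₀ : 0 < A₀) (hd₀ : 0 < d₀) (hd₀R : d₀ ≤ R) (hγ : 2 < γ) (hσ : 0 ≤ σ)
    (loc : Fin K → Option ℕ → Ω → MassiveMIMO.Plane) (η : Fin K → Option ℕ → Ω → ℝ)
    (hmodel : MassiveMIMO.CellularModel P K R lam σ loc η)
    (l ξ μ : ℝ) (hl : l = d₀ / R) (hξ : ξ = 10 / Real.log 10)
    (hμ : μ = Real.exp (σ ^ 2 / ξ ^ 2))
    (Iinter Icont : Ω → ℝ)
    (hIinter : Iinter = fun ω =>
      MassiveMIMO.interInterference M (MassiveMIMO.largeScale A₀ d₀ γ loc η ω) k)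
    (hIcont : Icont = fun ω =>
      MassiveMIMO.contInterference M (MassiveMIMO.largeScale A₀ d₀ γ loc η ω) k) :
    (MemLp Iinter 2 P ∧
      variance Iinter P = l ^ (4 * γ) * A₀ ^ 4 * μ ^ 2 / M ^ 2 *
        (μ ^ 6 / (2 * γ - 1)
          + 4 * (γ * l ^ (2 - γ) + 2 * K) * μ ^ 3 / ((3 * γ - 2) * (γ - 2))
          + (K * γ * l ^ (2 - 2 * γ) + 1) * μ ^ 2 / (γ - 1) ^ 2
          + 4 * K * (2 * γ * l ^ (2 - γ) + K * γ * l ^ (2 - 2 * γ) - 1) * μ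
              / ((γ - 1) * (γ - 2) ^ 2)
          - 4 * K ^ 2 * (γ * l ^ (2 - γ) - 2) ^ 2 / (γ - 2) ^ 4)) ∧
    (MemLp Icont 2 P ∧
      variance Icont P =
        ((M : ℝ) - 1) ^ 2 * l ^ (4 * γ) * A₀ ^ 4 * μ ^ 8 / (M ^ 2 * (2 * γ - 1))) := by
  subst hξ hIinter hIcont
  refine ⟨hmodel.variance_interInterference hM hlam hA₀ hd₀ hd₀R hγ k hl hμ, ?_⟩
  obtain ⟨hL, hV⟩ := hmodel.variance_contInterference hM hlam hA₀ hd₀ hd₀R hγ k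
  refine ⟨hL, ?_⟩
  have hμν : μ = Real.exp (σ ^ 2 / (10 / Real.log 10) ^ 2 / 2) ^ 2 := by
    rw [hμ, ← Real.exp_nat_mul]
    congr 1
    push_cast
    ring
  rw [hV, MassiveMIMO.reuseCumulant, ← hl, hμν]
  have hM0 : (M : ℝ) ≠ 0 := by positivity
  have hγ' : 2 * γ - 1 ≠ 0 := by linarith
  rw [Nat.cast_ofNat, show 4 * γ - 2 = 2 * (2 * γ - 1) by ring]
  field_simp
  norm_num
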